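/- **Theorem.** Let $\mathcal S$ be a pivotal symmetric monoidal category (that is, a ribbon category whose braiding $s$ is symmetric), with tensor unit $1$, and let $H$ be a Hopf algebra in $\mathcal S$ with product $\mu$, unit $\eta$, coproduct $\Delta$, counit $\varepsilon$ and invertible antipode $S$. Let $\mathcal C=\mathcal C_0+\mathcal C_1$ be the disjoint union of $\mathcal C_0=\mathrm{Rep}_{\mathcal S}(H)$ (left $H$-modules in $\mathcal S$) and $\mathcal C_1=\mathcal S$, with the $\mathbb Z/2$-graded tensor product $\ast$ defined as follows, for $A,B\in\mathcal C_0$ and $X,Y\in\mathcal C_1$ (forgetful functors $\mathcal C_0\to\mathcal S$ are suppressed): $$A\ast B=A\otimes B\in\mathcal C_0\ (\text{action via }\Delta),\qquad A\ast Y=A\otimes Y\in\mathcal C_1,\qquad X\ast B=X\otimes B\in\mathcal C_1,\qquad X\ast Y=H\otimes X\otimes Y\in\mathcal C_0\ (\text{action by multiplication on }H).$$ We use Sweedler notation, to be read as morphisms in $\mathcal S$ with the symmetry $s$ inserted wherever factors are permuted; $\gamma=\gamma'\otimes\gamma''$, and $h_1\otimes h_2=\Delta(h)$. Let $\gamma:1\to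 H\otimes H$, $\lambda:H\to 1$ and $g:1\to H$ be morphisms, with $g$ invertible for the product of $H$, such that: 1. $\gamma$ is a Hopf copairing, i.e. $(\Delta\otimes\mathrm{id})\gamma=\gamma_{13}\gamma_{23}$, $(\mathrm{id}\otimes\Delta)\gamma=\gamma_{12}\gamma_{13}$ and $(\varepsilon\otimes\mathrm{id})\gamma=\eta=(\mathrm{id}\otimes\varepsilon)\gamma$, and it is non-degenerate, i.e. it is the coevaluation of a duality between $H$ and $H$; 2. $\lambda$ is a right cointegral, i.e. $(\lambda\otimes\mathrm{id})\Delta=\eta\circ\lambda$; moreover $(\mathrm{id}\otimes\lambda)\Delta=g\circ\lambda$ and $(\lambda\otimes\lambda)(\mathrm{id}\otimes S)\gamma=\mathrm{id}_1$; 3. $s_{H,H}\circ\gamma=(\mathrm{id}\otimes(S^2\circ\mathrm{Ad}_g^{-1}))\circ\gamma$, where $\mathrm{Ad}_g^{-1}(h)=g^{-1}hg$. Then there are isomorphisms $\alpha_{X,Y,Z}:X\ast(Y\ast Z)\to(X\ast Y)\ast Z$ in $\mathcal C$ such that $\mathcal C$ is a monoidal category with tensor product $\ast$, with the trivial $H$-module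 $1\in\mathcal C_0$ as tensor unit, with the unit isomorphisms of $\mathcal S$, and with $\alpha$ (read in the direction above) as associativity isomorphism, and whose underlying morphisms in $\mathcal S$ are the following; the label $abc$ means that the three objects lie in $\mathcal C_a$, $\mathcal C_b$, $\mathcal C_c$, and a dot is the action of $H$ on a module: - $000$, $001$, $100$: the associativity isomorphism of $\mathcal S$; - $010$: $a\otimes x\otimes b\mapsto\gamma'.a\otimes x\otimes\gamma''.b$; - $011$: $a\otimes h\otimes x\otimes y\mapsto h_2\otimes S^{-1}(h_1).a\otimes x\otimes y$; - $101$: $h\otimes x\otimes b\otimes y\mapsto h\gamma''\otimes x\otimes(g\gamma').b\otimes y$; - $110$: $h\otimes x\otimes y\otimes c\mapsto h_1\otimes x\otimes y\otimes h_2.c$; - $111$: $x\otimes h\otimes y\otimes z\mapsto\lambda(\gamma''h)\,S(\gamma')\otimes x\otimes y\otimes z$. In particular these morphisms are isomorphisms (and $H$-linear where source and target lie in $\mathcal C_0$), natural, and satisfy the pentagon and triangle identities. -/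

import Mathlib

open CategoryTheory MonoidalCategory
open scoped MonObj ComonObj HopfObj

universe v u

/-- A pivotal symmetric monoidal category, i.e. a ribbon category whose braiding is symmetric:
a rigid symmetric monoidal category with a twist, that is a natural automorphism of the identity
functor which is balanced and compatible with duals. -/
class PivotalSymmetricCategory (S : Type u) [Category.{v} S] [MonoidalCategory S]
    [SymmetricCategory S] [RigidCategory S] where
  /-- the twist -/
  twist : 𝟭 S ≅ 𝟭 S
  twist_tensor : ∀ X Y : S, twist.hom.app (X ⊗ Y) =
    (β_ X Y).hom ≫ (β_ Y X).hom ≫ (twist.hom.app X ⊗ₘ twist.hom.app Y)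
  twist_dual : ∀ X : S, twist.hom.app (Xᘁ) = rightAdjointMate (twist.hom.app X)

namespace HopfExtension

noncomputable section

variable {S : Type u} [Category.{v} S] [MonoidalCategory S] [SymmetricCategory S]

/-! ### Hopf algebraic data -/

section Data

variable {H : S} [HopfObj H]

/-- Left multiplication `h ↦ x h` with a point `x : 𝟙 ⟶ H`. -/
def leftMul (x : 𝟙_ S ⟶ H) : H ⟶ H := (λ_ H).inv ≫ x ▷ H ≫ μ

/-- Right multiplication `h ↦ h x` with a point `x : 𝟙 ⟶ H`. -/
def rightMul (x : 𝟙_ S ⟶ H) : H ⟶ H := (ρ_ H).inv ≫ H ◁ x ≫ μ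

/-- `x` and `y` are mutually inverse points of the algebra `H`. -/
def IsInversePoints (x y : 𝟙_ S ⟶ H) : Prop :=
  x ≫ leftMul y = η ∧ y ≫ leftMul x = η

/-- `(Δ ⊗ id) γ = γ₁₃ γ₂₃`, `(id ⊗ Δ) γ = γ₁₂ γ₁₃`, `(ε ⊗ id) γ = η = (id ⊗ ε) γ`. Each product
is formed from two copies `γ' ⊗ γ''`, `c' ⊗ c''` of `γ` placed side by side: it is
`γ' ⊗ c' ⊗ γ'' c''` in the first equation and `γ' c' ⊗ γ'' ⊗ c''` in the second. -/
structure IsHopfCopairing (cop : 𝟙_ S ⟶ H ⊗ H) : Prop where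
  comul_left : cop ≫ Δ ▷ H =
    (λ_ (𝟙_ S)).inv ≫ (cop ⊗ₘ cop) ≫ tensorμ H H H H ≫ (H ⊗ H) ◁ μ
  comul_right : cop ≫ H ◁ Δ =
    (λ_ (𝟙_ S)).inv ≫ (cop ⊗ₘ cop) ≫ tensorμ H H H H ≫ μ ▷ (H ⊗ H)
  counit_left : cop ≫ ε ▷ H ≫ (λ_ H).hom = η
  counit_right : cop ≫ H ◁ ε ≫ (ρ_ H).hom = η

/-- `γ` is non-degenerate: it is the coevaluation of a duality between `H` and itself. -/
def IsNondegenerate (cop : 𝟙_ S ⟶ H ⊗ H) : Prop :=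
  ∃ p : ExactPairing H H, p.coevaluation' = cop

/-- `(lam ⊗ id) Δ = η ∘ lam`. -/
def IsRightCointegral (lam : H ⟶ 𝟙_ S) : Prop :=
  Δ ≫ lam ▷ H ≫ (λ_ H).hom = lam ≫ η

end Data

/-! ### The category `C = Rep(H) + S` and its graded tensor product -/

section Category

variable (H : S) [HopfObj H]

/-- The disjoint union of the category of left `H`-modules in `S` (grade `0`) and of `S`
(grade `1`). -/
abbrev Ext := Mod S H ⊕ S

variable {H}

/-- The action `H ⊗ A ⟶ A` of `H` on a module. -/
def act (A : Mod S H) : H ⊗ A.X ⟶ A.X := ModObj.smul (M := H) (X := A.X)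

variable (H) in
/-- The trivial module: the unit object with the action through the counit. -/
def trivialModule : Mod S H :=
  letI : ModObj H (𝟙_ S) :=
    { smul := (ρ_ H).hom ≫ ε
      one_smul := by
        have h : η[H] ▷ 𝟙_ S ≫ (ρ_ H).hom ≫ ε[H] = (λ_ (𝟙_ S)).hom := by
          rw [rightUnitor_naturality_assoc, BimonObj.one_counit, Category.comp_id, unitors_equal]
        exact h
      mul_smul := by
        have h : μ[H] ▷ 𝟙_ S ≫ (ρ_ H).hom ≫ ε[H] =
            (α_ H H (𝟙_ S)).hom ≫ H ◁ ((ρ_ H).hom ≫ ε[H]) ≫ (ρ_ H).hom ≫ ε[H] := by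
          rw [rightUnitor_naturality_assoc, Bimon.mul_counit, tensorHom_def']
          simp [unitors_equal]
        exact h }
  ⟨𝟙_ S⟩

/-- The tensor product of two modules, with the action via the coproduct. -/
def tensorModule (A B : Mod S H) : Mod S H :=
  letI : ModObj H (A.X ⊗ B.X) :=
    { smul := Δ ▷ (A.X ⊗ B.X) ≫ tensorμ H H A.X B.X ≫ (act A ⊗ₘ act B)
      one_smul := by
        have hA : η[H] ▷ A.X ≫ act A = (λ_ A.X).hom := ModObj.one_smul_self H A.X
        have hB : η[H] ▷ B.X ≫ act B = (λ_ B.X).hom := ModObj.one_smul_self H B.X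
        have h : η[H] ▷ (A.X ⊗ B.X) ≫ Δ ▷ (A.X ⊗ B.X) ≫ tensorμ H H A.X B.X ≫
            (act A ⊗ₘ act B) = (λ_ (A.X ⊗ B.X)).hom := by
          rw [← comp_whiskerRight_assoc, Bimon.one_comul, comp_whiskerRight_assoc,
            tensorμ_natural_left_assoc, tensorHom_comp_tensorHom, hA, hB]
          exact (tensor_left_unitality A.X B.X).symm
        exact h
      mul_smul := by
        have hA : μ[H] ▷ A.X ≫ act A = (α_ H H A.X).hom ≫ H ◁ act A ≫ act A :=
          ModObj.mul_smul_self H A.X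
        have hB : μ[H] ▷ B.X ≫ act B = (α_ H H B.X).hom ≫ H ◁ act B ≫ act B :=
          ModObj.mul_smul_self H B.X
        have h : μ[H] ▷ (A.X ⊗ B.X) ≫ Δ ▷ (A.X ⊗ B.X) ≫ tensorμ H H A.X B.X ≫
              (act A ⊗ₘ act B) =
            (α_ H H (A.X ⊗ B.X)).hom ≫
              H ◁ (Δ ▷ (A.X ⊗ B.X) ≫ tensorμ H H A.X B.X ≫ (act A ⊗ₘ act B)) ≫
              Δ ▷ (A.X ⊗ B.X) ≫ tensorμ H H A.X B.X ≫ (act A ⊗ₘ act B) := by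
          rw [← comp_whiskerRight_assoc, BimonObj.mul_comul]
          simp only [comp_whiskerRight, Category.assoc]
          rw [tensorμ_natural_left_assoc, tensorHom_comp_tensorHom, hA, hB,
            ← tensorHom_comp_tensorHom, ← tensorHom_comp_tensorHom,
            tensor_associativity_assoc]
          simp only [whiskerLeft_comp, Category.assoc]
          rw [← tensorμ_natural_right_assoc, tensorHom_def (Δ[H]) (Δ[H]),
            comp_whiskerRight_assoc, associator_naturality_middle_assoc,
            associator_naturality_left_assoc]
          congr 1
          simp only [whisker_exchange_assoc]
        exact h }
  ⟨A.X ⊗ B.X⟩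

variable (H) in
/-- The free module `H ⊗ X`, with the action by multiplication. -/
def freeModule (X : S) : Mod S H :=
  letI : ModObj H (H ⊗ X) :=
    { smul := (α_ H H X).inv ≫ μ ▷ X
      one_smul := by
        have h : η[H] ▷ (H ⊗ X) ≫ (α_ H H X).inv ≫ μ[H] ▷ X = (λ_ (H ⊗ X)).hom := by
          rw [associator_inv_naturality_left_assoc, ← comp_whiskerRight, MonObj.one_mul]
          simp
        exact h
      mul_smul := by
        have h : μ[H] ▷ (H ⊗ X) ≫ (α_ H H X).inv ≫ μ[H] ▷ X =
            (α_ H H (H ⊗ X)).hom ≫ H ◁ ((α_ H H X).inv ≫ μ[H] ▷ X) ≫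
              (α_ H H X).inv ≫ μ[H] ▷ X := by
          rw [associator_inv_naturality_left_assoc, ← comp_whiskerRight, MonObj.mul_assoc]
          simp
        exact h }
  ⟨H ⊗ X⟩

/-- The graded tensor product of objects. -/
def starObj : Ext H → Ext H → Ext H
  | .inl A, .inl B => .inl (tensorModule A B)
  | .inl A, .inr Y => .inr (A.X ⊗ Y)
  | .inr X, .inl B => .inr (X ⊗ B.X)
  | .inr X, .inr Y => .inl (freeModule H (X ⊗ Y))

/-- The tensor product of two module morphisms. -/
def tensorModuleHom {A A' B B' : Mod S H} (f : A ⟶ A') (g : B ⟶ B') :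
    tensorModule A B ⟶ tensorModule A' B' :=
  Mod.Hom.mk' (f.hom ⊗ₘ g.hom) (by
    have hf : act A ≫ f.hom = H ◁ f.hom ≫ act A' := f.isModHom.smul_hom
    have hg : act B ≫ g.hom = H ◁ g.hom ≫ act B' := g.isModHom.smul_hom
    have h : (Δ[H] ▷ (A.X ⊗ B.X) ≫ tensorμ H H A.X B.X ≫ (act A ⊗ₘ act B)) ≫
          (f.hom ⊗ₘ g.hom) =
        H ◁ (f.hom ⊗ₘ g.hom) ≫
          Δ[H] ▷ (A'.X ⊗ B'.X) ≫ tensorμ H H A'.X B'.X ≫ (act A' ⊗ₘ act B') := by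
      simp only [Category.assoc, tensorHom_comp_tensorHom, hf, hg]
      rw [← tensorHom_comp_tensorHom, ← tensorμ_natural_right_assoc, whisker_exchange_assoc]
    exact h)

/-- The map `H ⊗ f` of free modules. -/
def freeModuleHom {X X' : S} (f : X ⟶ X') : freeModule H X ⟶ freeModule H X' :=
  Mod.Hom.mk' (H ◁ f) (by
    have h : ((α_ H H X).inv ≫ μ[H] ▷ X) ≫ H ◁ f =
        H ◁ H ◁ f ≫ (α_ H H X').inv ≫ μ[H] ▷ X' := by
      rw [Category.assoc, ← whisker_exchange]
      simp
    exact h)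

/-- The graded tensor product of morphisms. -/
def starHom : {X X' Y Y' : Ext H} → (X ⟶ X') → (Y ⟶ Y') → (starObj X Y ⟶ starObj X' Y')
  | .inl _, .inl _, .inl _, .inl _, f, g => ⟨tensorModuleHom f.down g.down⟩
  | .inl _, .inl _, .inr _, .inr _, f, g => ⟨f.down.hom ⊗ₘ g.down⟩
  | .inr _, .inr _, .inl _, .inl _, f, g => ⟨f.down ⊗ₘ g.down.hom⟩
  | .inr _, .inr _, .inr _, .inr _, f, g => ⟨freeModuleHom (f.down ⊗ₘ g.down)⟩

variable (H) in
/-- The tensor unit: the trivial module in grade `0`. -/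
def starUnit : Ext H := .inl (trivialModule H)

/-- An isomorphism in `S` between modules which is `H`-linear is an isomorphism of modules. -/
def mkModIso {A B : Mod S H} (e : A.X ≅ B.X) (h : act A ≫ e.hom = H ◁ e.hom ≫ act B) : A ≅ B where
  hom := Mod.Hom.mk' e.hom h
  inv := Mod.Hom.mk' e.inv (by
    have h' : act B ≫ e.inv = H ◁ e.inv ≫ act A := by
      rw [Iso.comp_inv_eq, Category.assoc, h, ← whiskerLeft_comp_assoc]
      simp
    exact h')
  hom_inv_id := Mod.hom_ext _ _ e.hom_inv_id
  inv_hom_id := Mod.hom_ext _ _ e.inv_hom_id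

/-- The left unitor, given by the one of `S`. -/
def starLeftUnitor : (X : Ext H) → (starObj (starUnit H) X ≅ X)
  | .inl A => (Sum.inl_ (Mod S H) S).mapIso (mkModIso (A := tensorModule (trivialModule H) A)
      (λ_ A.X) (by
        have h : (Δ[H] ▷ (𝟙_ S ⊗ A.X) ≫ tensorμ H H (𝟙_ S) A.X ≫
              (((ρ_ H).hom ≫ ε[H]) ⊗ₘ act A)) ≫ (λ_ A.X).hom =
            H ◁ (λ_ A.X).hom ≫ act A := by
          have e : ((ρ_ H).hom ≫ ε[H]) ⊗ₘ act A =
              ((ε[H] ▷ 𝟙_ S) ⊗ₘ (𝟙 H ▷ A.X)) ≫ ((ρ_ (𝟙_ S)).hom ⊗ₘ act A) := by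
            rw [tensorHom_comp_tensorHom, rightUnitor_naturality, id_whiskerRight,
              Category.id_comp]
          rw [e, Category.assoc, Category.assoc, Category.assoc, ← tensorμ_natural_left_assoc,
            ← comp_whiskerRight_assoc, tensorHom_id, ComonObj.counit_comul, tensorHom_def']
          simp [tensorμ]
        exact h))
  | .inr X => (Sum.inr_ (Mod S H) S).mapIso (λ_ X)

/-- The right unitor, given by the one of `S`. -/
def starRightUnitor : (X : Ext H) → (starObj X (starUnit H) ≅ X)
  | .inl A => (Sum.inl_ (Mod S H) S).mapIso (mkModIso (A := tensorModule A (trivialModule H))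
      (ρ_ A.X) (by
        have h : (Δ[H] ▷ (A.X ⊗ 𝟙_ S) ≫ tensorμ H H A.X (𝟙_ S) ≫
              (act A ⊗ₘ ((ρ_ H).hom ≫ ε[H]))) ≫ (ρ_ A.X).hom =
            H ◁ (ρ_ A.X).hom ≫ act A := by
          have e : act A ⊗ₘ ((ρ_ H).hom ≫ ε[H]) =
              ((𝟙 H ▷ A.X) ⊗ₘ (ε[H] ▷ 𝟙_ S)) ≫ (act A ⊗ₘ (ρ_ (𝟙_ S)).hom) := by
            rw [tensorHom_comp_tensorHom, rightUnitor_naturality, id_whiskerRight,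
              Category.id_comp]
          rw [e, Category.assoc, Category.assoc, Category.assoc, ← tensorμ_natural_left_assoc,
            ← comp_whiskerRight_assoc, id_tensorHom, ComonObj.comul_counit, tensorHom_def']
          simp [tensorμ]
        exact h))
  | .inr X => (Sum.inr_ (Mod S H) S).mapIso (ρ_ X)

/-- The monoidal structure data on `C` with tensor product `∗`, the trivial module as tensor unit,
the unitors of `S`, and a given family of isomorphisms as associator. -/
abbrev starStruct
    (a : ∀ X Y Z : Ext H, starObj (starObj X Y) Z ≅ starObj X (starObj Y Z)) :
    MonoidalCategoryStruct (Ext H) where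
  tensorObj := starObj
  whiskerLeft X _ _ f := starHom (𝟙 X) f
  whiskerRight f Y := starHom f (𝟙 Y)
  tensorHom := starHom
  tensorUnit := starUnit H
  associator := a
  leftUnitor := starLeftUnitor
  rightUnitor := starRightUnitor

variable (H) in
/-- The functor from `C` to `S` which forgets the `H`-action in grade `0` and is the identity in
grade `1`. -/
abbrev forgetGrade : Ext H ⥤ S := (Mod.forget H).sum' (𝟭 S)

end Category

/-! ### The associativity morphisms -/

section Associator

variable {H : S} [HopfObj H]

/-- For a point `c' ⊗ c''` of `H ⊗ H` and morphisms `a : H ⊗ M ⟶ M`, `b : H ⊗ N ⟶ N`: the morphism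
`m ⊗ n ↦ a (c' ⊗ m) ⊗ b (c'' ⊗ n)`. -/
def insertAct (c : 𝟙_ S ⟶ H ⊗ H) {M N : S} (a : H ⊗ M ⟶ M) (b : H ⊗ N ⟶ N) :
    M ⊗ N ⟶ M ⊗ N :=
  (λ_ (M ⊗ N)).inv ≫ c ▷ (M ⊗ N) ≫ tensorμ H H M N ≫ (a ⊗ₘ b)

/-- `a ⊗ x ⊗ b ↦ γ'.a ⊗ x ⊗ γ''.b`. -/
def assoc010 (cop : 𝟙_ S ⟶ H ⊗ H) (A : Mod S H) (X : S) (B : Mod S H) :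
    A.X ⊗ (X ⊗ B.X) ⟶ (A.X ⊗ X) ⊗ B.X :=
  (α_ A.X X B.X).inv ≫ insertAct cop ((α_ H A.X X).inv ≫ act A ▷ X) (act B)

/-- `a ⊗ h ↦ h₂ ⊗ S⁻¹(h₁).a`. -/
def moveH [IsIso (HopfObj.antipode (X := H))] (A : Mod S H) : A.X ⊗ H ⟶ H ⊗ A.X :=
  (β_ A.X H).hom ≫ (Δ ≫ (β_ H H).hom) ▷ A.X ≫ (α_ H H A.X).hom ≫
    H ◁ (inv (HopfObj.antipode (X := H)) ▷ A.X ≫ act A)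

/-- `a ⊗ h ⊗ x ⊗ y ↦ h₂ ⊗ S⁻¹(h₁).a ⊗ x ⊗ y`. -/
def assoc011 [IsIso (HopfObj.antipode (X := H))] (A : Mod S H) (X Y : S) :
    A.X ⊗ (H ⊗ (X ⊗ Y)) ⟶ H ⊗ ((A.X ⊗ X) ⊗ Y) :=
  (α_ A.X H (X ⊗ Y)).inv ≫ moveH A ▷ (X ⊗ Y) ≫ (α_ H A.X (X ⊗ Y)).hom ≫
    H ◁ (α_ A.X X Y).inv

/-- `h ⊗ x ⊗ b ⊗ y ↦ h γ'' ⊗ x ⊗ (g γ').b ⊗ y`. -/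
def assoc101 (cop : 𝟙_ S ⟶ H ⊗ H) (g : 𝟙_ S ⟶ H) (X : S) (B : Mod S H) (Y : S) :
    H ⊗ (X ⊗ (B.X ⊗ Y)) ⟶ H ⊗ ((X ⊗ B.X) ⊗ Y) :=
  H ◁ (α_ X B.X Y).inv ≫
    insertAct (cop ≫ (β_ H H).hom ≫ H ◁ leftMul g)
      ((β_ H H).hom ≫ μ)
      ((α_ H (X ⊗ B.X) Y).inv ≫
        ((α_ H X B.X).inv ≫ (β_ H X).hom ▷ B.X ≫ (α_ X H B.X).hom ≫ X ◁ act B) ▷ Y)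

/-- `h ⊗ x ⊗ y ⊗ c ↦ h₁ ⊗ x ⊗ y ⊗ h₂.c`. -/
def assoc110 (X Y : S) (C : Mod S H) :
    H ⊗ (X ⊗ (Y ⊗ C.X)) ⟶ (H ⊗ (X ⊗ Y)) ⊗ C.X :=
  (Δ ⊗ₘ (α_ X Y C.X).inv) ≫ tensorμ H H (X ⊗ Y) C.X ≫ (H ⊗ (X ⊗ Y)) ◁ act C

/-- `h ↦ lam(γ'' h) S(γ')`. -/
def fourier (cop : 𝟙_ S ⟶ H ⊗ H) (lam : H ⟶ 𝟙_ S) : H ⟶ H :=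
  (λ_ H).inv ≫ cop ▷ H ≫ (α_ H H H).hom ≫ H ◁ (μ ≫ lam) ≫ (ρ_ H).hom ≫ HopfObj.antipode

/-- `x ⊗ h ⊗ y ⊗ z ↦ lam(γ'' h) S(γ') ⊗ x ⊗ y ⊗ z`. -/
def assoc111 (cop : 𝟙_ S ⟶ H ⊗ H) (lam : H ⟶ 𝟙_ S) (X Y Z : S) :
    X ⊗ (H ⊗ (Y ⊗ Z)) ⟶ (H ⊗ (X ⊗ Y)) ⊗ Z :=
  X ◁ (fourier cop lam ▷ (Y ⊗ Z)) ≫ (α_ X H (Y ⊗ Z)).inv ≫ (β_ X H).hom ▷ (Y ⊗ Z) ≫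
    (α_ H X (Y ⊗ Z)).hom ≫ H ◁ (α_ X Y Z).inv ≫ (α_ H (X ⊗ Y) Z).inv

/-- The morphisms in `S` underlying the associativity isomorphisms
`X ∗ (Y ∗ Z) ⟶ (X ∗ Y) ∗ Z`. -/
def assocMor [IsIso (HopfObj.antipode (X := H))]
    (cop : 𝟙_ S ⟶ H ⊗ H) (lam : H ⟶ 𝟙_ S) (g : 𝟙_ S ⟶ H) :
    (X Y Z : Ext H) → ((forgetGrade H).obj (starObj X (starObj Y Z)) ⟶
      (forgetGrade H).obj (starObj (starObj X Y) Z))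
  | .inl A, .inl B, .inl C => (α_ A.X B.X C.X).inv
  | .inl A, .inl B, .inr Z => (α_ A.X B.X Z).inv
  | .inl A, .inr Y, .inl C => assoc010 cop A Y C
  | .inr X, .inl B, .inl C => (α_ X B.X C.X).inv
  | .inl A, .inr Y, .inr Z => assoc011 A Y Z
  | .inr X, .inl B, .inr Z => assoc101 cop g X B Z
  | .inr X, .inr Y, .inl C => assoc110 X Y C
  | .inr X, .inr Y, .inr Z => assoc111 cop lam X Y Z

end Associator

end

end HopfExtension

/-! The forgetful functor from `C` to `S` is faithful, so naturality, linearity, pentagon and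
triangle are equations between morphisms of `S`. Sorted by grade they become identities between Hopf
algebra expressions. With at most one odd object they are coherence of `S`, the two coproduct axioms
of γ, or the counit axioms. With more odd objects they are coassociativity, antipode laws, the
grouplike property of `g`, conjugated inverses of γ, and the exchange rules of the Fourier transform
F(h) = λ(γ''h) S(γ').

The centre is the formula F(g F(h)) = S⁻¹(h) (`fourierGrpFourier`). It makes F, hence the associator
111, invertible, and together with F(h₁) ⊗ h₂ = γ'F(h) ⊗ γ'' (`fourierComul`) it gives the pentagon
1111. Its proof runs as follows. By non-degeneracy the right cointegral λ yields a right integral R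
= λ(γ')γ''. The normalization makes R and λ dual to each other: λ(x S(R₂)) S²(R₁) = x
(`integralDual`). Testing against λ gives the symmetry R₂ ⊗ R₁ = g⁻¹S²(R₁) ⊗ R₂ (`integralBraid`).
Read through the duality this is a Nakayama-type rule moving γ' across an argument of λ (`lamCop`),
and with the symmetry of γ it becomes S(γ')λ(γ''y) = g⁻¹S(γ'')λ(yγ') (`antiLamCop`). This rule turns
F(g F(h)) into an expression in the integral of the twisted cointegral λ(g S(-)), which is then
evaluated.

Calculations in Sweedler notation are made rigorous by string diagrams whose wires carry distinct
names. Between two orderings of distinct wires there is only one composite of symmetries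
(`IsPerm.unique`). Hence a list of operations with named inputs and outputs determines a morphism,
independently of the order in which independent operations are performed (`Sem.unique`). An
equational proof is then a list of rewriting steps on such lists. Its correctness is a finite
combinatorial check, carried out by kernel computation, and `Term.eval_eq_of_steps` transfers the
result to the morphisms of `S`. -/

namespace HopfExtension

/-! ### Coherence for permutations of tensor factors -/

section Coherence

variable {S : Type u} [Category.{v} S] [MonoidalCategory S] [SymmetricCategory S]
variable {N : Type} (ob : N → S)

/-- The tensor product of a list of labelled wires. -/
@[reducible] def listTensor : List N → S
  | [] => 𝟙_ S
  | a :: l => ob a ⊗ listTensor l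

/-- Exchanging the first two tensor factors. -/
def swapFront (X Y Z : S) : X ⊗ (Y ⊗ Z) ⟶ Y ⊗ (X ⊗ Z) :=
  (α_ X Y Z).inv ≫ (β_ X Y).hom ▷ Z ≫ (α_ Y X Z).hom

lemma swapFront_naturality {X X' Y Y' Z Z' : S} (f : X ⟶ X') (g : Y ⟶ Y') (h : Z ⟶ Z') :
    (f ⊗ₘ g ⊗ₘ h) ≫ swapFront X' Y' Z' = swapFront X Y Z ≫ (g ⊗ₘ f ⊗ₘ h) := by
  simp only [swapFront, Category.assoc]
  rw [associator_inv_naturality_assoc, ← associator_naturality, tensorHom_def (f ⊗ₘ g),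
    tensorHom_def (g ⊗ₘ f), Category.assoc, whisker_exchange_assoc, ← comp_whiskerRight_assoc,
    BraidedCategory.braiding_naturality, comp_whiskerRight_assoc, Category.assoc]

lemma swapFront_naturality_right {X Y Z Z' : S} (h : Z ⟶ Z') :
    X ◁ Y ◁ h ≫ swapFront X Y Z' = swapFront X Y Z ≫ Y ◁ X ◁ h := by
  simpa using swapFront_naturality (𝟙 X) (𝟙 Y) h

@[simp]
lemma swapFront_swapFront (X Y Z : S) : swapFront X Y Z ≫ swapFront Y X Z = 𝟙 _ := by
  simp [swapFront, ← comp_whiskerRight_assoc]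

@[simp]
lemma swapFront_swapFront_assoc (X Y Z : S) {W : S} (h : X ⊗ (Y ⊗ Z) ⟶ W) :
    swapFront X Y Z ≫ swapFront Y X Z ≫ h = h := by
  rw [← Category.assoc, swapFront_swapFront, Category.id_comp]

/-- The Yang–Baxter equation of the braiding, whiskered with the idle factor `W`; the rest is moving
associators. -/
lemma swapFront_yang_baxter (X Y Z W : S) :
    swapFront X Y (Z ⊗ W) ≫ Y ◁ swapFront X Z W ≫ swapFront Y Z (X ⊗ W) =
      X ◁ swapFront Y Z W ≫ swapFront X Z (Y ⊗ W) ≫ Z ◁ swapFront X Y W := by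
  have h := congrArg (fun f => 𝟙 (X ⊗ Y ⊗ Z ⊗ W) ⊗≫ f ▷ W ⊗≫ 𝟙 (Z ⊗ Y ⊗ X ⊗ W))
    (BraidedCategory.yang_baxter' X Y Z)
  calc
    _ = 𝟙 (X ⊗ Y ⊗ Z ⊗ W) ⊗≫ ((β_ X Y).hom ▷ Z ⊗≫ Y ◁ (β_ X Z).hom ⊗≫ (β_ Y Z).hom ▷ X) ▷ W ⊗≫
        𝟙 (Z ⊗ Y ⊗ X ⊗ W) := by simp only [swapFront]; monoidal
    _ = _ := h
    _ = _ := by simp only [swapFront]; monoidal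

/-- `f` is a composite of symmetries, permuting the wires `l` into `l'`. -/
inductive IsPerm : (l l' : List N) → (listTensor ob l ⟶ listTensor ob l') → Prop
  | nil : IsPerm [] [] (𝟙 _)
  | cons (a : N) {l l' : List N} {f} : IsPerm l l' f → IsPerm (a :: l) (a :: l') (ob a ◁ f)
  | swap (a b : N) (l : List N) :
      IsPerm (a :: b :: l) (b :: a :: l) (swapFront (ob a) (ob b) (listTensor ob l))
  | trans {l l' l'' : List N} {f g} : IsPerm l l' f → IsPerm l' l'' g → IsPerm l l'' (f ≫ g)

/-- `f` inserts the wire `a` into `l`, giving `l'`. -/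
inductive IsInsertion (a : N) : (l l' : List N) → (ob a ⊗ listTensor ob l ⟶ listTensor ob l') → Prop
  | head (l : List N) : IsInsertion a l (a :: l) (𝟙 _)
  | tail (b : N) {l l' : List N} {f} : IsInsertion a l l' f →
      IsInsertion a (b :: l) (b :: l') (swapFront (ob a) (ob b) (listTensor ob l) ≫ ob b ◁ f)

variable {ob}

lemma IsPerm.refl (l : List N) : IsPerm ob l l (𝟙 _) := by
  induction l with
  | nil => exact .nil
  | cons a l ih => simpa using! IsPerm.cons a ih

lemma IsPerm.perm {l l' : List N} {f} (h : IsPerm ob l l' f) : l.Perm l' := by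
  induction h with
  | nil => exact .nil
  | cons a _ ih => exact .cons a ih
  | swap a b l => exact .swap b a l
  | trans _ _ ih ih' => exact ih.trans ih'

lemma IsPerm.exists_of_perm {l l' : List N} (h : l.Perm l') : ∃ f, IsPerm ob l l' f := by
  induction h with
  | nil => exact ⟨_, .nil⟩
  | cons a _ ih => obtain ⟨f, hf⟩ := ih; exact ⟨_, .cons a hf⟩
  | swap a b l => exact ⟨_, .swap b a l⟩
  | trans _ _ ih ih' =>
    obtain ⟨f, hf⟩ := ih
    obtain ⟨g, hg⟩ := ih'
    exact ⟨_, .trans hf hg⟩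

lemma IsInsertion.mem {a : N} {l l' : List N} {f} (h : IsInsertion ob a l l' f) : a ∈ l' := by
  induction h with
  | head l => simp
  | tail b _ ih => simp [ih]

/-- Without repetitions, `l'` itself shows at which position `a` was inserted. -/
lemma IsInsertion.unique {a : N} {l l' : List N} {f} (h : IsInsertion ob a l l' f)
    (hl : l'.Nodup) {m : List N} {f'} (h' : IsInsertion ob a m l' f') :
    l = m ∧ f ≍ f' := by
  induction h generalizing m with
  | head l =>
    cases h' with
    | head => exact ⟨rfl, .rfl⟩
    | tail b h' => exact absurd h'.mem (List.nodup_cons.1 hl).1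
  | tail b h ih =>
    cases h' with
    | head => exact absurd h.mem (List.nodup_cons.1 hl).1
    | tail b h' =>
      obtain ⟨rfl, h⟩ := ih (List.nodup_cons.1 hl).2 h'
      obtain rfl := eq_of_heq h
      exact ⟨rfl, .rfl⟩

/-- The normal form of a permutation: first permute the wires other than `a`, then insert `a`. An
insertion is pushed through the generators one at a time. -/
lemma IsPerm.exists_insertion {l l' : List N} {f} (h : IsPerm ob l l' f) {a : N} {m : List N} {i}
    (hi : IsInsertion ob a m l i) : ∃ (m' : List N) (k : _) (i' : _), IsPerm ob m m' k ∧
      IsInsertion ob a m' l' i' ∧ i ≫ f = ob a ◁ k ≫ i' := by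
  induction h generalizing m with
  | nil => cases hi
  | @cons b l l' f hf ih =>
    cases hi with
    | head => exact ⟨_, _, _, hf, .head _, by simp⟩
    | tail b hi =>
      obtain ⟨m', k, i', hk, hi', h⟩ := ih hi
      refine ⟨_, _, _, .cons b hk, .tail b hi', ?_⟩
      rw [Category.assoc, ← whiskerLeft_comp, h, whiskerLeft_comp]
      exact ((reassoc_of% swapFront_naturality_right) _ _).symm
  -- If `a` is one of the two exchanged wires, the exchange either lengthens the insertion or
  -- cancels its last crossing. If `a` has passed both, the Yang–Baxter equation applies.
  | swap b c l =>
    cases hi with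
    | head => exact ⟨_, _, _, .refl _, .tail c (.head _), by simp [listTensor]⟩
    | tail b hi =>
      cases hi with
      | head => exact ⟨_, _, _, .refl _, .head _, by simp [listTensor]⟩
      | tail c hi =>
        refine ⟨_, _, _, .swap b c _, .tail c (.tail b hi), ?_⟩
        simp only [whiskerLeft_comp, Category.assoc]
        rw [swapFront_naturality_right]
        exact (reassoc_of% swapFront_yang_baxter (ob a) (ob b) (ob c)) _ _
  | trans _ _ ih ih' =>
    obtain ⟨m', k, i', hk, hi', h⟩ := ih hi
    obtain ⟨m'', k', i'', hk', hi'', h'⟩ := ih' hi'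
    exact ⟨_, _, _, .trans hk hk', hi'', by rw [reassoc_of% h, h', whiskerLeft_comp_assoc]⟩

lemma IsPerm.eq_id {f} (h : IsPerm ob ([] : List N) [] f) : f = 𝟙 _ := by
  -- Induction on `IsPerm` needs variable endpoints, whence the heterogeneous equality.
  have aux : ∀ {l l' : List N} {f}, IsPerm ob l l' f → l = [] → f ≍ 𝟙 (listTensor ob l) := by
    intro l l' f h
    induction h with
    | nil => intro _; rfl
    | cons => intro h; simp at h
    | swap => intro h; simp at h
    | @trans l l' l'' f g hf hg ih ih' =>
      rintro rfl
      obtain rfl := hf.perm.nil_eq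
      obtain rfl := hg.perm.nil_eq
      rw [eq_of_heq (ih rfl), eq_of_heq (ih' rfl)]
      simp
  exact eq_of_heq (aux h rfl)

/-- Symmetric coherence: on pairwise distinct wires a permutation determines its morphism. -/
theorem IsPerm.unique {l l' : List N} {f f'} (hl : l.Nodup) (h : IsPerm ob l l' f)
    (h' : IsPerm ob l l' f') : f = f' := by
  induction l generalizing l' with
  | nil =>
    obtain rfl := h.perm.nil_eq
    rw [h.eq_id, h'.eq_id]
  | cons a l ih =>
    -- Both morphisms are put in normal form with respect to `a`. The insertions agree because the
    -- wires are distinct, the remaining permutations by induction.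
    obtain ⟨m, k, i, hk, hi, e⟩ := h.exists_insertion (.head l)
    obtain ⟨m', k', i', hk', hi', e'⟩ := h'.exists_insertion (.head l)
    obtain ⟨rfl, e''⟩ := hi.unique (h.perm.nodup hl) hi'
    obtain rfl := eq_of_heq e''
    obtain rfl := ih (List.nodup_cons.1 hl).2 hk hk'
    rw [← Category.id_comp f, ← Category.id_comp f']
    exact e.trans e'.symm

end Coherence

/-! ### Juxtaposition of lists of wires -/

section Append

variable {S : Type u} [Category.{v} S] [MonoidalCategory S]
variable {N : Type} {ob : N → S}

variable (ob) in
/-- The tensor product of a concatenation. -/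
def appendIso : (l m : List N) → (listTensor ob (l ++ m) ≅ listTensor ob l ⊗ listTensor ob m)
  | [], m => (λ_ (listTensor ob m)).symm
  | a :: l, m => whiskerLeftIso (ob a) (appendIso l m) ≪≫ (α_ _ _ _).symm

/-- `f` next to the idle wires `m`. -/
def padRight {l l' : List N} (f : listTensor ob l ⟶ listTensor ob l') (m : List N) :
    listTensor ob (l ++ m) ⟶ listTensor ob (l' ++ m) :=
  (appendIso ob l m).hom ≫ f ▷ listTensor ob m ≫ (appendIso ob l' m).inv

/-- The idle wires `l` next to `f`. -/
def padLeft (l : List N) {m m' : List N} (f : listTensor ob m ⟶ listTensor ob m') :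
    listTensor ob (l ++ m) ⟶ listTensor ob (l ++ m') :=
  (appendIso ob l m).hom ≫ listTensor ob l ◁ f ≫ (appendIso ob l m').inv

@[simp]
lemma padRight_id (l m : List N) : padRight (𝟙 (listTensor ob l)) m = 𝟙 _ := by simp [padRight]

lemma padRight_comp {l l' l'' : List N} (f : listTensor ob l ⟶ listTensor ob l')
    (g : listTensor ob l' ⟶ listTensor ob l'') (m : List N) :
    padRight (f ≫ g) m = padRight f m ≫ padRight g m := by simp [padRight]

lemma padLeft_comp (l : List N) {m m' m'' : List N} (f : listTensor ob m ⟶ listTensor ob m')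
    (g : listTensor ob m' ⟶ listTensor ob m'') :
    padLeft l (f ≫ g) = padLeft l f ≫ padLeft l g := by simp [padLeft]

lemma padLeft_padRight {l l' m m' : List N} (f : listTensor ob l ⟶ listTensor ob l')
    (g : listTensor ob m ⟶ listTensor ob m') :
    padLeft l g ≫ padRight f m' = padRight f m ≫ padLeft l' g := by
  simp [padRight, padLeft, whisker_exchange_assoc]

variable (ob) in
/-- Reassociation of a concatenation. -/
def appendAssoc (l m k : List N) :
    listTensor ob (l ++ m ++ k) ≅ listTensor ob (l ++ (m ++ k)) :=
  appendIso ob (l ++ m) k ≪≫ whiskerRightIso (appendIso ob l m) _ ≪≫ α_ _ _ _ ≪≫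
    whiskerLeftIso _ (appendIso ob m k).symm ≪≫ (appendIso ob l (m ++ k)).symm

lemma padRight_padRight {l l' : List N} (f : listTensor ob l ⟶ listTensor ob l') (m k : List N) :
    (appendAssoc ob l m k).hom ≫ padRight f (m ++ k) =
      padRight (padRight f m) k ≫ (appendAssoc ob l' m k).hom := by
  simp only [padRight, appendAssoc, Iso.trans_hom, whiskerRightIso_hom, whiskerLeftIso_hom,
    Iso.symm_hom, Category.assoc, Iso.inv_hom_id_assoc, comp_whiskerRight,
    inv_hom_whiskerRight_assoc, Iso.cancel_iso_hom_left]
  rw [whisker_exchange_assoc, associator_naturality_left_assoc]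

section Abstract

variable {A L L' M M' LM LM' K MK R R' : S}

/-- The inductive steps about `appendIso` are isolated for arbitrary isomorphisms in its place, so
that simplification sees only monoidal structure; they apply to lists by definitional unfolding. -/
lemma cons_padRight (e : LM ≅ L ⊗ M) (e' : LM' ≅ L' ⊗ M) (f : L ⟶ L') :
    (whiskerLeftIso A e ≪≫ (α_ A L M).symm).hom ≫ (A ◁ f) ▷ M ≫
      (whiskerLeftIso A e' ≪≫ (α_ A L' M).symm).inv = A ◁ (e.hom ≫ f ▷ M ≫ e'.inv) := by
  simp

lemma cons_padLeft (e : LM ≅ L ⊗ M) (e' : LM' ≅ L ⊗ M') (f : M ⟶ M') :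
    (whiskerLeftIso A e ≪≫ (α_ A L M).symm).hom ≫ (A ⊗ L) ◁ f ≫
      (whiskerLeftIso A e' ≪≫ (α_ A L M').symm).inv = A ◁ (e.hom ≫ L ◁ f ≫ e'.inv) := by
  simp

lemma cons_appendAssoc (e₁ : LM ≅ L ⊗ M) (e₂ : R ≅ LM ⊗ K) (e₃ : MK ≅ M ⊗ K)
    (e₄ : R' ≅ L ⊗ MK) :
    (whiskerLeftIso A e₂ ≪≫ (α_ A LM K).symm) ≪≫
      whiskerRightIso (whiskerLeftIso A e₁ ≪≫ (α_ A L M).symm) K ≪≫ α_ (A ⊗ L) M K ≪≫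
      whiskerLeftIso (A ⊗ L) e₃.symm ≪≫ (whiskerLeftIso A e₄ ≪≫ (α_ A L MK).symm).symm =
    whiskerLeftIso A (e₂ ≪≫ whiskerRightIso e₁ K ≪≫ α_ L M K ≪≫ whiskerLeftIso L e₃.symm ≪≫
      e₄.symm) := by
  ext
  simp

lemma nil_appendAssoc (e : MK ≅ M ⊗ K) :
    e ≪≫ whiskerRightIso (λ_ M).symm K ≪≫ α_ (𝟙_ S) M K ≪≫ whiskerLeftIso (𝟙_ S) e.symm ≪≫
      (λ_ MK).symm.symm = Iso.refl _ := by
  ext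
  simp

lemma cons_renameAppend {A' : S} (e : LM ≅ L ⊗ M) (e' : LM' ≅ L' ⊗ M')
    (x : LM ≅ K) (y : L ≅ L') (z : M ≅ M') (a : A ≅ A') :
    (a ⊗ᵢ x).symm ≪≫ (whiskerLeftIso A e ≪≫ (α_ A L M).symm) ≪≫ ((a ⊗ᵢ y) ⊗ᵢ z) ≪≫
      (whiskerLeftIso A' e' ≪≫ (α_ A' L' M').symm).symm =
    whiskerLeftIso A' (x.symm ≪≫ e ≪≫ (y ⊗ᵢ z) ≪≫ e'.symm) := by
  ext
  simp only [Iso.trans_hom, Iso.symm_hom, tensorIso_inv, tensorIso_hom, whiskerLeftIso_hom,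
    Iso.trans_inv, whiskerLeftIso_inv, Iso.symm_inv, Category.assoc]
  rw [← associator_inv_naturality_assoc, Iso.inv_hom_id_assoc]
  simp [← id_tensorHom, tensorHom_comp_tensorHom]

lemma cons_nil_rightUnitor (e : L' ≅ L ⊗ 𝟙_ S) :
    (whiskerLeftIso A e ≪≫ (α_ A L (𝟙_ S)).symm) ≪≫ ρ_ (A ⊗ L) =
      whiskerLeftIso A (e ≪≫ ρ_ L) := by
  ext
  simp

lemma assoc_conj {A A' B B' C C' X Y : S} (a : A' ≅ A) (b : B' ≅ B) (c : C' ≅ C)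
    (x : X ⟶ A ⊗ B) (y : B ⊗ C ⟶ Y) :
    ((x ≫ (a.inv ⊗ₘ b.inv)) ⊗ₘ c.inv) ≫ (α_ A' B' C').hom ≫ (a.hom ⊗ₘ ((b.hom ⊗ₘ c.hom) ≫ y)) =
      x ▷ C ≫ (α_ A B C).hom ≫ A ◁ y := by
  have h : (a.hom ⊗ₘ ((b.hom ⊗ₘ c.hom) ≫ y)) = (a.hom ⊗ₘ (b.hom ⊗ₘ c.hom)) ≫ A ◁ y := by
    rw [← id_tensorHom, tensorHom_comp_tensorHom, Category.comp_id]
  rw [h, ← associator_naturality_assoc, tensorHom_comp_tensorHom_assoc, Category.assoc,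
    tensorHom_comp_tensorHom]
  simp

lemma assocInv_conj {A A' B B' C C' X Y : S} (a : A' ≅ A) (b : B' ≅ B) (c : C' ≅ C)
    (x : X ⟶ B ⊗ C) (y : A ⊗ B ⟶ Y) :
    (a.inv ⊗ₘ (x ≫ (b.inv ⊗ₘ c.inv))) ≫ (α_ A' B' C').inv ≫ (((a.hom ⊗ₘ b.hom) ≫ y) ⊗ₘ c.hom) =
      A ◁ x ≫ (α_ A B C).inv ≫ y ▷ C := by
  have h : ((a.hom ⊗ₘ b.hom) ≫ y) ⊗ₘ c.hom = ((a.hom ⊗ₘ b.hom) ⊗ₘ c.hom) ≫ y ▷ C := by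
    rw [← tensorHom_id, tensorHom_comp_tensorHom, Category.comp_id]
  rw [h, ← associator_inv_naturality_assoc, tensorHom_comp_tensorHom_assoc, Category.assoc,
    tensorHom_comp_tensorHom]
  simp

end Abstract

variable [SymmetricCategory S]

variable (ob) in
/-- Exchange of two blocks of wires in front of a third one. -/
def blockSwap (l m k : List N) :
    listTensor ob (l ++ (m ++ k)) ⟶ listTensor ob (m ++ (l ++ k)) :=
  (appendIso ob l (m ++ k)).hom ≫ _ ◁ (appendIso ob m k).hom ≫ swapFront _ _ _ ≫
    _ ◁ (appendIso ob l k).inv ≫ (appendIso ob m (l ++ k)).inv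

lemma padRight_blockSwap {l l' : List N} (f : listTensor ob l ⟶ listTensor ob l') (m k : List N) :
    padRight f (m ++ k) ≫ blockSwap ob l' m k = blockSwap ob l m k ≫ padLeft m (padRight f k) := by
  have h := swapFront_naturality f (𝟙 (listTensor ob m)) (𝟙 (listTensor ob k))
  simp only [tensorHom_id, id_tensorHom, id_whiskerRight] at h
  simp only [padRight, blockSwap, padLeft, Category.assoc, Iso.inv_hom_id_assoc,
    whiskerLeft_comp, whiskerLeft_inv_hom_assoc, Iso.cancel_iso_hom_left]
  rw [← whisker_exchange_assoc, reassoc_of% h]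

@[simp]
lemma blockSwap_blockSwap (l m k : List N) :
    blockSwap ob l m k ≫ blockSwap ob m l k = 𝟙 _ := by
  simp [blockSwap]

section Abstract

variable {A B L M LM LM' K MK R R' : S}

lemma swap_padRight (e : LM ≅ L ⊗ M) :
    (whiskerLeftIso A (whiskerLeftIso B e ≪≫ (α_ B L M).symm) ≪≫ (α_ A (B ⊗ L) M).symm).hom ≫
      swapFront A B L ▷ M ≫
      (whiskerLeftIso B (whiskerLeftIso A e ≪≫ (α_ A L M).symm) ≪≫ (α_ B (A ⊗ L) M).symm).inv =
    swapFront A B LM := by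
  have h : swapFront A B LM =
      A ◁ B ◁ e.hom ≫ swapFront A B (L ⊗ M) ≫ B ◁ A ◁ e.inv := by
    rw [reassoc_of% swapFront_naturality_right, ← whiskerLeft_comp, ← whiskerLeft_comp]
    simp
  rw [h]
  simp only [swapFront, Iso.trans_hom, Iso.trans_inv, whiskerLeftIso_hom, whiskerLeftIso_inv,
    Iso.symm_hom, Iso.symm_inv, Category.assoc, whiskerLeft_comp]
  monoidal

lemma swapFront_unit_left : swapFront (𝟙_ S) L M = (λ_ _).hom ≫ L ◁ (λ_ M).inv := by
  simp [swapFront, braiding_tensorUnit_left]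

lemma swapFront_unit_right : swapFront L (𝟙_ S) M = L ◁ (λ_ M).hom ≫ (λ_ _).inv := by
  simp only [swapFront, braiding_tensorUnit_right]
  monoidal

lemma swapFront_tensor_right :
    swapFront A (B ⊗ L) M = A ◁ (α_ B L M).hom ≫ swapFront A B (L ⊗ M) ≫
      B ◁ swapFront A L M ≫ (α_ B L (A ⊗ M)).inv := by
  simp only [swapFront, BraidedCategory.braiding_tensor_right_hom]
  monoidal

lemma swapFront_tensor_left :
    swapFront (A ⊗ B) L M = (α_ A B (L ⊗ M)).hom ≫ A ◁ swapFront B L M ≫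
      swapFront A L (B ⊗ M) ≫ L ◁ (α_ A B M).inv := by
  simp only [swapFront, BraidedCategory.braiding_tensor_left_hom]
  monoidal

lemma cons_blockSwap_singleton (e : LM ≅ L ⊗ M) (e' : R ≅ L ⊗ A ⊗ M) :
    A ◁ (whiskerLeftIso B e ≪≫ (α_ B L M).symm).hom ≫ swapFront A (B ⊗ L) M ≫
      (whiskerLeftIso B e' ≪≫ (α_ B L (A ⊗ M)).symm).inv =
    swapFront A B LM ≫ B ◁ (A ◁ e.hom ≫ swapFront A L M ≫ e'.inv) := by
  simp [swapFront_tensor_right, reassoc_of% swapFront_naturality_right]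

lemma cons_blockSwap (e₁ : R ≅ L ⊗ MK) (e₂ : MK ≅ M ⊗ K) (e₃ : LM ≅ L ⊗ K)
    (e₄ : R' ≅ M ⊗ LM) (e₅ : LM' ≅ M ⊗ (A ⊗ LM)) :
    (whiskerLeftIso A e₁ ≪≫ (α_ A L MK).symm).hom ≫ (A ⊗ L) ◁ e₂.hom ≫ swapFront (A ⊗ L) M K ≫
      M ◁ (whiskerLeftIso A e₃ ≪≫ (α_ A L K).symm).inv ≫ e₅.inv =
    A ◁ (e₁.hom ≫ L ◁ e₂.hom ≫ swapFront L M K ≫ M ◁ e₃.inv ≫ e₄.inv) ≫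
      A ◁ e₄.hom ≫ swapFront A M LM ≫ e₅.inv := by
  have h := swapFront_naturality_right (X := A) (Y := M) e₃.inv
  simp [swapFront_tensor_left, reassoc_of% h]

end Abstract

lemma IsPerm.of_eq {l l' : List N} {f g} (h : IsPerm ob l l' f) (e : g = f) :
    IsPerm ob l l' g := e ▸ h

lemma IsPerm.padRight {l l' : List N} {f} (h : IsPerm ob l l' f) (m : List N) :
    IsPerm ob (l ++ m) (l' ++ m) (padRight f m) := by
  induction h with
  | nil => exact (IsPerm.refl m).of_eq (padRight_id (ob := ob) [] m)
  | @cons a l l' f _ ih =>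
    have e : HopfExtension.padRight (l := a :: l) (l' := a :: l') (ob a ◁ f) m = _ :=
      cons_padRight (appendIso ob l m) (appendIso ob l' m) f
    exact e ▸ IsPerm.cons a ih
  | swap a b l =>
    have e : HopfExtension.padRight (l := a :: b :: l) (l' := b :: a :: l)
      (swapFront _ _ _) m = _ := swap_padRight (appendIso ob l m)
    exact e ▸ IsPerm.swap a b (l ++ m)
  | trans _ _ ih ih' => rw [padRight_comp]; exact ih.trans ih'

lemma IsPerm.padLeft (l : List N) {m m' : List N} {f} (h : IsPerm ob m m' f) :
    IsPerm ob (l ++ m) (l ++ m') (padLeft l f) := by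
  induction l with
  | nil =>
    have e : (λ_ (listTensor ob m)).inv ≫ 𝟙_ S ◁ f ≫ (λ_ (listTensor ob m')).hom = f := by simp
    exact h.of_eq e
  | cons a l ih =>
    have e : HopfExtension.padLeft (a :: l) f = _ :=
      cons_padLeft (appendIso ob l m) (appendIso ob l m') f
    exact e ▸ IsPerm.cons a ih

lemma isPerm_appendAssoc (l m k : List N) :
    IsPerm ob (l ++ m ++ k) (l ++ (m ++ k)) (appendAssoc ob l m k).hom ∧
    IsPerm ob (l ++ (m ++ k)) (l ++ m ++ k) (appendAssoc ob l m k).inv := by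
  induction l with
  | nil =>
    have e : appendAssoc ob [] m k = _ := nil_appendAssoc (appendIso ob m k)
    exact e ▸ ⟨.refl _, .refl _⟩
  | cons a l ih =>
    have e : appendAssoc ob (a :: l) m k = _ := cons_appendAssoc (appendIso ob l m)
      (appendIso ob (l ++ m) k) (appendIso ob m k) (appendIso ob l (m ++ k))
    exact e ▸ ⟨.cons a ih.1, .cons a ih.2⟩

/-- By the hexagon identity, passing a block means passing its wires one after the other.
`isPerm_blockSwap` then moves the wires of a block one by one. -/
lemma isPerm_blockSwap_singleton (a : N) (m k : List N) :
    IsPerm ob (a :: (m ++ k)) (m ++ a :: k) (ob a ◁ (appendIso ob m k).hom ≫ swapFront _ _ _ ≫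
      (appendIso ob m (a :: k)).inv) := by
  induction m with
  | nil =>
    have e : ob a ◁ (λ_ (listTensor ob k)).inv ≫ swapFront (ob a) (𝟙_ S) (listTensor ob k) ≫
      (λ_ (ob a ⊗ listTensor ob k)).hom = 𝟙 _ := by simp [swapFront_unit_right]
    exact (IsPerm.refl (a :: k)).of_eq e
  | cons b m ih =>
    have e := cons_blockSwap_singleton (A := ob a) (B := ob b) (appendIso ob m k)
      (appendIso ob m (a :: k))
    exact (IsPerm.trans (.swap a b (m ++ k)) (.cons b ih)).of_eq e

lemma isPerm_blockSwap (l m k : List N) :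
    IsPerm ob (l ++ (m ++ k)) (m ++ (l ++ k)) (blockSwap ob l m k) := by
  induction l with
  | nil =>
    have e : (λ_ (listTensor ob (m ++ k))).inv ≫ 𝟙_ S ◁ (appendIso ob m k).hom ≫
      swapFront _ _ _ ≫ listTensor ob m ◁ (λ_ (listTensor ob k)).hom ≫
      (appendIso ob m k).inv = 𝟙 _ := by simp [swapFront_unit_left]
    exact (IsPerm.refl (m ++ k)).of_eq e
  | cons a l ih =>
    have e := cons_blockSwap (A := ob a) (appendIso ob l (m ++ k)) (appendIso ob m k)
      (appendIso ob l k) (appendIso ob m (l ++ k)) (appendIso ob m (a :: (l ++ k)))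
    exact (IsPerm.trans (.cons a ih) (isPerm_blockSwap_singleton a m (l ++ k))).of_eq e

end Append

/-! ### String diagrams with named wires -/

/-- Operations with named input and output wires. -/
class Wiring (N : outParam Type) (O : Type) where
  src : O → List N
  tgt : O → List N

/-- An interpretation of wires and operations in a monoidal category. -/
structure Interp (S : Type u) [Category.{v} S] [MonoidalCategory S] (N O : Type)
    [Wiring N O] where
  ob : N → S
  mor : ∀ o : O, listTensor ob (Wiring.src o) ⟶ listTensor ob (Wiring.tgt o)

section Diagrams

variable {S : Type u} [Category.{v} S] [MonoidalCategory S]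
variable {N O : Type} [Wiring N O] (E : Interp S N O)

open Wiring

section

variable {E} (ρ : N → N) (r : ∀ a, E.ob a ≅ E.ob (ρ a))

/-- Renaming wires by isomorphic ones. -/
def renameIso : (l : List N) → (listTensor E.ob l ≅ listTensor E.ob (l.map ρ))
  | [] => Iso.refl _
  | a :: l => r a ⊗ᵢ renameIso l

lemma renameIso_eq_refl (l : List N) (h : ∀ a ∈ l, ρ a = a ∧ r a ≍ Iso.refl (E.ob a)) :
    l.map ρ = l ∧ renameIso ρ r l ≍ Iso.refl (listTensor E.ob l) := by
  induction l with
  | nil => exact ⟨rfl, .rfl⟩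
  | cons a l ih =>
    obtain ⟨h1, h2⟩ := ih (fun b hb => h b (List.mem_cons_of_mem _ hb))
    obtain ⟨h3, h4⟩ := h a List.mem_cons_self
    have aux : ∀ (b : N) (l' : List N) (x : E.ob a ≅ E.ob b)
        (y : listTensor E.ob l ≅ listTensor E.ob l'), b = a → l' = l →
        x ≍ Iso.refl (E.ob a) → y ≍ Iso.refl (listTensor E.ob l) →
        (x ⊗ᵢ y) ≍ Iso.refl (E.ob a ⊗ listTensor E.ob l) := by
      rintro b l' x y rfl rfl hx hy
      obtain rfl := eq_of_heq hx
      obtain rfl := eq_of_heq hy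
      exact heq_of_eq (by ext; simp)
    exact ⟨by rw [List.map_cons, h1, h3], aux _ _ _ _ h3 h1 h4 h2⟩

end

variable [SymmetricCategory S]

/-- `Sem E Γ P Γ' f`: applying the operations `P` successively to the wires `Γ`, and reordering
the resulting wires as `Γ'`, gives the morphism `f`. -/
inductive Sem : (Γ : List N) → List O → (Γ' : List N) →
    (listTensor E.ob Γ ⟶ listTensor E.ob Γ') → Prop
  | nil {Γ Γ' : List N} {f} : IsPerm E.ob Γ Γ' f → Sem Γ [] Γ' f
  | cons (o : O) (F : List N) {Γ : List N} {P : List O} {Γ' : List N} {p g} :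
      IsPerm E.ob Γ (src o ++ F) p → Sem (tgt o ++ F) P Γ' g →
      Sem Γ (o :: P) Γ' (p ≫ padRight (E.mor o) F ≫ g)

/-- The wires created by a list of operations. -/
def outputs (P : List O) : List N := P.flatMap tgt

@[simp] lemma outputs_nil : outputs ([] : List O) = [] := rfl
@[simp] lemma outputs_cons (o : O) (P : List O) : outputs (o :: P) = tgt o ++ outputs P := rfl
@[simp] lemma outputs_append (P Q : List O) : outputs (P ++ Q) = outputs P ++ outputs Q := by
  simp [outputs]

lemma outputs_perm {P Q : List O} (h : P.Perm Q) : (outputs P).Perm (outputs Q) :=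
  h.flatMap_right _

variable {E}

lemma Sem.of_eq {Γ Γ' : List N} {P : List O} {f g} (h : Sem E Γ P Γ' f) (e : g = f) :
    Sem E Γ P Γ' g := e ▸ h

lemma Sem.perm_comp {Γ₁ Γ Γ' : List N} {P : List O} {p f} (hp : IsPerm E.ob Γ₁ Γ p)
    (h : Sem E Γ P Γ' f) : Sem E Γ₁ P Γ' (p ≫ f) := by
  cases h with
  | nil h => exact .nil (hp.trans h)
  | cons o F h h' => exact (Sem.cons o F (hp.trans h) h').of_eq (by simp)

lemma Sem.comp_perm {Γ Γ' Γ'' : List N} {P : List O} {p f} (h : Sem E Γ P Γ' f)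
    (hp : IsPerm E.ob Γ' Γ'' p) : Sem E Γ P Γ'' (f ≫ p) := by
  induction h with
  | nil h => exact .nil (h.trans hp)
  | cons o F h _ ih => exact (Sem.cons o F h (ih hp)).of_eq (by simp)

lemma Sem.append {Γ Γ' Γ'' : List N} {P Q : List O} {f g} (h : Sem E Γ P Γ' f)
    (h' : Sem E Γ' Q Γ'' g) : Sem E Γ (P ++ Q) Γ'' (f ≫ g) := by
  induction h with
  | nil h => exact h'.perm_comp h
  | cons o F h _ ih => exact (Sem.cons o F h (ih h')).of_eq (by simp)

lemma Sem.exists_of_append {Γ Γ'' : List N} {P Q : List O} {h}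
    (H : Sem E Γ (P ++ Q) Γ'' h) :
    ∃ (Γ' : List N) (f : _) (g : _), Sem E Γ P Γ' f ∧ Sem E Γ' Q Γ'' g ∧ h = f ≫ g := by
  induction P generalizing Γ with
  | nil => exact ⟨Γ, 𝟙 _, h, .nil (.refl _), H, by simp⟩
  | cons o P ih =>
    cases H with
    | cons _ F hp hs =>
      obtain ⟨Γ', f, g, hf, hg, rfl⟩ := ih hs
      exact ⟨Γ', _, g, .cons o F hp hf, hg, by simp⟩

lemma Sem.pad {Γ Γ' : List N} {P : List O} {f} (h : Sem E Γ P Γ' f) (K : List N) :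
    Sem E (Γ ++ K) P (Γ' ++ K) (padRight f K) := by
  induction h with
  | nil h => exact .nil (h.padRight K)
  | cons o F h _ ih =>
    refine (Sem.cons o (F ++ K) ((h.padRight K).trans (isPerm_appendAssoc _ _ _).1)
      (ih.perm_comp (isPerm_appendAssoc _ _ _).2)).of_eq ?_
    rw [padRight_comp, padRight_comp]
    simp only [Category.assoc]
    rw [reassoc_of% padRight_padRight, Iso.hom_inv_id_assoc]

/-- Each operation replaces some of the wires present by new ones, so distinctness survives. This
lets diagrams be composed without losing the hypothesis of uniqueness. -/
lemma Sem.perm {Γ Γ' : List N} {P : List O} {f} (h : Sem E Γ P Γ' f) :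
    (Γ ++ outputs P).Nodup → Γ'.Nodup ∧ ∀ a ∈ Γ', a ∈ Γ ++ outputs P := by
  induction h with
  | nil h =>
    intro hn
    rw [outputs_nil, List.append_nil] at hn ⊢
    exact ⟨h.perm.nodup hn, fun a ha => h.perm.mem_iff.2 ha⟩
  | @cons o F Γ P Γ' p g h _ ih =>
    intro hn
    have hp := h.perm
    have hn' : (src o ++ F ++ (tgt o ++ outputs P)).Nodup :=
      (hp.append_right (tgt o ++ outputs P)).nodup hn
    have : (tgt o ++ F ++ outputs P).Nodup := by
      simp only [List.append_assoc, List.nodup_append, List.mem_append] at hn' ⊢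
      grind
    obtain ⟨h1, h2⟩ := ih this
    refine ⟨h1, fun a ha => ?_⟩
    have := h2 a ha
    simp only [outputs_cons, List.mem_append, hp.mem_iff] at this ⊢
    tauto

lemma Sem.src_subset {Γ Γ' : List N} {A B : List O} {o : O} {f}
    (h : Sem E Γ (A ++ o :: B) Γ' f) : ∀ a ∈ src o, a ∈ Γ ++ outputs A := by
  induction A generalizing Γ with
  | nil =>
    cases h with
    | cons _ F hp _ => intro a ha; simp [hp.perm.mem_iff, ha]
  | cons x A ih =>
    cases h with
    | cons _ F hp hs =>
      intro a ha
      have := ih hs a ha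
      simp only [outputs_cons, List.mem_append, hp.perm.mem_iff] at this ⊢
      tauto

lemma List.Nodup.exists_perm_append {l m : List N} (hl : l.Nodup) (h : ∀ a ∈ l, a ∈ m) :
    ∃ k, m.Perm (l ++ k) := by
  obtain ⟨l', h1, h2⟩ := List.subperm_of_subset hl h
  obtain ⟨k, hk⟩ := h2.exists_perm_append
  exact ⟨k, hk.trans (h1.append_right k)⟩

/-- The interchange law: the inputs of `o₂` are present before `o₁` acts, so the two operations act
on disjoint wires. -/
lemma Sem.swap {Γ Γ' : List N} {P : List O} {o₁ o₂ : O} {f}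
    (h : Sem E Γ (o₁ :: o₂ :: P) Γ' f) (hn : (Γ ++ outputs (o₁ :: o₂ :: P)).Nodup)
    (h₂ : ∀ a ∈ src o₂, a ∈ Γ) : Sem E Γ (o₂ :: o₁ :: P) Γ' f := by
  cases h with
  | @cons _ F₁ _ _ _ p _ hp hs =>
  cases hs with
  | @cons _ F₂ _ _ _ q g hq hs =>
    have hn₁ : (src o₁ ++ F₁ ++ outputs (o₁ :: o₂ :: P)).Nodup :=
      (hp.perm.append_right _).nodup hn
    have hn₂ : (tgt o₁ ++ F₁).Nodup := by
      simp only [outputs_cons, List.append_assoc, List.nodup_append, List.mem_append] at hn₁ ⊢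
      grind
    -- An input of `o₂` was present at the start, so by distinctness it is not an output of `o₁`.
    have hsub : ∀ a ∈ src o₂, a ∈ F₁ := by
      intro a ha
      have h1 : a ∈ tgt o₁ ++ F₁ := by simp [hq.perm.mem_iff, ha]
      have h3 := h₂ a ha
      simp only [outputs_cons, List.nodup_append, List.mem_append] at hn h1 ⊢
      grind
    have hsrc : (src o₂).Nodup := (List.nodup_append.1 (hq.perm.nodup hn₂)).1
    obtain ⟨G, hG⟩ := List.Nodup.exists_perm_append hsrc hsub
    have hF₂ : (tgt o₁ ++ G).Perm F₂ := by
      refine (List.perm_append_left_iff (src o₂)).1 ?_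
      have e1 : (src o₂ ++ (tgt o₁ ++ G)).Perm (tgt o₁ ++ (src o₂ ++ G)) := by
        simpa only [List.append_assoc] using List.perm_append_comm.append_right G
      exact e1.trans ((hG.symm.append_left _).trans hq.perm)
    obtain ⟨r₁, hr₁⟩ := IsPerm.exists_of_perm (ob := E.ob) hG
    obtain ⟨r₂, hr₂⟩ := IsPerm.exists_of_perm (ob := E.ob) hF₂
    -- Coherence replaces the unknown permutation `q` by a block exchange, for which naturality is
    -- available.
    have hq' : q = padLeft (tgt o₁) r₁ ≫ blockSwap E.ob (tgt o₁) (src o₂) G ≫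
        padLeft (src o₂) r₂ :=
      hq.unique hn₂ ((hr₁.padLeft _).trans ((isPerm_blockSwap _ _ _).trans (hr₂.padLeft _)))
    refine (Sem.cons o₂ (src o₁ ++ G) (hp.trans ((hr₁.padLeft _).trans (isPerm_blockSwap _ _ _)))
      (.cons o₁ (tgt o₂ ++ G) (isPerm_blockSwap _ _ _)
        (hs.perm_comp ((isPerm_blockSwap _ _ _).trans (hr₂.padLeft _))))).of_eq ?_
    simp only [hq', Category.assoc]
    rw [← reassoc_of% padLeft_padRight (E.mor o₁), reassoc_of% padRight_blockSwap,
      reassoc_of% padLeft_padRight, reassoc_of% padLeft_padRight,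
      reassoc_of% padRight_blockSwap (E.mor o₁), reassoc_of% blockSwap_blockSwap]

/-- Repeated interchange. A wire that is present at the start and consumed by `o` cannot be touched
by an earlier operation: it would disappear, and distinctness forbids creating it again. -/
lemma Sem.move_front {Γ Γ' : List N} {A B : List O} {o : O} {f}
    (h : Sem E Γ (A ++ o :: B) Γ' f) (hn : (Γ ++ outputs (A ++ o :: B)).Nodup)
    (ho : ∀ a ∈ src o, a ∈ Γ) : Sem E Γ (o :: (A ++ B)) Γ' f := by
  induction A generalizing Γ with
  | nil => exact h
  | cons x A ih =>
    cases h with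
    | @cons _ F _ _ _ p g hp hs =>
      have hn₁ : (src x ++ F ++ outputs (x :: (A ++ o :: B))).Nodup :=
        (hp.perm.append_right _).nodup hn
      have hn₂ : (tgt x ++ F ++ outputs (A ++ o :: B)).Nodup := by
        simp only [outputs_cons, List.append_assoc, List.nodup_append, List.mem_append] at hn₁ ⊢
        grind
      have hsub : ∀ a ∈ src o, a ∈ tgt x ++ F := by
        intro a ha
        have h1 := hs.src_subset a ha
        have h2 := ho a ha
        simp only [hp.perm.mem_iff, outputs_append, outputs_cons, List.nodup_append,
          List.mem_append] at hn₁ h1 h2 ⊢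
        grind
      refine Sem.swap (.cons x F hp (ih hs hn₂ hsub)) ?_ ho
      refine List.Perm.nodup (List.Perm.append_left _ ?_) hn
      refine outputs_perm (.cons x ?_)
      exact List.perm_middle

/-- A string diagram on distinct wires determines its morphism, up to the order in which the
operations are listed. -/
theorem Sem.unique {Γ Γ' : List N} {P Q : List O} {f g} (h : Sem E Γ P Γ' f)
    (h' : Sem E Γ Q Γ' g) (hPQ : P.Perm Q) (hn : (Γ ++ outputs P).Nodup) : f = g := by
  induction Q generalizing Γ P with
  | nil =>
    obtain rfl := hPQ.eq_nil
    cases h with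
    | nil h =>
    cases h' with
    | nil h' => exact h.unique (by simpa using hn) h'
  | cons o Q ih =>
    -- The first operation of the second list needs only initial wires, so it can be moved to the
    -- front of the first list. The idle wires may then still differ by a permutation `q`.
    obtain ⟨A, B, rfl⟩ := List.append_of_mem (hPQ.mem_iff.2 List.mem_cons_self)
    have hAB : (A ++ B).Perm Q := (List.perm_cons o).1 (List.perm_middle.symm.trans hPQ)
    cases h' with
    | @cons _ F' _ _ _ p' g hp' hs' =>
    have hmov := h.move_front hn (fun a ha => by simp [hp'.perm.mem_iff, ha])
    cases hmov with
    | @cons _ F _ _ _ p k hp hs =>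
    have hΓ : Γ.Nodup := (List.nodup_append.1 hn).1
    have hFF : F.Perm F' :=
      (List.perm_append_left_iff (src o)).1 (hp.perm.symm.trans hp'.perm)
    obtain ⟨q, hq⟩ := IsPerm.exists_of_perm (ob := E.ob) hFF
    have e₁ : p' = p ≫ padLeft _ q := hp'.unique hΓ (hp.trans (hq.padLeft _))
    have hn₁ : (src o ++ F ++ outputs (o :: (A ++ B))).Nodup :=
      ((hp.perm.append_right _).trans ((outputs_perm List.perm_middle).append_left _)).nodup hn
    have hn₂ : (tgt o ++ F ++ outputs (A ++ B)).Nodup := by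
      simp only [outputs_cons, List.append_assoc, List.nodup_append, List.mem_append] at hn₁ ⊢
      grind
    have e₂ := ih hs (hs'.perm_comp (hq.padLeft _)) hAB hn₂
    rw [e₁, e₂, Category.assoc, reassoc_of% padLeft_padRight]

/-! ### Renaming wires -/

/-- The wires of a renamed operation are the renamed wires only up to propositional equality; here
this transport is done once. -/
lemma Sem.cons_of_eq {o : O} (s t F : List N) {Γ : List N} {P : List O} {Γ' : List N} {p g}
    (hs : src o = s) (ht : tgt o = t) (m : listTensor E.ob s ⟶ listTensor E.ob t)
    (hm : E.mor o ≍ m) (hp : IsPerm E.ob Γ (s ++ F) p) (hg : Sem E (t ++ F) P Γ' g) :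
    Sem E Γ (o :: P) Γ' (p ≫ padRight m F ≫ g) := by
  subst hs ht
  obtain rfl := eq_of_heq hm
  exact .cons o F hp hg

section Rename

variable (ρ : N → N) (r : ∀ a, E.ob a ≅ E.ob (ρ a))

lemma IsPerm.rename {l l' : List N} {f} (h : IsPerm E.ob l l' f) :
    IsPerm E.ob (l.map ρ) (l'.map ρ) ((renameIso ρ r l).inv ≫ f ≫ (renameIso ρ r l').hom) := by
  induction h with
  | nil => exact IsPerm.nil.of_eq (by simp [renameIso])
  | @cons a l l' f _ ih =>
    refine (IsPerm.cons (ρ a) ih).of_eq ?_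
    simp [renameIso, ← id_tensorHom, tensorHom_comp_tensorHom]
  | swap a b l =>
    refine (IsPerm.swap (ρ a) (ρ b) (l.map ρ)).of_eq ?_
    have h := swapFront_naturality (r a).hom (r b).hom (renameIso ρ r l).hom
    exact (Iso.inv_comp_eq _).2 h.symm
  | trans _ _ ih ih' => exact (ih.trans ih').of_eq (by simp)

/-- Renaming the wires of a concatenation. -/
def renameAppend (l m : List N) :
    listTensor E.ob ((l ++ m).map ρ) ≅ listTensor E.ob (l.map ρ ++ m.map ρ) :=
  (renameIso ρ r (l ++ m)).symm ≪≫ appendIso E.ob l m ≪≫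
    (renameIso ρ r l ⊗ᵢ renameIso ρ r m) ≪≫ (appendIso E.ob (l.map ρ) (m.map ρ)).symm

lemma isPerm_renameAppend (l m : List N) :
    IsPerm E.ob ((l ++ m).map ρ) (l.map ρ ++ m.map ρ) (renameAppend ρ r l m).hom ∧
    IsPerm E.ob (l.map ρ ++ m.map ρ) ((l ++ m).map ρ) (renameAppend ρ r l m).inv := by
  induction l with
  | nil =>
    have e : (renameIso ρ r m).symm ≪≫ (λ_ _).symm ≪≫ (Iso.refl _ ⊗ᵢ renameIso ρ r m) ≪≫
        (λ_ _).symm.symm = Iso.refl _ := by ext; simp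
    exact ⟨(IsPerm.refl (m.map ρ)).of_eq (congrArg Iso.hom e),
      (IsPerm.refl (m.map ρ)).of_eq (congrArg Iso.inv e)⟩
  | cons a l ih =>
    have e := cons_renameAppend (appendIso E.ob l m) (appendIso E.ob (l.map ρ) (m.map ρ))
      (renameIso ρ r (l ++ m)) (renameIso ρ r l) (renameIso ρ r m) (r a)
    exact ⟨(ih.1.cons (ρ a)).of_eq (congrArg Iso.hom e),
      (ih.2.cons (ρ a)).of_eq (congrArg Iso.inv e)⟩

/-- A string diagram may be renamed wholesale. -/
theorem Sem.rename (ρO : O → O) (hs : ∀ o, src (ρO o) = (src o).map ρ)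
    (ht : ∀ o, tgt (ρO o) = (tgt o).map ρ)
    (hm : ∀ o, E.mor (ρO o) ≍
      (renameIso ρ r (src o)).inv ≫ E.mor o ≫ (renameIso ρ r (tgt o)).hom)
    {Γ Γ' : List N} {P : List O} {f} (h : Sem E Γ P Γ' f) :
    Sem E (Γ.map ρ) (P.map ρO) (Γ'.map ρ)
      ((renameIso ρ r Γ).inv ≫ f ≫ (renameIso ρ r Γ').hom) := by
  induction h with
  | nil h => exact .nil (h.rename ρ r)
  | cons o F hp _ ih =>
    refine (Sem.cons_of_eq _ _ (F.map ρ) (hs o) (ht o) _ (hm o)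
      ((hp.rename ρ r).trans (isPerm_renameAppend ρ r (src o) F).1)
      (ih.perm_comp (isPerm_renameAppend ρ r (tgt o) F).2)).of_eq ?_
    simp [renameAppend, padRight, ← tensorHom_id, tensorHom_comp_tensorHom_assoc]

/-- Renaming inner wires does not change the morphism. -/
theorem Sem.rename_inner (ρO : O → O) (hs : ∀ o, src (ρO o) = (src o).map ρ)
    (ht : ∀ o, tgt (ρO o) = (tgt o).map ρ)
    (hm : ∀ o, E.mor (ρO o) ≍
      (renameIso ρ r (src o)).inv ≫ E.mor o ≫ (renameIso ρ r (tgt o)).hom)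
    {Γ Γ' : List N} {P : List O} {f} (h : Sem E Γ P Γ' f)
    (hΓ : ∀ a ∈ Γ, ρ a = a ∧ r a ≍ Iso.refl (E.ob a))
    (hΓ' : ∀ a ∈ Γ', ρ a = a ∧ r a ≍ Iso.refl (E.ob a)) :
    Sem E Γ (P.map ρO) Γ' f := by
  have H := h.rename ρ r ρO hs ht hm
  obtain ⟨h1, h2⟩ := renameIso_eq_refl ρ r Γ hΓ
  obtain ⟨h3, h4⟩ := renameIso_eq_refl ρ r Γ' hΓ'
  -- The renamed lists are equal to the original ones only propositionally, so they are made
  -- variables before substitution.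
  generalize renameIso ρ r Γ = x at H h2
  generalize renameIso ρ r Γ' = y at H h4
  generalize Γ.map ρ = m at *
  generalize Γ'.map ρ = m' at *
  subst h1 h3
  obtain rfl := eq_of_heq h2
  obtain rfl := eq_of_heq h4
  simpa using H

end Rename

/-! ### Execution and rewriting -/

section Exec

variable [DecidableEq N]

/-- The wires present after executing `P` on the wires `Γ`. -/
def exec : List N → List O → Option (List N)
  | Γ, [] => some Γ
  | Γ, o :: P =>
    if Γ.isPerm (src o ++ Γ.diff (src o)) then exec (tgt o ++ Γ.diff (src o)) P else none

lemma Sem.exists_of_exec {Γ Γ' : List N} {P : List O} (h : exec Γ P = some Γ') :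
    ∃ f, Sem E Γ P Γ' f := by
  induction P generalizing Γ with
  | nil =>
    obtain rfl : Γ = Γ' := by simpa [exec] using h
    exact ⟨_, .nil (.refl _)⟩
  | cons o P ih =>
    rw [exec] at h
    split_ifs at h with hp
    obtain ⟨p, hp⟩ := IsPerm.exists_of_perm (ob := E.ob) (List.isPerm_iff.1 hp)
    obtain ⟨f, hf⟩ := ih h
    exact ⟨_, .cons o _ hp hf⟩

/-- `P` can be executed on the wires `Γ`, leaving the wires `Γ'`, and creates no wire twice. -/
def wellFormed (Γ : List N) (P : List O) (Γ' : List N) : Bool :=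
  decide (Γ ++ outputs P).Nodup && (exec Γ P).any fun m => m.isPerm Γ'

lemma Sem.exists_of_wellFormed {Γ Γ' : List N} {P : List O} (h : wellFormed Γ P Γ' = true) :
    (Γ ++ outputs P).Nodup ∧ ∃ f, Sem E Γ P Γ' f := by
  simp only [wellFormed, Bool.and_eq_true, decide_eq_true_eq, Option.any_eq_true] at h
  obtain ⟨h1, m, h2, h3⟩ := h
  obtain ⟨f, hf⟩ := Sem.exists_of_exec (E := E) h2
  obtain ⟨p, hp⟩ := IsPerm.exists_of_perm (ob := E.ob) (List.isPerm_iff.1 h3)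
  exact ⟨h1, _, hf.comp_perm hp⟩

/-- An equation between two string diagrams with the same inputs and outputs. -/
structure Equation (N O : Type) where
  dom : List N
  cod : List N
  lhs : List O
  rhs : List O

variable (E) in
/-- The two sides of the equation are interpreted by the same morphism. -/
def Equation.Valid (e : Equation N O) : Prop :=
  ∃ f, Sem E e.dom e.lhs e.cod f ∧ Sem E e.dom e.rhs e.cod f

/-- Replacing a part of a string diagram by means of a valid equation. -/
theorem Sem.rewrite {e : Equation N O} (he : e.Valid E) {Γ Γ' : List N} {P : List O} {f}
    (h : Sem E Γ P Γ' f) (pre post : List O) (F : List N)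
    (hwf : wellFormed Γ (pre ++ e.lhs ++ post) Γ' = true)
    (hP : P.Perm (pre ++ e.lhs ++ post))
    (hpre : (exec Γ pre).any (fun m => m.isPerm (e.dom ++ F)) = true)
    (hpost : (exec (e.cod ++ F) post).any (fun m => m.isPerm Γ') = true) :
    Sem E Γ (pre ++ e.rhs ++ post) Γ' f := by
  obtain ⟨k, hk, hk'⟩ := he
  simp only [Option.any_eq_true] at hpre hpost
  obtain ⟨m, hm, hmF⟩ := hpre
  obtain ⟨m', hm', hmF'⟩ := hpost
  obtain ⟨x, hx⟩ := Sem.exists_of_exec (E := E) hm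
  obtain ⟨y, hy⟩ := Sem.exists_of_exec (E := E) hm'
  obtain ⟨p, hp⟩ := IsPerm.exists_of_perm (ob := E.ob) (List.isPerm_iff.1 hmF)
  obtain ⟨q, hq⟩ := IsPerm.exists_of_perm (ob := E.ob) (List.isPerm_iff.1 hmF')
  have h1 := ((hx.comp_perm hp).append (hk.pad F)).append (hy.comp_perm hq)
  have h2 := ((hx.comp_perm hp).append (hk'.pad F)).append (hy.comp_perm hq)
  have hn := (Sem.exists_of_wellFormed (E := E) hwf).1
  -- `h1` and `h2` describe the same composite, once with each side of the equation in the middle;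
  -- uniqueness identifies that composite with `f`.
  exact h2.of_eq (h.unique h1 hP (((outputs_perm hP).append_left Γ).symm.nodup hn))

end Exec

end Diagrams

/-! ### Monoidal terms and their string diagrams -/

/-- Bracketed tensor products of wires. -/
inductive WireTree (N : Type) : Type
  | unit : WireTree N
  | leaf : N → WireTree N
  | node : WireTree N → WireTree N → WireTree N

namespace WireTree

/-- The wires of a bracketed tensor product. -/
@[reducible] def toList {N : Type} : WireTree N → List N
  | unit => []
  | leaf a => [a]
  | node s t => s.toList ++ t.toList

variable {S : Type u} [Category.{v} S] [MonoidalCategory S] {N : Type} (ob : N → S)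

/-- The object denoted by a bracketed tensor product. -/
@[reducible] def eval : WireTree N → S
  | unit => 𝟙_ S
  | leaf a => ob a
  | node s t => eval s ⊗ eval t

/-- Removing the brackets. -/
def flatten : (t : WireTree N) → (t.eval ob ≅ listTensor ob t.toList)
  | unit => Iso.refl _
  | leaf a => (ρ_ (ob a)).symm
  | node s t => (flatten s ⊗ᵢ flatten t) ≪≫ (appendIso ob s.toList t.toList).symm

end WireTree

open WireTree

/-- Operations with bracketed inputs and outputs. -/
class TreeWiring (N : outParam Type) (O : Type) where
  dom : O → WireTree N
  cod : O → WireTree N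

instance {N O : Type} [TreeWiring N O] : Wiring N O where
  src o := (TreeWiring.dom o).toList
  tgt o := (TreeWiring.cod o).toList

/-- An interpretation of wires and of operations with bracketed inputs and outputs. -/
structure TreeInterp (S : Type u) [Category.{v} S] [MonoidalCategory S] (N O : Type)
    [TreeWiring N O] where
  ob : N → S
  mor : ∀ o : O, (TreeWiring.dom o).eval ob ⟶ (TreeWiring.cod o).eval ob

/-- The interpretation with brackets removed. -/
abbrev TreeInterp.toInterp {S : Type u} [Category.{v} S] [MonoidalCategory S] {N O : Type}
    [TreeWiring N O] (E : TreeInterp S N O) : Interp S N O where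
  ob := E.ob
  mor o := (flatten E.ob _).inv ≫ E.mor o ≫ (flatten E.ob _).hom

/-- Formal morphisms in a symmetric monoidal category, built from operations. -/
inductive Term {N : Type} (O : Type) [TreeWiring N O] : WireTree N → WireTree N → Type
  | id (s) : Term O s s
  | comp {s t u} : Term O s t → Term O t u → Term O s u
  | whiskerLeft (s) {t u} : Term O t u → Term O (node s t) (node s u)
  | whiskerRight {s t} (f : Term O s t) (u) : Term O (node s u) (node t u)
  | tensor {s t s' t'} : Term O s t → Term O s' t' → Term O (node s s') (node t t')
  | assoc (s t u) : Term O (node (node s t) u) (node s (node t u))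
  | assocInv (s t u) : Term O (node s (node t u)) (node (node s t) u)
  | leftUnitor (s) : Term O (node .unit s) s
  | leftUnitorInv (s) : Term O s (node .unit s)
  | rightUnitor (s) : Term O (node s .unit) s
  | rightUnitorInv (s) : Term O s (node s .unit)
  | braid (s t) : Term O (node s t) (node t s)
  | op (o : O) : Term O (TreeWiring.dom o) (TreeWiring.cod o)

section Term

variable {S : Type u} [Category.{v} S] [MonoidalCategory S] [SymmetricCategory S]
variable {N O : Type} [TreeWiring N O] (E : TreeInterp S N O)

/-- The morphism denoted by a formal one. -/
def Term.eval : {s t : WireTree N} → Term O s t → (s.eval E.ob ⟶ t.eval E.ob)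
  | _, _, id _ => 𝟙 _
  | _, _, comp f g => f.eval ≫ g.eval
  | _, _, whiskerLeft s f => s.eval E.ob ◁ f.eval
  | _, _, whiskerRight f u => f.eval ▷ u.eval E.ob
  | _, _, tensor f g => f.eval ⊗ₘ g.eval
  | _, _, assoc s t u => (α_ (s.eval E.ob) (t.eval E.ob) (u.eval E.ob)).hom
  | _, _, assocInv s t u => (α_ (s.eval E.ob) (t.eval E.ob) (u.eval E.ob)).inv
  | _, _, leftUnitor s => (λ_ (s.eval E.ob)).hom
  | _, _, leftUnitorInv s => (λ_ (s.eval E.ob)).inv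
  | _, _, rightUnitor s => (ρ_ (s.eval E.ob)).hom
  | _, _, rightUnitorInv s => (ρ_ (s.eval E.ob)).inv
  | _, _, braid s t => (β_ (s.eval E.ob) (t.eval E.ob)).hom
  | _, _, op o => E.mor o

/-- The operations in a formal morphism. -/
def Term.ops : {s t : WireTree N} → Term O s t → List O
  | _, _, comp f g => f.ops ++ g.ops
  | _, _, whiskerLeft _ f => f.ops
  | _, _, whiskerRight f _ => f.ops
  | _, _, tensor f g => f.ops ++ g.ops
  | _, _, op o => [o]
  | _, _, id _ => []
  | _, _, assoc _ _ _ => []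
  | _, _, assocInv _ _ _ => []
  | _, _, leftUnitor _ => []
  | _, _, leftUnitorInv _ => []
  | _, _, rightUnitor _ => []
  | _, _, rightUnitorInv _ => []
  | _, _, braid _ _ => []

variable {ob : N → S}

lemma isPerm_append_nil (l : List N) :
    IsPerm ob (l ++ []) l (appendIso ob l [] ≪≫ ρ_ (listTensor ob l)).hom ∧
    IsPerm ob l (l ++ []) (appendIso ob l [] ≪≫ ρ_ (listTensor ob l)).inv := by
  induction l with
  | nil =>
    have e : (λ_ (𝟙_ S)).symm ≪≫ ρ_ (𝟙_ S) = Iso.refl _ := by ext; simp [← unitors_equal]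
    exact ⟨IsPerm.nil.of_eq (congrArg Iso.hom e), IsPerm.nil.of_eq (congrArg Iso.inv e)⟩
  | cons a l ih =>
    have e := cons_nil_rightUnitor (A := ob a) (appendIso ob l [])
    exact ⟨(ih.1.cons a).of_eq (congrArg Iso.hom e), (ih.2.cons a).of_eq (congrArg Iso.inv e)⟩

lemma cons_braiding {A L M LM ML R : S} (e : LM ≅ L ⊗ M) (e' : ML ≅ M ⊗ L) (e'' : R ≅ M ⊗ A ⊗ L) :
    (whiskerLeftIso A e ≪≫ (α_ A L M).symm).hom ≫ (β_ (A ⊗ L) M).hom ≫ e''.inv =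
      A ◁ (e.hom ≫ (β_ L M).hom ≫ e'.inv) ≫ A ◁ e'.hom ≫ swapFront A M L ≫ e''.inv := by
  simp [swapFront]

/-- By the hexagon identity the braiding of two blocks passes the wires of `l` across `m` one at a
time, the last one first. -/
lemma isPerm_braiding (l m : List N) :
    IsPerm ob (l ++ m) (m ++ l) ((appendIso ob l m).hom ≫ (β_ _ _).hom ≫
      (appendIso ob m l).inv) := by
  induction l with
  | nil =>
    refine (isPerm_append_nil (ob := ob) m).2.of_eq ?_
    have : (λ_ (listTensor ob m)).inv ≫ (β_ (𝟙_ S) (listTensor ob m)).hom ≫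
        (appendIso ob m []).inv = (ρ_ _).inv ≫ (appendIso ob m []).inv := by
      simp [braiding_tensorUnit_left]
    exact this.trans (by simp)
  | cons a l ih =>
    have e := cons_braiding (A := ob a) (appendIso ob l m) (appendIso ob m l)
      (appendIso ob m (a :: l))
    exact (IsPerm.trans (.cons a ih) (isPerm_blockSwap_singleton a m l)).of_eq e

/-- Operations act on the front wires, so the idle block `K` is moved behind the inputs and back
after the operation; the two exchanges cancel. -/
lemma Sem.padLeft {E : Interp S N O} {Γ Γ' : List N} {P : List O} {f}
    (h : Sem E Γ P Γ' f) (K : List N) :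
    Sem E (K ++ Γ) P (K ++ Γ') (padLeft K f) := by
  induction h with
  | nil h => exact .nil (h.padLeft K)
  | cons o F h _ ih =>
    refine (Sem.cons o (K ++ F) ((h.padLeft K).trans (isPerm_blockSwap _ _ _))
      (ih.perm_comp (isPerm_blockSwap _ _ _))).of_eq ?_
    rw [padLeft_comp, padLeft_comp]
    simp only [Category.assoc]
    rw [reassoc_of% padRight_blockSwap, reassoc_of% blockSwap_blockSwap]

/-- The string diagram of a formal morphism denotes the same morphism. -/
theorem Term.sem {s t : WireTree N} (f : Term O s t) (hn : (s.toList ++ outputs f.ops).Nodup) :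
    Sem E.toInterp s.toList f.ops t.toList
      ((flatten E.ob s).inv ≫ f.eval E ≫ (flatten E.ob t).hom) := by
  induction f with
  | id s => exact (Sem.nil (.refl _)).of_eq (by simp [eval])
  | comp f g ihf ihg =>
    simp only [ops, outputs_append] at hn ⊢
    have h1 := ihf (by simp only [List.nodup_append, List.mem_append] at hn ⊢; grind)
    obtain ⟨h2, h3⟩ := h1.perm (by simp only [List.nodup_append, List.mem_append] at hn ⊢; grind)
    refine (h1.append (ihg ?_)).of_eq (by simp [eval])
    simp only [List.nodup_append, List.mem_append] at hn h3 ⊢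
    grind
  | whiskerLeft s f ih =>
    have h1 := ih (by
      simp only [ops, toList, List.nodup_append, List.mem_append] at hn ⊢; grind)
    exact (h1.padLeft s.toList).of_eq (by
      simp [eval, flatten, padLeft, ← id_tensorHom, tensorHom_comp_tensorHom_assoc])
  | whiskerRight f s ih =>
    have h1 := ih (by
      simp only [ops, toList, List.nodup_append, List.mem_append] at hn ⊢; grind)
    exact (h1.pad s.toList).of_eq (by
      simp [eval, flatten, padRight, ← tensorHom_id, tensorHom_comp_tensorHom_assoc])
  | @tensor s t s' t' f g ihf ihg =>
    have h1 := ihf (by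
      simp only [ops, toList, outputs_append, List.nodup_append, List.mem_append] at hn ⊢; grind)
    have h2 := ihg (by
      simp only [ops, toList, outputs_append, List.nodup_append, List.mem_append] at hn ⊢; grind)
    exact ((h1.pad s'.toList).append (h2.padLeft t.toList)).of_eq
      (by simp [eval, flatten, padLeft, padRight, ← id_tensorHom, ← tensorHom_id,
        tensorHom_comp_tensorHom_assoc])
  | assoc s t u =>
    refine (Sem.nil (isPerm_appendAssoc _ _ _).1).of_eq ?_
    simp only [eval, flatten, appendAssoc, Iso.trans_inv, Iso.trans_hom, Iso.symm_inv,
      Iso.symm_hom, tensorIso_inv, tensorIso_hom, whiskerRightIso_hom, whiskerLeftIso_hom,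
      Category.assoc]
    rw [reassoc_of% assoc_conj]
  | assocInv s t u =>
    refine (Sem.nil (isPerm_appendAssoc _ _ _).2).of_eq ?_
    simp only [eval, flatten, appendAssoc, Iso.trans_inv, Iso.trans_hom, Iso.symm_inv,
      Iso.symm_hom, tensorIso_inv, tensorIso_hom, whiskerRightIso_inv, whiskerLeftIso_inv,
      Category.assoc]
    rw [reassoc_of% assocInv_conj]
  | leftUnitor s => exact (Sem.nil (.refl _)).of_eq (by simp [eval, flatten, appendIso])
  | leftUnitorInv s => exact (Sem.nil (.refl _)).of_eq (by simp [eval, flatten, appendIso])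
  | rightUnitor s =>
    exact (Sem.nil (isPerm_append_nil _).1).of_eq (by simp [eval, flatten])
  | rightUnitorInv s =>
    exact (Sem.nil (isPerm_append_nil _).2).of_eq (by simp [eval, flatten])
  | braid s t =>
    exact (Sem.nil (isPerm_braiding _ _)).of_eq (by simp [eval, flatten])
  | op o =>
    -- A single operation has no idle wires; the empty list is attached and removed by right
    -- unitors.
    refine (Sem.cons o [] (isPerm_append_nil _).2 (.nil (isPerm_append_nil _).1)).of_eq ?_
    simp [eval, padRight]

end Term

/-! ### The operations of a Hopf algebra with modules -/

/-- Kinds of wires: the Hopf algebra, modules and objects (sources of given morphisms), modules and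
objects (targets of given morphisms). -/
inductive Kind
  | alg
  | mod (k : ℕ)
  | mod' (k : ℕ)
  | obj (k : ℕ)
  | obj' (k : ℕ)
  deriving DecidableEq

/-- A named wire. -/
structure Wire where
  kind : Kind
  name : ℕ
  deriving DecidableEq

/-- The operations, with the names of their input and output wires. -/
inductive Op
  | mul (a b c : ℕ)
  | one (a : ℕ)
  | comul (a b c : ℕ)
  | counit (a : ℕ)
  | anti (a b : ℕ)
  | antiInv (a b : ℕ)
  | cop (a b : ℕ)
  | ev (a b : ℕ)
  | lam (a : ℕ)
  | grp (a : ℕ)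
  | grpInv (a : ℕ)
  | act (k a m m' : ℕ)
  | act' (k a m m' : ℕ)
  | modHom (k m m' : ℕ)
  | objHom (k x x' : ℕ)
  | wire (t : Kind) (a b : ℕ)
  deriving DecidableEq

/-- A wire of the Hopf algebra. -/
abbrev algWire (a : ℕ) : WireTree Wire := leaf ⟨.alg, a⟩

instance : TreeWiring Wire Op where
  dom
    | .mul a b _ => node (algWire a) (algWire b)
    | .one _ => unit
    | .comul a _ _ => algWire a
    | .counit a => algWire a
    | .anti a _ => algWire a
    | .antiInv a _ => algWire a
    | .cop _ _ => unit
    | .ev a b => node (algWire a) (algWire b)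
    | .lam a => algWire a
    | .grp _ => unit
    | .grpInv _ => unit
    | .act k a m _ => node (algWire a) (leaf ⟨.mod k, m⟩)
    | .act' k a m _ => node (algWire a) (leaf ⟨.mod' k, m⟩)
    | .modHom k m _ => leaf ⟨.mod k, m⟩
    | .objHom k x _ => leaf ⟨.obj k, x⟩
    | .wire t a _ => leaf ⟨t, a⟩
  cod
    | .mul _ _ c => algWire c
    | .one a => algWire a
    | .comul _ b c => node (algWire b) (algWire c)
    | .counit _ => unit
    | .anti _ b => algWire b
    | .antiInv _ b => algWire b
    | .cop a b => node (algWire a) (algWire b)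
    | .ev _ _ => unit
    | .lam _ => unit
    | .grp a => algWire a
    | .grpInv a => algWire a
    | .act k _ _ m' => leaf ⟨.mod k, m'⟩
    | .act' k _ _ m' => leaf ⟨.mod' k, m'⟩
    | .modHom k _ m' => leaf ⟨.mod' k, m'⟩
    | .objHom k _ x' => leaf ⟨.obj' k, x'⟩
    | .wire t _ b => leaf ⟨t, b⟩

/-- Renaming a wire. -/
def Wire.rename (σ : ℕ → ℕ) (w : Wire) : Wire := ⟨w.kind, σ w.name⟩

/-- Renaming the wires of an operation. -/
def Op.rename (σ : ℕ → ℕ) : Op → Op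
  | mul a b c => mul (σ a) (σ b) (σ c)
  | one a => one (σ a)
  | comul a b c => comul (σ a) (σ b) (σ c)
  | counit a => counit (σ a)
  | anti a b => anti (σ a) (σ b)
  | antiInv a b => antiInv (σ a) (σ b)
  | cop a b => cop (σ a) (σ b)
  | ev a b => ev (σ a) (σ b)
  | lam a => lam (σ a)
  | grp a => grp (σ a)
  | grpInv a => grpInv (σ a)
  | act k a m m' => act k (σ a) (σ m) (σ m')
  | act' k a m m' => act' k (σ a) (σ m) (σ m')
  | modHom k m m' => modHom k (σ m) (σ m')
  | objHom k x x' => objHom k (σ x) (σ x')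
  | wire t a b => wire t (σ a) (σ b)

section Model

variable {S : Type u} [Category.{v} S] [MonoidalCategory S] [SymmetricCategory S]

variable (S) in
/-- A Hopf algebra with the structure of the theorem, together with families of modules, objects
and morphisms. -/
structure Model where
  H : S
  [hopf : HopfObj H]
  [antipode_iso : IsIso (HopfObj.antipode (X := H))]
  cop : 𝟙_ S ⟶ H ⊗ H
  ev : H ⊗ H ⟶ 𝟙_ S
  lam : H ⟶ 𝟙_ S
  g : 𝟙_ S ⟶ H
  ginv : 𝟙_ S ⟶ H
  cop_hopf : IsHopfCopairing cop
  cop_ev : H ◁ cop ≫ (α_ _ _ _).inv ≫ ev ▷ H = (ρ_ H).hom ≫ (λ_ H).inv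
  ev_cop : cop ▷ H ≫ (α_ _ _ _).hom ≫ H ◁ ev = (λ_ H).hom ≫ (ρ_ H).inv
  lam_right : IsRightCointegral lam
  lam_left : Δ[H] ≫ H ◁ lam ≫ (ρ_ H).hom = lam ≫ g
  g_ginv : IsInversePoints g ginv
  lam_lam : cop ≫ H ◁ HopfObj.antipode ≫ (lam ⊗ₘ lam) ≫ (λ_ (𝟙_ S)).hom = 𝟙 (𝟙_ S)
  cop_symm : cop ≫ (β_ H H).hom =
    cop ≫ H ◁ ((leftMul ginv ≫ rightMul g) ≫ HopfObj.antipode ≫ HopfObj.antipode)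
  mod : ℕ → Mod S H
  mod' : ℕ → Mod S H
  modHom : ∀ k, mod k ⟶ mod' k
  obj : ℕ → S
  obj' : ℕ → S
  objHom : ∀ k, obj k ⟶ obj' k

attribute [instance] Model.hopf Model.antipode_iso

namespace Model

variable (E : Model S)

/-- The object of a kind of wires. -/
@[reducible] def kindObj : Kind → S
  | .alg => E.H
  | .mod k => (E.mod k).X
  | .mod' k => (E.mod' k).X
  | .obj k => E.obj k
  | .obj' k => E.obj' k

/-- The morphism of an operation. -/
noncomputable def opMor : (o : Op) → ((TreeWiring.dom o).eval (fun w : Wire => E.kindObj w.kind) ⟶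
    (TreeWiring.cod o).eval (fun w : Wire => E.kindObj w.kind))
  | .mul _ _ _ => μ[E.H]
  | .one _ => η[E.H]
  | .comul _ _ _ => Δ[E.H]
  | .counit _ => ε[E.H]
  | .anti _ _ => HopfObj.antipode (X := E.H)
  | .antiInv _ _ => inv (HopfObj.antipode (X := E.H))
  | .cop _ _ => E.cop
  | .ev _ _ => E.ev
  | .lam _ => E.lam
  | .grp _ => E.g
  | .grpInv _ => E.ginv
  | .act k _ _ _ => HopfExtension.act (E.mod k)
  | .act' k _ _ _ => HopfExtension.act (E.mod' k)
  | .modHom k _ _ => (E.modHom k).hom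
  | .objHom k _ _ => E.objHom k
  | .wire t _ _ => 𝟙 (E.kindObj t)

/-- The interpretation of the operations. -/
@[reducible] noncomputable def interp : TreeInterp S Wire Op where
  ob w := E.kindObj w.kind
  mor := E.opMor

/-- Renaming wires within their kinds. -/
noncomputable abbrev renameIso (σ : ℕ → ℕ) (l : List Wire) :
    listTensor E.interp.toInterp.ob l ≅ listTensor E.interp.toInterp.ob (l.map (Wire.rename σ)) :=
  HopfExtension.renameIso (E := E.interp.toInterp) (Wire.rename σ) (fun _ => Iso.refl _) l

/-- The interpretation depends only on the kinds of the wires, so renaming isomorphisms are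
identities. -/
lemma mor_rename (σ : ℕ → ℕ) (o : Op) : E.interp.toInterp.mor (o.rename σ) ≍
    (E.renameIso σ (Wiring.src o)).inv ≫ E.interp.toInterp.mor o ≫
      (E.renameIso σ (Wiring.tgt o)).hom := by
  have h : ∀ {X Y : S} (x : X ≅ X) (y : Y ≅ Y) (f : X ⟶ Y), x = Iso.refl _ → y = Iso.refl _ →
      f ≍ x.inv ≫ f ≫ y.hom := by
    rintro X Y _ _ f rfl rfl
    simp
  have h₁ : ∀ X : S, (Iso.refl X ⊗ᵢ Iso.refl (𝟙_ S)) = Iso.refl _ := fun X => by ext; simp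
  have h₂ : ∀ X Y : S, (Iso.refl X ⊗ᵢ (Iso.refl Y ⊗ᵢ Iso.refl (𝟙_ S))) = Iso.refl _ :=
    fun X Y => by ext; simp
  cases o <;> refine h _ _ _ ?_ ?_ <;> first | rfl | exact h₁ _ | exact h₂ _ _

lemma src_rename (σ : ℕ → ℕ) (o : Op) :
    Wiring.src (o.rename σ) = (Wiring.src o).map (Wire.rename σ) := by
  cases o <;> rfl

lemma tgt_rename (σ : ℕ → ℕ) (o : Op) :
    Wiring.tgt (o.rename σ) = (Wiring.tgt o).map (Wire.rename σ) := by
  cases o <;> rfl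

end Model

/-! ### Checking equational proofs -/

/-- Renaming the wires of an equation. -/
def Equation.rename (σ : ℕ → ℕ) (e : Equation Wire Op) : Equation Wire Op where
  dom := e.dom.map (Wire.rename σ)
  cod := e.cod.map (Wire.rename σ)
  lhs := e.lhs.map (Op.rename σ)
  rhs := e.rhs.map (Op.rename σ)

/-- The reversed equation. -/
def Equation.symm (e : Equation Wire Op) : Equation Wire Op where
  dom := e.dom
  cod := e.cod
  lhs := e.rhs
  rhs := e.lhs

/-- The equation holds in the model. -/
class Model.Holds (E : Model S) (e : Equation Wire Op) : Prop where
  valid : e.Valid E.interp.toInterp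

/-- A step of an equational proof: rewriting along an equation whose wire `i` is renamed as the
`i`-th entry of a list, removal or insertion of a trivial operation, or renaming of an inner wire.
-/
inductive Step
  | rw (e : Equation Wire Op) (σ : List ℕ)
  | unwire (t : Kind) (a b : ℕ)
  | addWire (t : Kind) (a b : ℕ)
  | rename (a b : ℕ)

/-- The operations that can be executed on the wires `Γ`, in an order that is possible, and the
remaining ones. -/
def schedule : ℕ → List Wire → List Op → List Op × List Op
  | 0, _, P => ([], P)
  | n + 1, Γ, P =>
    match P.find? fun o => (Wiring.src o).all fun w => Γ.elem w with
    | none => ([], P)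
    | some o =>
      let r := schedule n (Wiring.tgt o ++ Γ.diff (Wiring.src o)) (P.erase o)
      (o :: r.1, r.2)

/-- Rewriting `P` along an equation. -/
def rewriteWith (Γ Γ' : List Wire) (e : Equation Wire Op) (P : List Op) : Option (List Op) :=
  let R := P.diff e.lhs
  let r := schedule R.length Γ R
  (exec Γ r.1).bind fun m =>
    let F := m.diff e.dom
    let post := (schedule r.2.length (e.cod ++ F) r.2).1
    if wellFormed Γ (r.1 ++ e.lhs ++ post) Γ' && P.isPerm (r.1 ++ e.lhs ++ post) &&
        m.isPerm (e.dom ++ F) &&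
        (exec (e.cod ++ F) post).any (fun m => m.isPerm Γ') then
      some (r.1 ++ e.rhs ++ post)
    else none

/-- Replacing one name by another. -/
def substName (a b : ℕ) (n : ℕ) : ℕ := if n = a then b else n

/-- Removal of a trivial operation from `P`. -/
def removeWire (Γ Γ' : List Wire) (t : Kind) (a b : ℕ) (P : List Op) : Option (List Op) :=
  if P.elem (.wire t a b) then
    if (Γ ++ Γ').all fun w => w.name != b then
      some ((P.erase (.wire t a b)).map (Op.rename (substName b a)))
    else if (Γ ++ Γ').all fun w => w.name != a then
      some ((P.erase (.wire t a b)).map (Op.rename (substName a b)))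
    else none
  else none

/-- Insertion of a trivial operation into `P`. -/
def addWire (Γ Γ' : List Wire) (t : Kind) (a b : ℕ) (P : List Op) : Option (List Op) :=
  let R := if Γ'.elem ⟨t, b⟩ then
      P.map fun o => if (Wiring.tgt o).elem ⟨t, b⟩ then o.rename (substName b a) else o
    else P.map fun o => if (Wiring.src o).elem ⟨t, a⟩ then o.rename (substName a b) else o
  let Q := (schedule (P.length + 1) Γ (.wire t a b :: R)).1
  if wellFormed Γ Q Γ' && wellFormed Γ P Γ' &&
      (removeWire Γ Γ' t a b Q).any (fun P' => P'.isPerm P) then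
    some Q
  else none

/-- Applying a list of steps. -/
def runSteps (Γ Γ' : List Wire) : List Step → List Op → Option (List Op)
  | [], P => some P
  | .rw e σ :: L, P =>
    -- Names beyond the end of the list are kept. In the proofs below, entries at indices that are
    -- not wires of the equation are filled with `0`.
    (rewriteWith Γ Γ' (e.rename fun n => σ.getD n n) P).bind (runSteps Γ Γ' L)
  | .unwire t a b :: L, P => (removeWire Γ Γ' t a b P).bind (runSteps Γ Γ' L)
  | .addWire t a b :: L, P => (addWire Γ Γ' t a b P).bind (runSteps Γ Γ' L)
  | .rename a b :: L, P =>
    if (Γ ++ Γ').all fun w => w.name != a then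
      runSteps Γ Γ' L (P.map (Op.rename (substName a b)))
    else none

/-- The steps transform the left hand side of the equation to the right hand side. -/
def Equation.check (e : Equation Wire Op) (L : List Step) : Bool :=
  wellFormed e.dom e.lhs e.cod && wellFormed e.dom e.rhs e.cod &&
    (runSteps e.dom e.cod L e.lhs).any fun P => P.isPerm e.rhs

/-- The equations used by a list of steps hold. -/
class Model.StepsHold (E : Model S) (L : List Step) : Prop where
  valid : ∀ e σ, Step.rw e σ ∈ L → E.Holds e

instance (E : Model S) : E.StepsHold [] := ⟨by simp⟩

instance (E : Model S) (e : Equation Wire Op) (σ : List ℕ) (L : List Step) [he : E.Holds e]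
    [hL : E.StepsHold L] : E.StepsHold (.rw e σ :: L) :=
  ⟨fun e' σ' h => by
    rcases List.mem_cons.1 h with h | h
    · cases h; exact he
    · exact hL.valid e' σ' h⟩

instance (E : Model S) (t : Kind) (a b : ℕ) (L : List Step) [hL : E.StepsHold L] :
    E.StepsHold (.unwire t a b :: L) :=
  ⟨fun e' σ' h => hL.valid e' σ' (by simpa using h)⟩

instance (E : Model S) (t : Kind) (a b : ℕ) (L : List Step) [hL : E.StepsHold L] :
    E.StepsHold (.addWire t a b :: L) :=
  ⟨fun e' σ' h => hL.valid e' σ' (by simpa using h)⟩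

instance (E : Model S) (a b : ℕ) (L : List Step) [hL : E.StepsHold L] :
    E.StepsHold (.rename a b :: L) :=
  ⟨fun e' σ' h => hL.valid e' σ' (by simpa using h)⟩

instance (E : Model S) (e : Equation Wire Op) [he : E.Holds e] : E.Holds e.symm :=
  ⟨let ⟨f, h, h'⟩ := he.valid; ⟨f, h', h⟩⟩

variable {E : Model S}

lemma Sem.rename_model {Γ Γ' : List Wire} {P : List Op} {f} (σ : ℕ → ℕ)
    (h : Sem E.interp.toInterp Γ P Γ' f) :
    Sem E.interp.toInterp (Γ.map (Wire.rename σ)) (P.map (Op.rename σ)) (Γ'.map (Wire.rename σ))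
      ((E.renameIso σ Γ).inv ≫ f ≫ (E.renameIso σ Γ').hom) :=
  h.rename (Wire.rename σ) (fun _ => Iso.refl _) (Op.rename σ) (Model.src_rename σ)
    (Model.tgt_rename σ) (E.mor_rename σ)

lemma Model.Holds.rename {e : Equation Wire Op} (he : E.Holds e) (σ : ℕ → ℕ) :
    (e.rename σ).Valid E.interp.toInterp :=
  let ⟨_, h, h'⟩ := he.valid
  ⟨_, h.rename_model σ, h'.rename_model σ⟩

/-- Nothing is assumed about the scheduling that finds the context of the rewrite: the Boolean tests
certify its output. -/
lemma Sem.rewriteWith {e : Equation Wire Op} (he : e.Valid E.interp.toInterp) {Γ Γ' : List Wire}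
    {P Q : List Op} {f} (h : Sem E.interp.toInterp Γ P Γ' f)
    (hQ : rewriteWith Γ Γ' e P = some Q) : Sem E.interp.toInterp Γ Q Γ' f := by
  simp only [HopfExtension.rewriteWith, Option.bind_eq_some_iff, Option.ite_none_right_eq_some,
    Bool.and_eq_true, Option.some.injEq] at hQ
  obtain ⟨m, hm, ⟨⟨⟨h1, h2⟩, h3⟩, h4⟩, rfl⟩ := hQ
  refine h.rewrite he _ _ (m.diff e.dom) h1 (List.isPerm_iff.1 h2) ?_ h4
  simp [hm, h3]

lemma Sem.erase_wire {Γ Γ' : List Wire} {A B : List Op} {t : Kind} {a : ℕ} {f}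
    (h : Sem E.interp.toInterp Γ (A ++ .wire t a a :: B) Γ' f) :
    Sem E.interp.toInterp Γ (A ++ B) Γ' f := by
  obtain ⟨m, x, y, hx, hy, rfl⟩ := h.exists_of_append
  cases hy with
  | cons _ F hp hs =>
    have e : E.interp.toInterp.mor (.wire t a a) = 𝟙 _ := by
      have : (ρ_ (E.kindObj t)).hom ≫ 𝟙 _ ≫ (ρ_ (E.kindObj t)).inv = 𝟙 _ := by simp
      exact this
    refine hx.append ((hs.perm_comp hp).of_eq ?_)
    have := congrArg (padRight · F) e
    simp only at this
    rw [this]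
    simp

lemma Sem.rename_inner_model {Γ Γ' : List Wire} {P : List Op} {f}
    (h : Sem E.interp.toInterp Γ P Γ' f) (a b : ℕ)
    (ha : ((Γ ++ Γ').all fun w => w.name != a) = true) :
    Sem E.interp.toInterp Γ (P.map (Op.rename (substName a b))) Γ' f := by
  have aux : ∀ w : Wire, w.name ≠ a → w.rename (substName a b) = w := by
    rintro ⟨t, n⟩ hn
    simp only [Wire.rename, substName, if_neg hn]
  simp only [List.all_eq_true, List.mem_append, bne_iff_ne] at ha
  exact h.rename_inner (Wire.rename (substName a b)) (fun _ => Iso.refl _) _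
    (Model.src_rename _) (Model.tgt_rename _) (E.mor_rename _)
    (fun w hw => ⟨aux w (ha w (.inl hw)), .rfl⟩) (fun w hw => ⟨aux w (ha w (.inr hw)), .rfl⟩)

/-- Renaming whichever end is an inner wire makes the two ends of the trivial operation equal, and
then it is literally an identity. -/
lemma Sem.removeWire {Γ Γ' : List Wire} {P Q : List Op} {f} {t : Kind} {a b : ℕ}
    (h : Sem E.interp.toInterp Γ P Γ' f) (hQ : removeWire Γ Γ' t a b P = some Q) :
    Sem E.interp.toInterp Γ Q Γ' f := by
  rw [HopfExtension.removeWire] at hQ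
  split_ifs at hQ with h1 h2 h3
  all_goals
    obtain ⟨A, B, -, hP, he⟩ := List.exists_erase_eq (List.elem_iff.1 h1)
    rw [he] at hQ
    subst hP
    obtain rfl := Option.some.inj hQ
  · have := h.rename_inner_model b a h2
    simp only [List.map_append, List.map_cons, Op.rename, substName, if_true] at this ⊢
    split_ifs at this with h3
    · exact this.erase_wire
    · exact this.erase_wire
  · have := h.rename_inner_model a b h3
    simp only [List.map_append, List.map_cons, Op.rename, substName, if_true] at this ⊢
    split_ifs at this with h3
    · exact this.erase_wire
    · exact this.erase_wire

/-- Insertion is justified by undoing it: the new diagram denotes some morphism, removing the wire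
recovers `P`, and uniqueness shows that the morphism is `f`. -/
lemma Sem.addWire {Γ Γ' : List Wire} {P Q : List Op} {f} {t : Kind} {a b : ℕ}
    (h : Sem E.interp.toInterp Γ P Γ' f) (hQ : addWire Γ Γ' t a b P = some Q) :
    Sem E.interp.toInterp Γ Q Γ' f := by
  simp only [HopfExtension.addWire, Option.ite_none_right_eq_some, Bool.and_eq_true,
    Option.any_eq_true, Option.some.injEq] at hQ
  obtain ⟨⟨⟨h1, h2⟩, P', hP', h3⟩, rfl⟩ := hQ
  obtain ⟨-, f', hf'⟩ := Sem.exists_of_wellFormed (E := E.interp.toInterp) h1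
  obtain ⟨hn, -⟩ := Sem.exists_of_wellFormed (E := E.interp.toInterp) h2
  obtain rfl := h.unique (hf'.removeWire hP') (List.isPerm_iff.1 h3).symm hn
  exact hf'

lemma Sem.runSteps {Γ Γ' : List Wire} {L : List Step}
    (hL : ∀ e σ, Step.rw e σ ∈ L → E.Holds e) {P Q : List Op} {f}
    (h : Sem E.interp.toInterp Γ P Γ' f) (hQ : runSteps Γ Γ' L P = some Q) :
    Sem E.interp.toInterp Γ Q Γ' f := by
  induction L generalizing P with
  | nil =>
    obtain rfl := Option.some.inj hQ
    exact h
  | cons s L ih =>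
    have hL' := fun e σ h => hL e σ (List.mem_cons_of_mem _ h)
    cases s with
    | rw e σ =>
      obtain ⟨R, hR, hQ⟩ := Option.bind_eq_some_iff.1 hQ
      exact ih hL' (h.rewriteWith ((hL e σ List.mem_cons_self).rename _) hR) hQ
    | unwire t a b =>
      obtain ⟨R, hR, hQ⟩ := Option.bind_eq_some_iff.1 hQ
      exact ih hL' (h.removeWire hR) hQ
    | addWire t a b =>
      obtain ⟨R, hR, hQ⟩ := Option.bind_eq_some_iff.1 hQ
      exact ih hL' (h.addWire hR) hQ
    | rename a b =>
      simp only [HopfExtension.runSteps, Option.ite_none_right_eq_some] at hQ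
      exact ih hL' (h.rename_inner_model a b hQ.1) hQ.2

/-- A checked equational proof establishes its equation. -/
theorem Model.Holds.of_steps (e : Equation Wire Op) (L : List Step) [hL : E.StepsHold L]
    (hc : e.check L = true) : E.Holds e := by
  simp only [Equation.check, Bool.and_eq_true, Option.any_eq_true] at hc
  obtain ⟨⟨h1, h2⟩, Q, hQ, h3⟩ := hc
  obtain ⟨-, f, hf⟩ := Sem.exists_of_wellFormed (E := E.interp.toInterp) h1
  obtain ⟨hn, f', hf'⟩ := Sem.exists_of_wellFormed (E := E.interp.toInterp) h2
  have hf₂ := hf.runSteps hL.valid hQ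
  have hp := List.isPerm_iff.1 h3
  obtain rfl := hf'.unique hf₂ hp.symm hn
  exact ⟨f', hf, hf'⟩

variable {s t : WireTree Wire} (x y : Term Op s t)

/-- The equation between the string diagrams of two formal morphisms. -/
def Term.equation : Equation Wire Op where
  dom := s.toList
  cod := t.toList
  lhs := x.ops
  rhs := y.ops

/-- The string diagrams of equal morphisms are equal. -/
theorem Model.Holds.of_eval (hx : (s.toList ++ outputs x.ops).Nodup)
    (hy : (s.toList ++ outputs y.ops).Nodup) (h : x.eval E.interp = y.eval E.interp) :
    E.Holds (x.equation y) :=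
  ⟨_, (x.sem E.interp hx), (y.sem E.interp hy).of_eq (by rw [h])⟩

/-- Formal morphisms whose string diagrams are equal denote equal morphisms. -/
theorem Model.Holds.eval_eq (h : E.Holds (x.equation y))
    (hx : (s.toList ++ outputs x.ops).Nodup) (hy : (s.toList ++ outputs y.ops).Nodup) :
    x.eval E.interp = y.eval E.interp := by
  obtain ⟨f, hf, hf'⟩ := h.valid
  have h1 := (x.sem E.interp hx).unique hf (.refl _) hx
  have h2 := (y.sem E.interp hy).unique hf' (.refl _) hy
  have h3 := h1.trans h2.symm
  rwa [Iso.cancel_iso_inv_left, Iso.cancel_iso_hom_right] at h3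

/-- Proving an equation between morphisms by checked steps between their string diagrams. -/
theorem Term.eval_eq_of_steps (E : Model S) (x y : Term Op s t) (L : List Step) [E.StepsHold L]
    (hc : (x.equation y).check L = true) : x.eval E.interp = y.eval E.interp := by
  have h := Model.Holds.of_steps (E := E) _ L hc
  simp only [Equation.check, wellFormed, Bool.and_eq_true, decide_eq_true_eq] at hc
  exact h.eval_eq x y hc.1.1.1 hc.1.2.1

end Model

/-! ### The structure of the model as string diagrams -/

local infixr:80 "⊚" => Term.comp
local infixr:81 "◁ₜ" => Term.whiskerLeft
local infixl:81 "▷ₜ" => Term.whiskerRight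
local prefix:max "op" => Term.op (O := Op)

section

variable {S : Type u} [Category.{v} S] [MonoidalCategory S] [SymmetricCategory S] {E : Model S}

/-- Associativity of the product. -/
def mulAssoc : Equation Wire Op :=
  Term.equation (op (.mul 0 1 4) ▷ₜ algWire 2 ⊚ op (.mul 4 2 3))
    (.assoc _ _ _ ⊚ algWire 0 ◁ₜ op (.mul 1 2 5) ⊚ op (.mul 0 5 3))

instance : E.Holds mulAssoc :=
  .of_eval _ _ (by decide) (by decide) (MonObj.mul_assoc E.H)

/-- The left unit law. -/
def oneMul : Equation Wire Op :=
  Term.equation (.leftUnitorInv _ ⊚ op (.one 2) ▷ₜ algWire 0 ⊚ op (.mul 2 0 1))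
    (op (.wire .alg 0 1))

instance : E.Holds oneMul :=
  .of_eval _ _ (by decide) (by decide) (by
    have h : (λ_ E.H).inv ≫ η[E.H] ▷ E.H ≫ μ[E.H] = 𝟙 E.H := by simp
    exact h)

/-- The right unit law. -/
def mulOne : Equation Wire Op :=
  Term.equation (.rightUnitorInv _ ⊚ algWire 0 ◁ₜ op (.one 2) ⊚ op (.mul 0 2 1))
    (op (.wire .alg 0 1))

instance : E.Holds mulOne :=
  .of_eval _ _ (by decide) (by decide) (by
    have h : (ρ_ E.H).inv ≫ E.H ◁ η[E.H] ≫ μ[E.H] = 𝟙 E.H := by simp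
    exact h)

/-- Coassociativity. -/
def coassoc : Equation Wire Op :=
  Term.equation (op (.comul 0 4 3) ⊚ op (.comul 4 1 2) ▷ₜ algWire 3 ⊚ .assoc _ _ _)
    (op (.comul 0 1 5) ⊚ algWire 1 ◁ₜ op (.comul 5 2 3))

instance : E.Holds coassoc :=
  .of_eval _ _ (by decide) (by decide) (ComonObj.comul_assoc E.H).symm

/-- The left counit law. -/
def counitLeft : Equation Wire Op :=
  Term.equation (op (.comul 0 2 1) ⊚ op (.counit 2) ▷ₜ algWire 1 ⊚ .leftUnitor _)
    (op (.wire .alg 0 1))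

instance : E.Holds counitLeft :=
  .of_eval _ _ (by decide) (by decide) (by
    have h : Δ[E.H] ≫ ε[E.H] ▷ E.H ≫ (λ_ E.H).hom = 𝟙 E.H := by simp
    exact h)

/-- The right counit law. -/
def counitRight : Equation Wire Op :=
  Term.equation (op (.comul 0 1 2) ⊚ algWire 1 ◁ₜ op (.counit 2) ⊚ .rightUnitor _)
    (op (.wire .alg 0 1))

instance : E.Holds counitRight :=
  .of_eval _ _ (by decide) (by decide) (by
    have h : Δ[E.H] ≫ E.H ◁ ε[E.H] ≫ (ρ_ E.H).hom = 𝟙 E.H := by simp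
    exact h)

/-- Exchanging the two middle factors. -/
@[reducible] def middleSwap (s t s' t' : WireTree Wire) :
    Term Op (.node (.node s t) (.node s' t')) (.node (.node s s') (.node t t')) :=
  .assoc _ _ _ ⊚ s ◁ₜ .assocInv _ _ _ ⊚ s ◁ₜ (.braid _ _ ▷ₜ t') ⊚ s ◁ₜ .assoc _ _ _ ⊚
    .assocInv _ _ _

/-- Multiplicativity of the coproduct. -/
def mulComul : Equation Wire Op :=
  Term.equation (op (.mul 0 1 4) ⊚ op (.comul 4 2 3))
    (.tensor (op (.comul 0 5 6)) (op (.comul 1 7 8)) ⊚ middleSwap _ _ _ _ ⊚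
      .tensor (op (.mul 5 7 2)) (op (.mul 6 8 3)))

instance : E.Holds mulComul :=
  .of_eval _ _ (by decide) (by decide) (BimonObj.mul_comul E.H)

/-- Multiplicativity of the counit. -/
def mulCounit : Equation Wire Op :=
  Term.equation (op (.mul 0 1 2) ⊚ op (.counit 2))
    (.tensor (op (.counit 0)) (op (.counit 1)) ⊚ .leftUnitor _)

instance : E.Holds mulCounit :=
  .of_eval _ _ (by decide) (by decide) (BimonObj.mul_counit E.H)

/-- The antipode is a left convolution inverse of the identity. -/
def antiLeft : Equation Wire Op :=
  Term.equation (op (.comul 0 2 3) ⊚ op (.anti 2 4) ▷ₜ algWire 3 ⊚ op (.mul 4 3 1))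
    (op (.counit 0) ⊚ op (.one 1))

instance : E.Holds antiLeft :=
  .of_eval _ _ (by decide) (by decide) (HopfObj.antipode_left E.H)

/-- The antipode is a right convolution inverse of the identity. -/
def antiRight : Equation Wire Op :=
  Term.equation (op (.comul 0 2 3) ⊚ algWire 2 ◁ₜ op (.anti 3 4) ⊚ op (.mul 2 4 1))
    (op (.counit 0) ⊚ op (.one 1))

instance : E.Holds antiRight :=
  .of_eval _ _ (by decide) (by decide) (HopfObj.antipode_right E.H)

/-- The inverse antipode. -/
def antiAntiInv : Equation Wire Op :=
  Term.equation (op (.anti 0 2) ⊚ op (.antiInv 2 1)) (op (.wire .alg 0 1))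

instance : E.Holds antiAntiInv :=
  .of_eval _ _ (by decide) (by decide) (IsIso.hom_inv_id (HopfObj.antipode (X := E.H)))

/-- The inverse antipode. -/
def antiInvAnti : Equation Wire Op :=
  Term.equation (op (.antiInv 0 2) ⊚ op (.anti 2 1)) (op (.wire .alg 0 1))

instance : E.Holds antiInvAnti :=
  .of_eval _ _ (by decide) (by decide) (IsIso.inv_hom_id (HopfObj.antipode (X := E.H)))

/-- The antipode reverses products. -/
def mulAnti : Equation Wire Op :=
  Term.equation (op (.mul 0 1 3) ⊚ op (.anti 3 2))
    (.tensor (op (.anti 0 4)) (op (.anti 1 5)) ⊚ .braid _ _ ⊚ op (.mul 5 4 2))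

instance : E.Holds mulAnti :=
  .of_eval _ _ (by decide) (by decide) (HopfObj.mul_antipode E.H)

/-- The antipode reverses coproducts. -/
def antiComul : Equation Wire Op :=
  Term.equation (op (.anti 0 3) ⊚ op (.comul 3 1 2))
    (op (.comul 0 4 5) ⊚ .braid _ _ ⊚ .tensor (op (.anti 5 1)) (op (.anti 4 2)))

instance : E.Holds antiComul :=
  .of_eval _ _ (by decide) (by decide) (HopfObj.antipode_comul E.H)

/-- The antipode preserves the unit. -/
def oneAnti : Equation Wire Op :=
  Term.equation (op (.one 1) ⊚ op (.anti 1 0)) (op (.one 0))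

instance : E.Holds oneAnti :=
  .of_eval _ _ (by decide) (by decide) (HopfObj.one_antipode E.H)

/-- The antipode preserves the counit. -/
def antiCounit : Equation Wire Op :=
  Term.equation (op (.anti 0 1) ⊚ op (.counit 1)) (op (.counit 0))

instance : E.Holds antiCounit :=
  .of_eval _ _ (by decide) (by decide) (HopfObj.antipode_counit E.H)

/-- The first coproduct axiom of the copairing. -/
def copComulLeft : Equation Wire Op :=
  Term.equation (op (.cop 3 2) ⊚ op (.comul 3 0 1) ▷ₜ algWire 2 ⊚ .id (.node (.node _ _) _))
    (.leftUnitorInv _ ⊚ .tensor (op (.cop 0 4)) (op (.cop 1 5)) ⊚ middleSwap _ _ _ _ ⊚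
      .node _ _ ◁ₜ op (.mul 4 5 2))

instance : E.Holds copComulLeft :=
  .of_eval _ _ (by decide) (by decide) (by
    have h := E.cop_hopf.comul_left
    rw [← Category.comp_id (_ ▷ _)] at h
    exact h)

/-- The second coproduct axiom of the copairing. -/
def copComulRight : Equation Wire Op :=
  Term.equation (op (.cop 0 3) ⊚ algWire 0 ◁ₜ op (.comul 3 1 2))
    (.leftUnitorInv _ ⊚ .tensor (op (.cop 4 1)) (op (.cop 5 2)) ⊚ middleSwap _ _ _ _ ⊚
      op (.mul 4 5 0) ▷ₜ .node _ _)

instance : E.Holds copComulRight :=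
  .of_eval _ _ (by decide) (by decide) E.cop_hopf.comul_right

/-- The first counit axiom of the copairing. -/
def copCounitLeft : Equation Wire Op :=
  Term.equation (op (.cop 1 0) ⊚ op (.counit 1) ▷ₜ algWire 0 ⊚ .leftUnitor _) (op (.one 0))

instance : E.Holds copCounitLeft :=
  .of_eval _ _ (by decide) (by decide) E.cop_hopf.counit_left

/-- The second counit axiom of the copairing. -/
def copCounitRight : Equation Wire Op :=
  Term.equation (op (.cop 0 1) ⊚ algWire 0 ◁ₜ op (.counit 1) ⊚ .rightUnitor _) (op (.one 0))

instance : E.Holds copCounitRight :=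
  .of_eval _ _ (by decide) (by decide) E.cop_hopf.counit_right

/-- The first triangle identity of the duality. -/
def evCop : Equation Wire Op :=
  Term.equation (.rightUnitorInv _ ⊚ algWire 0 ◁ₜ op (.cop 2 1) ⊚ .assocInv _ _ _ ⊚
    op (.ev 0 2) ▷ₜ algWire 1 ⊚ .leftUnitor _) (op (.wire .alg 0 1))

instance : E.Holds evCop :=
  .of_eval _ _ (by decide) (by decide) (by
    have h : (ρ_ E.H).inv ≫ E.H ◁ E.cop ≫ (α_ _ _ _).inv ≫ E.ev ▷ E.H ≫ (λ_ E.H).hom =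
        𝟙 E.H := by
      rw [Iso.inv_comp_eq, ← cancel_mono (λ_ E.H).inv]
      simpa using E.cop_ev
    exact h)

/-- The second triangle identity of the duality. -/
def copEv : Equation Wire Op :=
  Term.equation (.leftUnitorInv _ ⊚ op (.cop 1 2) ▷ₜ algWire 0 ⊚ .assoc _ _ _ ⊚
    algWire 1 ◁ₜ op (.ev 2 0) ⊚ .rightUnitor _) (op (.wire .alg 0 1))

instance : E.Holds copEv :=
  .of_eval _ _ (by decide) (by decide) (by
    have h : (λ_ E.H).inv ≫ E.cop ▷ E.H ≫ (α_ _ _ _).hom ≫ E.H ◁ E.ev ≫ (ρ_ E.H).hom =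
        𝟙 E.H := by
      rw [Iso.inv_comp_eq, ← cancel_mono (ρ_ E.H).inv]
      simpa using E.ev_cop
    exact h)

/-- The right cointegral. -/
def lamRight : Equation Wire Op :=
  Term.equation (op (.comul 0 2 1) ⊚ op (.lam 2) ▷ₜ algWire 1 ⊚ .leftUnitor _)
    (op (.lam 0) ⊚ op (.one 1))

instance : E.Holds lamRight :=
  .of_eval _ _ (by decide) (by decide) E.lam_right

/-- The distinguished point. -/
def lamLeft : Equation Wire Op :=
  Term.equation (op (.comul 0 1 2) ⊚ algWire 1 ◁ₜ op (.lam 2) ⊚ .rightUnitor _)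
    (op (.lam 0) ⊚ op (.grp 1))

instance : E.Holds lamLeft :=
  .of_eval _ _ (by decide) (by decide) E.lam_left

/-- The point `g` has a left inverse. -/
def grpInvMul : Equation Wire Op :=
  Term.equation (op (.grp 2) ⊚ .leftUnitorInv _ ⊚ op (.grpInv 1) ▷ₜ algWire 2 ⊚
    op (.mul 1 2 0)) (op (.one 0))

instance : E.Holds grpInvMul :=
  .of_eval _ _ (by decide) (by decide) E.g_ginv.1

/-- The point `g` has a right inverse. -/
def grpMulInv : Equation Wire Op :=
  Term.equation (op (.grpInv 2) ⊚ .leftUnitorInv _ ⊚ op (.grp 1) ▷ₜ algWire 2 ⊚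
    op (.mul 1 2 0)) (op (.one 0))

instance : E.Holds grpMulInv :=
  .of_eval _ _ (by decide) (by decide) E.g_ginv.2

/-- The normalization of the cointegral. -/
def lamLam : Equation Wire Op :=
  Term.equation (op (.cop 0 1) ⊚ algWire 0 ◁ₜ op (.anti 1 2) ⊚
    .tensor (op (.lam 0)) (op (.lam 2)) ⊚ .leftUnitor _) (.id _)

instance : E.Holds lamLam :=
  .of_eval _ _ (by decide) (by decide) E.lam_lam

/-- The symmetry of the copairing. -/
def copSymm : Equation Wire Op :=
  Term.equation (op (.cop 1 0) ⊚ .braid _ _) (op (.cop 0 2) ⊚ algWire 0 ◁ₜ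
    (((.leftUnitorInv _ ⊚ op (.grpInv 3) ▷ₜ algWire 2 ⊚ op (.mul 3 2 4)) ⊚
      .rightUnitorInv _ ⊚ algWire 4 ◁ₜ op (.grp 5) ⊚ op (.mul 4 5 6)) ⊚
        op (.anti 6 7) ⊚ op (.anti 7 1)))

instance : E.Holds copSymm :=
  .of_eval _ _ (by decide) (by decide) E.cop_symm

/-- Associativity of an action. -/
def actMul (k : ℕ) : Equation Wire Op :=
  Term.equation (op (.mul 0 1 2) ▷ₜ .leaf _ ⊚ op (.act k 2 3 4))
    (.assoc _ _ _ ⊚ algWire 0 ◁ₜ op (.act k 1 3 5) ⊚ op (.act k 0 5 4))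

instance (k : ℕ) : E.Holds (actMul k) :=
  .of_eval _ _ (by simp [outputs, Wiring.tgt, TreeWiring.cod, TreeWiring.dom, toList, Term.ops])
    (by simp [outputs, Wiring.tgt, TreeWiring.cod, TreeWiring.dom, toList, Term.ops])
    (ModObj.mul_smul_self E.H (E.mod k).X)

/-- Unitality of an action. -/
def actOne (k : ℕ) : Equation Wire Op :=
  Term.equation (.leftUnitorInv _ ⊚ op (.one 0) ▷ₜ .leaf _ ⊚ op (.act k 0 1 2))
    (op (.wire (.mod k) 1 2))

instance (k : ℕ) : E.Holds (actOne k) :=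
  .of_eval _ _ (by simp [outputs, Wiring.tgt, TreeWiring.cod, Term.ops])
    (by simp [outputs, Wiring.tgt, TreeWiring.cod, toList, Term.ops])
    (by
      have h : (λ_ (E.mod k).X).inv ≫ η[E.H] ▷ (E.mod k).X ≫ act (E.mod k) = 𝟙 _ := by
        rw [Iso.inv_comp_eq, Category.comp_id]
        exact ModObj.one_smul_self E.H (E.mod k).X
      exact h)

/-- Linearity of a morphism of modules. -/
def actModHom (k : ℕ) : Equation Wire Op :=
  Term.equation (op (.act k 0 1 2) ⊚ op (.modHom k 2 3))
    (algWire 0 ◁ₜ op (.modHom k 1 4) ⊚ op (.act' k 0 4 3))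

instance (k : ℕ) : E.Holds (actModHom k) :=
  .of_eval _ _ (by simp [outputs, Wiring.tgt, TreeWiring.cod, TreeWiring.dom, toList, Term.ops])
    (by simp [outputs, Wiring.tgt, TreeWiring.cod, TreeWiring.dom, toList, Term.ops])
    (E.modHom k).isModHom.smul_hom

end

/-! ### Duality and the grouplike point -/

section

variable {S : Type u} [Category.{v} S] [MonoidalCategory S] [SymmetricCategory S] {E : Model S}

/-- The counit through the duality. -/
def counitEv : Equation Wire Op where
  dom := [⟨.alg, 0⟩]
  cod := []
  lhs := [.counit 0]
  rhs := [.one 2, .ev 0 2]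

/-- Apply ε to x = ev(x, γ')γ'' and use γ' ε(γ'') = 1. -/
instance : E.Holds counitEv := .of_steps _
    [.addWire .alg 0 1, .rw evCop.symm [0, 1, 2], .rw copCounitRight [2, 1]]
    (by decide +kernel)

/-- The counit through the duality. -/
def counitEv₂ : Equation Wire Op where
  dom := [⟨.alg, 0⟩]
  cod := []
  lhs := [.counit 0]
  rhs := [.one 2, .ev 2 0]

instance : E.Holds counitEv₂ := .of_steps _
    [.addWire .alg 0 1, .rw copEv.symm [0, 1, 2], .rw copCounitLeft [2, 1]]
    (by decide +kernel)

/-- The point `g` is grouplike. -/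
def grpComul : Equation Wire Op where
  dom := []
  cod := [⟨.alg, 0⟩, ⟨.alg, 1⟩]
  lhs := [.grp 2, .comul 2 0 1]
  rhs := [.grp 1, .grp 0]

/-- The normalization supplies the scalar λ(γ')λ(S(γ'')) = 1. Absorbing `g` by h₁λ(h₂) = gλ(h) at h
= γ', coassociativity produces `g` twice, after which the scalar is removed. The counit of `g` is
found in the same way. -/
instance : E.Holds grpComul := .of_steps _
    [.rw lamLam.symm [3, 4, 5], .rw lamLeft.symm [3, 2, 6], .rw coassoc [3, 0, 1, 6, 2, 7],
     .rw lamLeft [7, 1, 6], .rw lamLeft [3, 0, 7], .rw lamLam [3, 4, 5]]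
    (by decide +kernel)

/-- The counit of `g`. -/
def grpCounit : Equation Wire Op where
  dom := []
  cod := []
  lhs := [.grp 0, .counit 0]
  rhs := []

instance : E.Holds grpCounit := .of_steps _
    [.rw lamLam.symm [1, 2, 3], .rw lamLeft.symm [1, 0, 4], .rw counitLeft [1, 4, 0],
     .unwire .alg 1 4, .rw lamLam [1, 2, 3]]
    (by decide +kernel)

/-- `S(g) = g⁻¹` -/
def antiGrp : Equation Wire Op where
  dom := []
  cod := [⟨.alg, 0⟩]
  lhs := [.grp 1, .anti 1 0]
  rhs := [.grpInv 0]

/-- S(g) = S(g) g g⁻¹ = ε(g) g⁻¹, because `g` is grouplike. -/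
instance : E.Holds antiGrp := .of_steps _
    [.addWire .alg 2 0, .rw mulOne.symm [2, 0, 3], .rw grpMulInv.symm [3, 4, 5],
     .rw mulAssoc.symm [2, 4, 5, 0, 6, 3], .rw grpComul.symm [1, 4, 3],
     .rw antiLeft [3, 6, 1, 4, 2], .rw grpCounit [3], .rw oneMul [5, 0, 6], .unwire .alg 5 0]
    (by decide +kernel)

/-- `S(g⁻¹) = g` -/
def antiGrpInv : Equation Wire Op where
  dom := []
  cod := [⟨.alg, 0⟩]
  lhs := [.grpInv 1, .anti 1 0]
  rhs := [.grp 0]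

instance : E.Holds antiGrpInv := .of_steps _
    [.addWire .alg 2 0, .rw mulOne.symm [2, 0, 3], .rw grpInvMul.symm [3, 4, 5],
     .rw mulAssoc.symm [2, 4, 5, 0, 6, 3], .rw antiGrp.symm [4, 3],
     .rw mulAnti.symm [3, 1, 6, 7, 4, 2], .rw grpMulInv [7, 3, 1], .rw oneAnti [6, 7],
     .rw oneMul [5, 0, 6], .unwire .alg 5 0]
    (by decide +kernel)

/-- The counit of `g⁻¹`. -/
def grpInvCounit : Equation Wire Op where
  dom := []
  cod := []
  lhs := [.grpInv 0, .counit 0]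
  rhs := []

instance : E.Holds grpInvCounit := .of_steps _
    [.rw antiGrp.symm [0, 1], .rw antiCounit [1, 0], .rw grpCounit [1]]
    (by decide +kernel)

/-! ### The inverse antipode -/

/-- The inverse antipode preserves the unit. -/
def oneAntiInv : Equation Wire Op where
  dom := []
  cod := [⟨.alg, 0⟩]
  lhs := [.one 1, .antiInv 1 0]
  rhs := [.one 0]

instance : E.Holds oneAntiInv := .of_steps _
    [.rw oneAnti.symm [1, 2], .rw antiAntiInv [2, 0, 1], .unwire .alg 2 0]
    (by decide +kernel)

/-- The inverse antipode reverses products. -/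
def mulAntiInv : Equation Wire Op where
  dom := [⟨.alg, 0⟩, ⟨.alg, 1⟩]
  cod := [⟨.alg, 2⟩]
  lhs := [.mul 0 1 3, .antiInv 3 2]
  rhs := [.antiInv 0 5, .antiInv 1 7, .mul 7 5 2]

instance : E.Holds mulAntiInv := .of_steps _
    [.addWire .alg 0 4, .rw antiInvAnti.symm [0, 4, 5], .addWire .alg 1 6,
     .rw antiInvAnti.symm [1, 6, 7], .rw mulAnti.symm [7, 5, 3, 8, 6, 4],
     .rw antiAntiInv [8, 2, 3], .unwire .alg 8 2]
    (by decide +kernel)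

/-- The inverse antipode reverses coproducts. -/
def antiInvComul : Equation Wire Op where
  dom := [⟨.alg, 0⟩]
  cod := [⟨.alg, 1⟩, ⟨.alg, 2⟩]
  lhs := [.antiInv 0 3, .comul 3 1 2]
  rhs := [.comul 0 7 5, .antiInv 5 1, .antiInv 7 2]

instance : E.Holds antiInvComul := .of_steps _
    [.addWire .alg 4 1, .rw antiAntiInv.symm [4, 1, 5], .addWire .alg 6 2,
     .rw antiAntiInv.symm [6, 2, 7], .rw antiComul.symm [3, 7, 5, 8, 4, 6],
     .rw antiInvAnti [0, 8, 3], .unwire .alg 0 8]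
    (by decide +kernel)

/-- `S⁻¹(x₂) x₁ = ε(x)` -/
def antiInvLeft : Equation Wire Op where
  dom := [⟨.alg, 0⟩]
  cod := [⟨.alg, 1⟩]
  lhs := [.comul 0 2 3, .antiInv 3 4, .mul 4 2 1]
  rhs := [.counit 0, .one 1]

/-- Applying S turns the left side into S(x₁)x₂; then S is undone. -/
instance : E.Holds antiInvLeft := .of_steps _
    [.addWire .alg 5 1, .rw antiAntiInv.symm [5, 1, 6], .rw mulAnti [4, 2, 6, 5, 7, 8],
     .rw antiInvAnti [3, 7, 4], .unwire .alg 3 7, .rw antiLeft [0, 6, 2, 3, 8],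
     .rw oneAntiInv [1, 6]]
    (by decide +kernel)

/-- `x₂ S⁻¹(x₁) = ε(x)` -/
def antiInvRight : Equation Wire Op where
  dom := [⟨.alg, 0⟩]
  cod := [⟨.alg, 1⟩]
  lhs := [.comul 0 2 3, .antiInv 2 4, .mul 3 4 1]
  rhs := [.counit 0, .one 1]

instance : E.Holds antiInvRight := .of_steps _
    [.addWire .alg 5 1, .rw antiAntiInv.symm [5, 1, 6], .rw mulAnti [3, 4, 6, 5, 7, 8],
     .rw antiInvAnti [2, 8, 4], .unwire .alg 2 8, .rw antiRight [0, 6, 2, 3, 7],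
     .rw oneAntiInv [1, 6]]
    (by decide +kernel)

/-! ### Inverses and symmetry of the copairing -/

/-- `γ'c' ⊗ S(γ'')c'' = 1` -/
def copInvLeft : Equation Wire Op where
  dom := []
  cod := [⟨.alg, 0⟩, ⟨.alg, 1⟩]
  lhs := [.cop 2 3, .cop 4 5, .anti 3 6, .mul 2 4 0, .mul 6 5 1]
  rhs := [.one 1, .one 0]

/-- A coproduct axiom of γ merges the two copies into one with a coproduct on a leg. An antipode law
turns that leg into ε, and the counit axiom ends the proof. The five identities that follow are the
variants with the other leg, order or antipode. -/
instance : E.Holds copInvLeft := .of_steps _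
    [.rw copComulRight.symm [0, 3, 5, 7, 2, 4], .rw antiLeft [7, 1, 3, 5, 6],
     .rw copCounitRight [0, 7]]
    (by decide +kernel)

/-- `γ'c' ⊗ γ''S(c'') = 1` -/
def copInvRight : Equation Wire Op where
  dom := []
  cod := [⟨.alg, 0⟩, ⟨.alg, 1⟩]
  lhs := [.cop 2 3, .cop 4 5, .anti 5 6, .mul 2 4 0, .mul 3 6 1]
  rhs := [.one 1, .one 0]

instance : E.Holds copInvRight := .of_steps _
    [.rw copComulRight.symm [0, 3, 5, 7, 2, 4], .rw antiRight [7, 1, 3, 5, 6],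
     .rw copCounitRight [0, 7]]
    (by decide +kernel)

/-- `S(γ')c' ⊗ γ''c'' = 1` -/
def copInvLeft₂ : Equation Wire Op where
  dom := []
  cod := [⟨.alg, 0⟩, ⟨.alg, 1⟩]
  lhs := [.cop 2 3, .cop 4 5, .anti 2 6, .mul 6 4 0, .mul 3 5 1]
  rhs := [.one 0, .one 1]

instance : E.Holds copInvLeft₂ := .of_steps _
    [.rw copComulLeft.symm [2, 4, 1, 7, 3, 5], .rw antiLeft [7, 0, 2, 4, 6],
     .rw copCounitLeft [1, 7]]
    (by decide +kernel)

/-- `γ'S(c') ⊗ γ''c'' = 1` -/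
def copInvRight₂ : Equation Wire Op where
  dom := []
  cod := [⟨.alg, 0⟩, ⟨.alg, 1⟩]
  lhs := [.cop 2 3, .cop 4 5, .anti 4 6, .mul 2 6 0, .mul 3 5 1]
  rhs := [.one 0, .one 1]

instance : E.Holds copInvRight₂ := .of_steps _
    [.rw copComulLeft.symm [2, 4, 1, 7, 3, 5], .rw antiRight [7, 0, 2, 4, 6],
     .rw copCounitLeft [1, 7]]
    (by decide +kernel)

/-- `S⁻¹(c')γ' ⊗ γ''c'' = 1` -/
def copInvLeft₃ : Equation Wire Op where
  dom := []
  cod := [⟨.alg, 0⟩, ⟨.alg, 1⟩]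
  lhs := [.cop 2 3, .cop 4 5, .antiInv 4 6, .mul 6 2 0, .mul 3 5 1]
  rhs := [.one 0, .one 1]

instance : E.Holds copInvLeft₃ := .of_steps _
    [.rw copComulLeft.symm [2, 4, 1, 7, 3, 5], .rw antiInvLeft [7, 0, 2, 4, 6],
     .rw copCounitLeft [1, 7]]
    (by decide +kernel)

/-- `c'S⁻¹(γ') ⊗ γ''c'' = 1` -/
def copInvRight₃ : Equation Wire Op where
  dom := []
  cod := [⟨.alg, 0⟩, ⟨.alg, 1⟩]
  lhs := [.cop 2 3, .cop 4 5, .antiInv 2 6, .mul 4 6 0, .mul 3 5 1]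
  rhs := [.one 0, .one 1]

instance : E.Holds copInvRight₃ := .of_steps _
    [.rw copComulLeft.symm [2, 4, 1, 7, 3, 5], .rw antiInvRight [7, 0, 2, 4, 6],
     .rw copCounitLeft [1, 7]]
    (by decide +kernel)

/-- `(S ⊗ id) γ = (id ⊗ S) γ` -/
def copAnti : Equation Wire Op where
  dom := []
  cod := [⟨.alg, 0⟩, ⟨.alg, 1⟩]
  lhs := [.cop 2 1, .anti 2 0]
  rhs := [.cop 0 10, .anti 10 1]

/-- Both sides invert γ in the algebra H ⊗ H, the left one on the left and the right one on the
right. -/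
instance : E.Holds copAnti := .of_steps _
    [.addWire .alg 3 0, .rw mulOne.symm [3, 0, 4], .addWire .alg 5 1, .rw mulOne.symm [5, 1, 6],
     .rw copInvRight.symm [4, 6, 7, 8, 9, 10, 11], .rw mulAssoc.symm [3, 7, 9, 0, 12, 4],
     .rw mulAssoc.symm [5, 8, 11, 1, 4, 6], .rw copInvLeft₂ [12, 4, 2, 5, 7, 8, 3],
     .rw oneMul [9, 0, 12], .unwire .alg 9 0, .rw oneMul [11, 1, 4], .unwire .alg 11 1]
    (by decide +kernel)

/-- `γ'' ⊗ γ' = γ' ⊗ g⁻¹S²(γ'')g` -/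
def copBraid : Equation Wire Op where
  dom := []
  cod := [⟨.alg, 0⟩, ⟨.alg, 1⟩]
  lhs := [.cop 1 0]
  rhs := [.cop 0 2, .anti 2 10, .anti 10 5, .grpInv 7, .mul 7 5 4, .grp 3, .mul 4 3 1]

/-- The symmetry hypothesis has S² outside the conjugation; S² passes inside because S²(g) = g and
S²(g⁻¹) = g⁻¹. -/
instance : E.Holds copBraid := .of_steps _
    [.rw copSymm [0, 1, 2, 3, 4, 5, 6, 7], .rw mulAnti [4, 5, 7, 6, 8, 9],
     .rw mulAnti [3, 2, 8, 4, 6, 10], .rw antiGrp [9, 5], .rw antiGrpInv [6, 3],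
     .rw mulAnti [9, 8, 1, 7, 3, 4], .rw mulAnti [10, 6, 4, 8, 5, 7], .rw antiGrp [7, 6],
     .rw antiGrpInv [3, 9]]
    (by decide +kernel)

/-! ### The integral dual to λ -/

/-- `R = λ(γ')γ''` is a right integral. -/
def integralMul : Equation Wire Op where
  dom := [⟨.alg, 0⟩]
  cod := [⟨.alg, 1⟩]
  lhs := [.cop 2 3, .lam 2, .mul 3 0 1]
  rhs := [.cop 6 1, .lam 6, .counit 0]

/-- With x = ev(x, c')c'', the product γ''c'' is merged by (Δ ⊗ id)γ. The cointegral property then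
replaces c' by 1, and ev(x, 1) = ε(x). -/
instance : E.Holds integralMul := .of_steps _
    [.addWire .alg 0 4, .rw evCop.symm [0, 4, 5], .rw copComulLeft.symm [2, 5, 1, 6, 3, 4],
     .rw lamRight [6, 5, 2], .rw counitEv.symm [0, 0, 5]]
    (by decide +kernel)

/-- `R₁ ⊗ R₂x = R₁S⁻¹(x) ⊗ R₂` -/
def integralComulMul : Equation Wire Op where
  dom := [⟨.alg, 0⟩]
  cod := [⟨.alg, 1⟩, ⟨.alg, 2⟩]
  lhs := [.cop 3 4, .lam 3, .comul 4 1 5, .mul 5 0 2]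
  rhs := [.cop 5 7, .lam 5, .comul 7 13 2, .antiInv 0 12, .mul 13 12 1]

/-- Insert x₂S⁻¹(x₁) = ε(x) behind R₁ to get R₁x₂S⁻¹(x₁) ⊗ R₂x₃ = Δ(R x₂)(S⁻¹(x₁) ⊗ 1), and use R x₂
= ε(x₂)R. -/
instance : E.Holds integralComulMul := .of_steps _
    [.addWire .alg 0 6, .rw counitLeft.symm [0, 6, 7], .addWire .alg 8 1,
     .rw mulOne.symm [8, 1, 9], .rw antiInvRight.symm [7, 9, 10, 11, 12],
     .rw mulAssoc.symm [8, 11, 12, 1, 13, 9], .rw coassoc [0, 10, 11, 6, 7, 9],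
     .rw mulComul.symm [4, 9, 13, 2, 7, 8, 5, 11, 6], .rw integralMul [9, 7, 3, 4, 0, 0, 5],
     .rw counitRight [0, 10, 9], .unwire .alg 0 10]
    (by decide +kernel)

/-- `R₁x ⊗ R₂ = R₁ ⊗ R₂S(x)` -/
def integralComulMul₂ : Equation Wire Op where
  dom := [⟨.alg, 0⟩]
  cod := [⟨.alg, 1⟩, ⟨.alg, 2⟩]
  lhs := [.cop 3 4, .lam 3, .comul 4 5 2, .mul 5 0 1]
  rhs := [.anti 0 7, .cop 8 9, .lam 8, .comul 9 1 3, .mul 3 7 2]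

instance : E.Holds integralComulMul₂ := .of_steps _
    [.addWire .alg 0 6, .rw antiAntiInv.symm [0, 6, 7],
     .rw integralComulMul.symm [7, 1, 2, 8, 9, 3, 0, 4, 0, 0, 0, 0, 6, 5]]
    (by decide +kernel)

/-- `λ(R₁x)R₂ = λ(R)S(x)` -/
def lamIntegralLeft : Equation Wire Op where
  dom := [⟨.alg, 0⟩]
  cod := [⟨.alg, 1⟩]
  lhs := [.cop 2 3, .lam 2, .comul 3 4 1, .mul 4 0 5, .lam 5]
  rhs := [.anti 0 1, .cop 7 8, .lam 7, .lam 8]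

instance : E.Holds lamIntegralLeft := .of_steps _
    [.rw integralComulMul₂ [0, 5, 1, 2, 3, 4, 0, 6, 7, 8], .rw lamRight [8, 2, 5],
     .rw oneMul [6, 1, 2], .unwire .alg 6 1]
    (by decide +kernel)

/-- `R₁λ(R₂x) = λ(R)gS⁻¹(x)` -/
def lamIntegralRight : Equation Wire Op where
  dom := [⟨.alg, 0⟩]
  cod := [⟨.alg, 1⟩]
  lhs := [.cop 2 3, .lam 2, .comul 3 1 4, .mul 4 0 5, .lam 5]
  rhs := [.cop 4 6, .lam 4, .antiInv 0 7, .lam 6, .grp 8, .mul 8 7 1]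

instance : E.Holds lamIntegralRight := .of_steps _
    [.rw integralComulMul [0, 1, 5, 2, 3, 4, 0, 6, 0, 0, 0, 0, 7, 8], .rw lamLeft [6, 8, 5]]
    (by decide +kernel)

/-- `h₁λ(S(h₂)) = λ(S(h))` -/
def lamAnti : Equation Wire Op where
  dom := [⟨.alg, 0⟩]
  cod := [⟨.alg, 1⟩]
  lhs := [.comul 0 1 2, .anti 2 3, .lam 3]
  rhs := [.anti 0 6, .lam 6, .one 1]

/-- S reverses the coproduct, so the right cointegral λ becomes the left cointegral λ ∘ S. -/
instance : E.Holds lamAnti := .of_steps _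
    [.addWire .alg 4 1, .rw antiAntiInv.symm [4, 1, 5], .rw antiComul.symm [0, 3, 5, 6, 4, 2],
     .rw lamRight [6, 5, 3], .rw oneAntiInv [1, 5]]
    (by decide +kernel)

/-- `λ(xS(R₂))S²(R₁) = x` -/
def integralDual : Equation Wire Op where
  dom := [⟨.alg, 0⟩]
  cod := [⟨.alg, 1⟩]
  lhs := [.cop 2 3, .lam 2, .comul 3 4 5, .anti 5 6, .mul 0 6 7, .lam 7, .anti 4 8, .anti 8 1]
  rhs := [.wire .alg 0 1]

/-- Write x S(R₂) = S(R₂ S⁻¹(x)) and move S⁻¹(x) to R₁, where it becomes S⁻²(x). The left cointegral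
λ ∘ S replaces R₁ by 1, leaving λ(S(R)) x, and λ(S(R)) = 1 is the normalization. -/
instance : E.Holds integralDual := .of_steps _
    [.addWire .alg 0 9, .rw antiInvAnti.symm [0, 9, 10], .rw mulAnti.symm [5, 10, 7, 11, 6, 9],
     .rw integralComulMul [10, 4, 11, 2, 3, 5, 0, 6, 0, 0, 0, 0, 9, 12],
     .rw mulAnti [12, 9, 8, 4, 2, 3], .rw mulAnti [3, 2, 1, 8, 4, 13],
     .rw lamAnti [6, 12, 11, 7, 0, 0, 8], .rw oneAnti [2, 12], .rw oneAnti [13, 2],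
     .rw oneMul [4, 1, 13], .unwire .alg 4 1, .rw antiInvAnti [10, 3, 9], .unwire .alg 10 3,
     .rw antiInvAnti [0, 1, 10], .rw lamLam [5, 6, 8]]
    (by decide +kernel)

/-- `g⁻¹S²(R₁)λ(R₂x) = λ(R)S(x)` -/
def lamIntegralRight₂ : Equation Wire Op where
  dom := [⟨.alg, 0⟩]
  cod := [⟨.alg, 1⟩]
  lhs := [.cop 2 3, .lam 2, .comul 3 4 5, .mul 5 0 6, .lam 6, .anti 4 7, .anti 7 8, .grpInv 9,
          .mul 9 8 1]
  rhs := [.cop 5 10, .lam 5, .lam 10, .anti 0 1]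

instance : E.Holds lamIntegralRight₂ := .of_steps _
    [.rw lamIntegralRight [0, 4, 2, 3, 5, 6, 10, 11, 12], .rw mulAnti [12, 11, 7, 4, 2, 3],
     .rw mulAnti [3, 2, 8, 7, 4, 6], .rw antiGrp [2, 12], .rw antiGrpInv [6, 2],
     .rw mulAssoc.symm [9, 6, 4, 1, 2, 8], .rw grpInvMul [2, 9, 6], .rw oneMul [4, 1, 2],
     .unwire .alg 4 1, .rw antiInvAnti [0, 3, 11], .unwire .alg 0 3]
    (by decide +kernel)

/-- `R₂ ⊗ R₁ = g⁻¹S²(R₁) ⊗ R₂` -/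
def integralBraid : Equation Wire Op where
  dom := []
  cod := [⟨.alg, 0⟩, ⟨.alg, 1⟩]
  lhs := [.cop 2 3, .lam 2, .comul 3 1 0]
  rhs := [.cop 2 3, .lam 2, .comul 3 4 1, .anti 4 14, .anti 14 15, .grpInv 16, .mul 16 15 0]

/-- The factor R₁ is expanded by `integralDual` with a second copy r of R. This exposes λ(R₁y)R₂
with y = S(r₂), which equals g⁻¹S²(R₁)λ(R₂y), both being λ(R)S(y). `integralDual` then contracts the
copy again. -/
instance : E.Holds integralBraid := .of_steps _
    [.addWire .alg 4 1, .rw integralDual.symm [4, 1, 5, 6, 7, 8, 9, 10, 11],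
     .rw lamIntegralLeft [9, 0, 2, 3, 4, 10, 0, 12, 13],
     .rw lamIntegralRight₂.symm [9, 0, 2, 3, 4, 12, 10, 14, 15, 16, 13],
     .rw integralDual [12, 1, 5, 6, 7, 8, 9, 10, 11], .unwire .alg 12 1]
    (by decide +kernel)

/-- `λ(yγ')γ'' = g⁻¹S²(γ'')λ(γ'y)` -/
def lamCop : Equation Wire Op where
  dom := [⟨.alg, 0⟩]
  cod := [⟨.alg, 1⟩]
  lhs := [.cop 2 1, .mul 0 2 3, .lam 3]
  rhs := [.grpInv 8, .cop 9 2, .anti 2 4, .anti 4 7, .mul 8 7 1, .mul 9 0 3, .lam 3]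

/-- This is `integralBraid` with one leg paired with y: expanding y = c' ev(c'', y) turns λ(yγ')γ''
into ev(R₁, y)R₂. -/
instance : E.Holds lamCop := .of_steps _
    [.addWire .alg 0 4, .rw copEv.symm [0, 4, 5], .rw copComulRight.symm [3, 5, 1, 6, 4, 2],
     .rw integralBraid [1, 5, 3, 6, 2, 0, 0, 0, 0, 0, 0, 0, 0, 0, 4, 7, 8],
     .rw copComulRight [3, 2, 5, 6, 9, 10], .rw copEv [0, 10, 5], .unwire .alg 0 10]
    (by decide +kernel)

/-- `S(γ')λ(γ''y) = g⁻¹S(γ'')λ(yγ')` -/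
def antiLamCop : Equation Wire Op where
  dom := [⟨.alg, 0⟩]
  cod := [⟨.alg, 1⟩]
  lhs := [.cop 2 3, .anti 2 1, .mul 3 0 4, .lam 4]
  rhs := [.grpInv 12, .cop 5 7, .mul 0 5 4, .lam 4, .anti 7 11, .mul 12 11 1]

/-- Exchange the legs of γ by `copBraid`; applying S to g⁻¹S²(γ'')g leaves a factor g⁻¹ in front and
the right side of `lamCop` under S. -/
instance : E.Holds antiLamCop := .of_steps _
    [.rw copBraid [3, 2, 5, 6, 7, 8, 0, 9, 0, 0, 10], .rw mulAnti [7, 6, 1, 2, 11, 12],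
     .rw antiGrp [12, 6], .rw lamCop.symm [0, 7, 5, 4, 10, 0, 0, 8, 9, 3]]
    (by decide +kernel)

/-! ### The twisted cointegral and the square of the Fourier transform -/

/-- `λ' = λ(gS(-))` is a right cointegral: `λ'(x₁)x₂ = λ'(x)` -/
def lamTwistRight : Equation Wire Op where
  dom := [⟨.alg, 0⟩]
  cod := [⟨.alg, 1⟩]
  lhs := [.comul 0 2 1, .anti 2 23, .grp 24, .mul 24 23 25, .lam 25]
  rhs := [.anti 0 6, .grp 2, .mul 2 6 3, .lam 3, .one 1]

/-- As `g` is grouplike, gS(x₂) ⊗ gS(x₁) = Δ(gS(x)). Hence S(x₂)λ(gS(x₁)) = g⁻¹gλ(gS(x)), and S⁻¹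
gives the claim. -/
instance : E.Holds lamTwistRight := .of_steps _
    [.addWire .alg 3 1, .rw antiAntiInv.symm [3, 1, 4], .addWire .alg 4 5,
     .rw oneMul.symm [4, 5, 6], .rw grpInvMul.symm [6, 7, 8], .rw mulAssoc [7, 8, 4, 5, 6, 9],
     .rw antiComul.symm [0, 4, 23, 6, 2, 3], .rw grpComul.symm [8, 24, 2],
     .rw mulComul.symm [2, 6, 9, 25, 3, 8, 24, 4, 23], .rw lamLeft [3, 9, 25],
     .rw grpInvMul [5, 7, 9], .rw oneAntiInv [1, 5]]
    (by decide +kernel)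

/-- `R' = λ'(γ')γ''` is a right integral. -/
def twistIntegralMul : Equation Wire Op where
  dom := [⟨.alg, 0⟩]
  cod := [⟨.alg, 1⟩]
  lhs := [.cop 2 3, .anti 2 23, .grp 24, .mul 24 23 25, .lam 25, .mul 3 0 1]
  rhs := [.cop 6 1, .anti 6 4, .grp 2, .mul 2 4 3, .lam 3, .counit 0]

instance : E.Holds twistIntegralMul := .of_steps _
    [.addWire .alg 0 4, .rw evCop.symm [0, 4, 5], .rw copComulLeft.symm [2, 5, 1, 6, 3, 4], .rw
     lamTwistRight [6, 5, 2, 3, 0, 0, 4, 0, 0, 0, 0, 0, 0, 0, 0, 0, 0, 0, 0, 0, 0, 0, 0, 23, 24,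
     25], .rw counitEv.symm [0, 0, 5]]
    (by decide +kernel)

/-- `R'₁ ⊗ R'₂x = R'₁S⁻¹(x) ⊗ R'₂` -/
def twistIntegralComulMul : Equation Wire Op where
  dom := [⟨.alg, 0⟩]
  cod := [⟨.alg, 1⟩, ⟨.alg, 2⟩]
  lhs := [.cop 3 4, .anti 3 23, .grp 24, .mul 24 23 25, .lam 25, .comul 4 1 5, .mul 5 0 2]
  rhs := [.cop 6 7, .anti 6 5, .grp 3, .mul 3 5 4, .lam 4, .comul 7 13 2, .antiInv 0 12,
          .mul 13 12 1]

/-- The argument for R used only that R is a right integral, and applies verbatim. -/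
instance : E.Holds twistIntegralComulMul := .of_steps _
    [.addWire .alg 0 6, .rw counitLeft.symm [0, 6, 7], .addWire .alg 8 1,
     .rw mulOne.symm [8, 1, 9], .rw antiInvRight.symm [7, 9, 10, 11, 12],
     .rw mulAssoc.symm [8, 11, 12, 1, 13, 9], .rw coassoc [0, 10, 11, 6, 7, 9],
     .rw mulComul.symm [4, 9, 13, 2, 7, 8, 5, 11, 6], .rw twistIntegralMul [9, 7, 3, 4, 5, 0, 6,
     0, 0, 0, 0, 0, 0, 0, 0, 0, 0, 0, 0, 0, 0, 0, 0, 23, 24, 25], .rw counitRight [0, 10, 9],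
     .unwire .alg 0 10]
    (by decide +kernel)

/-- `R'₁λ(R'₂x) = λ(R')gS⁻¹(x)` -/
def lamTwistIntegral : Equation Wire Op where
  dom := [⟨.alg, 0⟩]
  cod := [⟨.alg, 1⟩]
  lhs := [.cop 2 3, .anti 2 4, .grp 5, .mul 5 4 6, .lam 6, .comul 3 1 7, .mul 7 0 8, .lam 8]
  rhs := [.cop 9 10, .anti 9 7, .grp 2, .mul 2 7 3, .lam 3, .antiInv 0 11, .lam 10, .grp 12,
          .mul 12 11 1]

instance : E.Holds lamTwistIntegral := .of_steps _
    [.rw twistIntegralComulMul [0, 1, 8, 2, 3, 7, 9, 10, 0, 0, 0, 0, 11, 12, 0, 0, 0, 0, 0, 0, 0,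
     0, 0, 4, 5, 6], .rw lamLeft [10, 12, 8]]
    (by decide +kernel)

/-- `γ'λ(γ'')` is a right integral. -/
def integralMul₂ : Equation Wire Op where
  dom := [⟨.alg, 0⟩]
  cod := [⟨.alg, 1⟩]
  lhs := [.cop 2 3, .lam 3, .mul 2 0 1]
  rhs := [.cop 1 6, .lam 6, .counit 0]

instance : E.Holds integralMul₂ := .of_steps _
    [.addWire .alg 0 4, .rw copEv.symm [0, 4, 5], .rw copComulRight.symm [1, 3, 5, 6, 2, 4],
     .rw lamRight [6, 5, 3], .rw counitEv₂.symm [0, 0, 5]]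
    (by decide +kernel)

/-- `λ'(γ')λ(γ'') = 1` -/
def lamTwistLam : Equation Wire Op where
  dom := []
  cod := []
  lhs := [.cop 0 1, .anti 0 2, .grp 3, .mul 3 2 4, .lam 4, .lam 1]
  rhs := []

/-- As g = S(g⁻¹), the argument of λ is S(γ'g⁻¹). The integral γ'λ(γ'') absorbs g⁻¹, and moving S to
the other leg gives the normalization. -/
instance : E.Holds lamTwistLam := .of_steps _
    [.rw antiGrpInv.symm [3, 5], .rw mulAnti.symm [0, 5, 4, 6, 2, 3],
     .rw integralMul₂ [5, 6, 0, 1, 0, 0, 2], .rw grpInvCounit [5],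
     .rw copAnti [4, 2, 6, 0, 0, 0, 0, 0, 0, 0, 0], .rw lamLam [4, 0, 2]]
    (by decide +kernel)

/-- The square of the Fourier transform: `F(gF(k)) = S⁻¹(k)`. -/
def fourierGrpFourier : Equation Wire Op where
  dom := [⟨.alg, 0⟩]
  cod := [⟨.alg, 1⟩]
  lhs := [.cop 2 3, .mul 3 0 4, .lam 4, .anti 2 5, .grp 6, .mul 6 5 7, .cop 8 9, .mul 9 7 10,
          .lam 10, .anti 8 1]
  rhs := [.antiInv 0 1]

/-- `antiLamCop` with y = gF(k) moves the outer γ' behind S(γ') of the inner transform. The antipode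
on the other leg is shifted so that both first legs lie under one S and the two copies of γ merge.
What remains is g⁻¹R'₁λ(R'₂k) = λ(R')S⁻¹(k), with λ(R') = 1. -/
instance : E.Holds fourierGrpFourier := .of_steps _
    [.rw antiLamCop [7, 1, 8, 9, 10, 11, 0, 12, 0, 0, 0, 13, 14],
     .rw mulAssoc [6, 5, 11, 10, 7, 8], .rw copAnti.symm [11, 13, 7, 0, 0, 0, 0, 0, 0, 0, 12],
     .rw mulAnti.symm [7, 2, 8, 9, 11, 5], .rw copComulRight.symm [9, 13, 3, 5, 7, 2],
     .rw lamTwistIntegral [0, 13, 9, 5, 8, 6, 10, 3, 4, 2, 7, 11, 12],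
     .rw lamTwistLam [2, 7, 3, 9, 5], .rw mulAssoc.symm [14, 12, 11, 1, 2, 13],
     .rw grpInvMul [2, 14, 12], .rw oneMul [11, 1, 2], .unwire .alg 11 1]
    (by decide +kernel)

/-! ### Exchange identities behind the pentagons -/

/-- `λ(xh₁)h₂ = λ(x₁h)S⁻¹(x₂)` -/
def lamMulComul : Equation Wire Op where
  dom := [⟨.alg, 0⟩, ⟨.alg, 1⟩]
  cod := [⟨.alg, 2⟩]
  lhs := [.comul 1 3 2, .mul 0 3 4, .lam 4]
  rhs := [.comul 0 8 10, .antiInv 10 2, .mul 8 1 6, .lam 6]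

/-- Inserting S⁻¹(x₃)x₂ in front of h₂ produces Δ(x₁h), to which the right cointegral property
applies. -/
instance : E.Holds lamMulComul := .of_steps _
    [.addWire .alg 0 5, .rw counitRight.symm [0, 5, 6], .addWire .alg 7 2,
     .rw oneMul.symm [7, 2, 8], .rw antiInvLeft.symm [6, 8, 9, 10, 11],
     .rw mulAssoc [11, 9, 7, 2, 8, 12], .rw coassoc.symm [0, 5, 9, 10, 8, 6],
     .rw mulComul.symm [8, 1, 4, 12, 6, 5, 9, 3, 7], .rw lamRight [6, 12, 4],
     .rw mulOne [11, 2, 12], .unwire .alg 11 2]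
    (by decide +kernel)

/-- `F(h₁) ⊗ h₂ = γ'F(h) ⊗ γ''` -/
def fourierComul : Equation Wire Op where
  dom := [⟨.alg, 0⟩]
  cod := [⟨.alg, 1⟩, ⟨.alg, 2⟩]
  lhs := [.comul 0 3 2, .cop 4 5, .mul 5 3 6, .lam 6, .anti 4 1]
  rhs := [.cop 3 8, .mul 8 0 7, .lam 7, .anti 3 5, .cop 10 2, .mul 10 5 1]

/-- `lamMulComul` moves the coproduct from h to γ'', which splits γ in two. The extra copy enters as
S(c') ⊗ S⁻¹(c'') = c' ⊗ c''. -/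
instance : E.Holds fourierComul := .of_steps _
    [.rw lamMulComul [5, 0, 2, 3, 6, 0, 7, 0, 8, 0, 9], .rw copComulRight [4, 8, 9, 5, 3, 6],
     .rw mulAnti [3, 6, 1, 4, 5, 10], .rw copAnti [10, 9, 6, 0, 0, 0, 0, 0, 0, 0, 4],
     .rw antiAntiInv [4, 2, 9], .unwire .alg 4 2]
    (by decide +kernel)

/-- `F(γ''h) ⊗ γ' = F(h)₂ ⊗ S⁻¹(F(h)₁)` -/
def fourierCopMul : Equation Wire Op where
  dom := [⟨.alg, 0⟩]
  cod := [⟨.alg, 1⟩, ⟨.alg, 2⟩]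
  lhs := [.cop 2 3, .mul 3 0 4, .cop 10 11, .mul 11 4 12, .lam 12, .anti 10 1]
  rhs := [.cop 4 5, .mul 5 0 12, .lam 12, .anti 4 7, .comul 7 6 1, .antiInv 6 2]

/-- The two copies of γ merge through a coproduct of γ', and S reverses that coproduct. -/
instance : E.Holds fourierCopMul := .of_steps _
    [.rw mulAssoc.symm [11, 3, 0, 12, 5, 4], .rw copComulLeft.symm [10, 2, 5, 4, 11, 3],
     .addWire .alg 3 2, .rw antiAntiInv.symm [3, 2, 6], .rw antiComul.symm [4, 6, 1, 7, 10, 3]]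
    (by decide +kernel)

/-- `g⁻¹x₁λ(x₂h) = S⁻¹(h₁)λ(xh₂)` -/
def lamMulComul₂ : Equation Wire Op where
  dom := [⟨.alg, 0⟩, ⟨.alg, 1⟩]
  cod := [⟨.alg, 2⟩]
  lhs := [.comul 0 6 7, .mul 7 1 8, .lam 8, .grpInv 9, .mul 9 6 2]
  rhs := [.comul 1 11 10, .antiInv 11 2, .mul 0 10 4, .lam 4]

/-- The mirror image of `lamMulComul`: h₂S⁻¹(h₁) is inserted behind x₁, and the left-hand
contraction of λ produces the factor `g` that g⁻¹ cancels. -/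
instance : E.Holds lamMulComul₂ := .of_steps _
    [.addWire .alg 1 3, .rw counitLeft.symm [1, 3, 4], .addWire .alg 6 5,
     .rw mulOne.symm [6, 5, 10], .rw antiInvRight.symm [4, 10, 11, 12, 13],
     .rw mulAssoc.symm [6, 12, 13, 5, 14, 10], .rw coassoc [1, 11, 12, 3, 4, 10],
     .rw mulComul.symm [0, 10, 14, 8, 4, 6, 7, 12, 3], .rw lamLeft [4, 14, 8],
     .rw mulAssoc.symm [9, 14, 13, 2, 3, 5], .rw grpInvMul [3, 9, 14], .rw oneMul [13, 2, 3],
     .unwire .alg 13 2]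
    (by decide +kernel)

/-- `S(c')γ'' ⊗ gγ'g⁻¹c'' = 1` -/
def copConj : Equation Wire Op where
  dom := []
  cod := [⟨.alg, 0⟩, ⟨.alg, 1⟩]
  lhs := [.cop 2 3, .anti 2 4, .cop 5 6, .mul 4 6 0, .grp 7, .mul 7 5 8, .grpInv 9, .mul 8 9 10,
          .mul 10 3 1]
  rhs := [.one 1, .one 0]

/-- By `copBraid`, γ'' ⊗ gγ'g⁻¹ = d' ⊗ S²(d'') for a copy d of γ. Moving S² to the first leg leaves
S(S(d')c') ⊗ d''c''. -/
instance : E.Holds copConj := .of_steps _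
    [.rw copBraid [6, 5, 11, 12, 13, 14, 0, 15, 0, 0, 16],
     .rw mulAssoc.symm [7, 13, 12, 8, 17, 5], .rw mulAssoc.symm [7, 15, 14, 17, 5, 13],
     .rw grpMulInv [5, 7, 15], .rw oneMul [14, 17, 5], .unwire .alg 14 17,
     .rw mulAssoc [14, 12, 9, 10, 8, 5], .rw grpMulInv [5, 12, 9], .rw mulOne [14, 10, 5],
     .unwire .alg 14 10, .rw copAnti.symm [6, 16, 5, 0, 0, 0, 0, 0, 0, 0, 11],
     .rw copAnti.symm [5, 14, 7, 0, 0, 0, 0, 0, 0, 0, 16], .rw mulAnti.symm [5, 2, 0, 8, 6, 4],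
     .rw copInvLeft₂ [8, 1, 7, 14, 2, 3, 5], .rw oneAnti [0, 8]]
    (by decide +kernel)

/-- `γ''c' ⊗ g⁻¹S(c'')gγ' = 1` -/
def copConj₂ : Equation Wire Op where
  dom := []
  cod := [⟨.alg, 0⟩, ⟨.alg, 1⟩]
  lhs := [.cop 2 3, .cop 4 5, .mul 5 2 0, .anti 3 6, .grpInv 7, .mul 7 6 8, .grp 9, .mul 9 4 10,
          .mul 8 10 1]
  rhs := [.one 0, .one 1]

/-- By `copBraid`, γ'' ⊗ gγ' = d' ⊗ S²(d'')g. Hence the second factor is g⁻¹S(S(d'')c'')g, and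
`copInvLeft` applies. -/
instance : E.Holds copConj₂ := .of_steps _
    [.rw copBraid [5, 4, 11, 12, 13, 14, 0, 15, 0, 0, 16],
     .rw mulAssoc.symm [9, 13, 12, 10, 17, 4], .rw mulAssoc.symm [9, 15, 14, 17, 4, 13],
     .rw grpMulInv [4, 9, 15], .rw oneMul [14, 17, 4], .unwire .alg 14 17,
     .rw mulAssoc [7, 6, 10, 1, 8, 4], .rw mulAssoc.symm [6, 14, 12, 4, 8, 10],
     .rw mulAnti.symm [16, 3, 8, 9, 14, 6], .rw copInvLeft [0, 9, 5, 11, 2, 3, 16],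
     .rw oneAnti [8, 9], .rw oneMul [12, 4, 8], .unwire .alg 12 4, .rw grpInvMul [1, 7, 12]]
    (by decide +kernel)

/-- `λ(c''yγ'')S(c')gγ' = λ(y)` -/
def lamCopCop : Equation Wire Op where
  dom := [⟨.alg, 0⟩]
  cod := [⟨.alg, 1⟩]
  lhs := [.cop 2 3, .cop 4 5, .mul 3 0 6, .mul 6 5 7, .lam 7, .anti 2 8, .grp 9, .mul 9 4 10,
          .mul 8 10 1]
  rhs := [.one 1, .lam 0]

/-- `antiLamCop` brings γ'' and c' together under λ; then `copConj₂` removes both copies. -/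
instance : E.Holds lamCopCop := .of_steps _
    [.rw mulAssoc [3, 0, 5, 7, 6, 11], .rw antiLamCop [11, 8, 2, 3, 7, 6, 0, 12, 0, 0, 0, 13, 14],
     .rw mulAssoc [0, 5, 6, 7, 11, 2], .rw copConj₂ [2, 1, 6, 12, 4, 5, 13, 14, 8, 9, 10],
     .rw mulOne [0, 7, 2], .unwire .alg 0 7]
    (by decide +kernel)

/-- `c'S⁻¹(γ'') ⊗ c''gγ' = 1 ⊗ g` -/
def copConj₃ : Equation Wire Op where
  dom := []
  cod := [⟨.alg, 0⟩, ⟨.alg, 1⟩]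
  lhs := [.cop 2 3, .cop 4 5, .antiInv 5 6, .mul 2 6 0, .grp 7, .mul 7 4 8, .mul 3 8 1]
  rhs := [.grp 1, .one 0]

/-- After `copBraid` and shifting S² to the first leg, S⁻¹S² = S there, so γ meets its inverse and
only `g` remains. -/
instance : E.Holds copConj₃ := .of_steps _
    [.rw copBraid [5, 4, 9, 10, 11, 12, 0, 13, 0, 0, 14], .rw mulAssoc.symm [7, 11, 10, 8, 15, 4],
     .rw mulAssoc.symm [7, 13, 12, 15, 4, 11], .rw grpMulInv [4, 7, 13], .rw oneMul [12, 15, 4],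
     .unwire .alg 12 15, .rw mulAssoc.symm [3, 12, 10, 1, 4, 8],
     .rw copAnti.symm [5, 14, 7, 0, 0, 0, 0, 0, 0, 0, 9],
     .rw copAnti.symm [7, 12, 8, 0, 0, 0, 0, 0, 0, 0, 14], .rw antiAntiInv [7, 6, 5],
     .unwire .alg 7 6, .rw copInvRight₂ [0, 4, 2, 3, 8, 12, 7], .rw oneMul [10, 1, 4],
     .unwire .alg 10 1]
    (by decide +kernel)

/-- `S⁻¹((x₂h)₁)x₁ ⊗ (x₂h)₂ = S⁻¹(h₁) ⊗ xh₂` -/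
def mulComulMul : Equation Wire Op where
  dom := [⟨.alg, 0⟩, ⟨.alg, 1⟩]
  cod := [⟨.alg, 2⟩, ⟨.alg, 3⟩]
  lhs := [.comul 0 4 5, .mul 5 1 6, .comul 6 7 3, .antiInv 7 8, .mul 8 4 2]
  rhs := [.comul 1 11 12, .antiInv 11 2, .mul 0 12 3]

/-- Expand Δ(x₂h) and cancel S⁻¹(x₂)x₁. -/
instance : E.Holds mulComulMul := .of_steps _
    [.rw mulComul [5, 1, 7, 3, 6, 9, 10, 11, 12], .rw mulAntiInv [9, 11, 8, 7, 0, 6, 0, 13],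
     .rw mulAssoc [13, 6, 4, 2, 8, 7], .rw coassoc.symm [0, 4, 9, 10, 8, 5],
     .rw antiInvLeft [8, 7, 4, 9, 6], .rw mulOne [13, 2, 7], .unwire .alg 13 2,
     .rw counitLeft [0, 10, 8], .unwire .alg 0 10]
    (by decide +kernel)

end

/-! ### The associativity morphisms as formal morphisms -/

namespace Term

variable {s s' t t' : WireTree Wire} {a b c : ℕ}

/-- The formal `insertAct`. -/
@[reducible] def insertAct (f : Term Op .unit (node (algWire a) (algWire b)))
    (x : Term Op (node (algWire a) s) s') (y : Term Op (node (algWire b) t) t') :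
    Term Op (node s t) (node s' t') :=
  .leftUnitorInv _ ⊚ f ▷ₜ node s t ⊚ middleSwap _ _ _ _ ⊚ .tensor x y

/-- The formal action on a tensor product of modules. -/
@[reducible] def tensorAct (h : ℕ) (x : Term Op (node (algWire a) s) s')
    (y : Term Op (node (algWire b) t) t') :
    Term Op (node (algWire h) (node s t)) (node s' t') :=
  op (.comul h a b) ▷ₜ node s t ⊚ middleSwap _ _ _ _ ⊚ .tensor x y

/-- The formal action on a free module. -/
@[reducible] def freeAct (h k l : ℕ) (x : WireTree Wire) :
    Term Op (node (algWire h) (node (algWire k) x)) (node (algWire l) x) :=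
  .assocInv _ _ _ ⊚ op (.mul h k l) ▷ₜ x

/-- The formal action on the trivial module. -/
@[reducible] def trivialAct (h : ℕ) : Term Op (node (algWire h) .unit) .unit :=
  .rightUnitor _ ⊚ op (.counit h)

/-- The formal associativity morphism in grades `010`. -/
@[reducible] def assoc010 (x : Term Op (node (algWire a) s) s') (r : WireTree Wire)
    (y : Term Op (node (algWire b) t) t') :
    Term Op (node s (node r t)) (node (node s' r) t') :=
  .assocInv _ _ _ ⊚ insertAct (op (.cop a b)) (.assocInv _ _ _ ⊚ x ▷ₜ r) y

/-- The formal `moveH`. -/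
@[reducible] def moveH (h h₁ h₂ : ℕ) (x : Term Op (node (algWire a) s) s') :
    Term Op (node s (algWire h)) (node (algWire h₂) s') :=
  .braid _ _ ⊚ (op (.comul h h₁ h₂) ⊚ .braid _ _) ▷ₜ s ⊚ .assoc _ _ _ ⊚
    algWire h₂ ◁ₜ (op (.antiInv h₁ a) ▷ₜ s ⊚ x)

/-- The formal associativity morphism in grades `011`. -/
@[reducible] def assoc011 (h h₁ h₂ : ℕ) (x : Term Op (node (algWire a) s) s')
    (r r' : WireTree Wire) :
    Term Op (node s (node (algWire h) (node r r'))) (node (algWire h₂) (node (node s' r) r')) :=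
  .assocInv _ _ _ ⊚ moveH h h₁ h₂ x ▷ₜ node r r' ⊚ .assoc _ _ _ ⊚ algWire h₂ ◁ₜ .assocInv _ _ _

/-- The formal associativity morphism in grades `101`. -/
@[reducible] def assoc101 (h h' c₁ c₂ n : ℕ) (r : WireTree Wire)
    (x : Term Op (node (algWire a) s) s') (r' : WireTree Wire) :
    Term Op (node (algWire h) (node r (node s r'))) (node (algWire h') (node (node r s') r')) :=
  algWire h ◁ₜ .assocInv _ _ _ ⊚
    insertAct (op (.cop c₁ c₂) ⊚ .braid _ _ ⊚ algWire c₂ ◁ₜ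
        (.leftUnitorInv _ ⊚ op (.grp n) ▷ₜ algWire c₁ ⊚ op (.mul n c₁ a)))
      (.braid _ _ ⊚ op (.mul h c₂ h'))
      (.assocInv _ _ _ ⊚
        (.assocInv _ _ _ ⊚ .braid _ _ ▷ₜ s ⊚ .assoc _ _ _ ⊚ r ◁ₜ x) ▷ₜ r')

/-- The formal associativity morphism in grades `110`. -/
@[reducible] def assoc110 (h h₁ : ℕ) (r r' : WireTree Wire)
    (x : Term Op (node (algWire a) s) s') :
    Term Op (node (algWire h) (node r (node r' s))) (node (node (algWire h₁) (node r r')) s') :=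
  .tensor (op (.comul h h₁ a)) (.assocInv _ _ _) ⊚ middleSwap _ _ _ _ ⊚
    node (algWire h₁) (node r r') ◁ₜ x

/-- The formal Fourier transform. -/
@[reducible] def fourier (h h' c₁ c₂ k : ℕ) : Term Op (algWire h) (algWire h') :=
  .leftUnitorInv _ ⊚ op (.cop c₁ c₂) ▷ₜ algWire h ⊚ .assoc _ _ _ ⊚
    algWire c₁ ◁ₜ (op (.mul c₂ h k) ⊚ op (.lam k)) ⊚ .rightUnitor _ ⊚ op (.anti c₁ h')

/-- The formal associativity morphism in grades `111`. -/
@[reducible] def assoc111 (h h' c₁ c₂ k : ℕ) (r r' r'' : WireTree Wire) :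
    Term Op (node r (node (algWire h) (node r' r'')))
      (node (node (algWire h') (node r r')) r'') :=
  r ◁ₜ (fourier h h' c₁ c₂ k ▷ₜ node r' r'') ⊚ .assocInv _ _ _ ⊚ .braid _ _ ▷ₜ node r' r'' ⊚
    .assoc _ _ _ ⊚ algWire h' ◁ₜ .assocInv _ _ _ ⊚ .assocInv _ _ _

end Term

/-- The wire of a module. -/
abbrev modWire (k a : ℕ) : WireTree Wire := leaf ⟨.mod k, a⟩

/-- The wire of an object. -/
abbrev objWire (k a : ℕ) : WireTree Wire := leaf ⟨.obj k, a⟩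

/-- The wire of a target module. -/
abbrev modWire' (k a : ℕ) : WireTree Wire := leaf ⟨.mod' k, a⟩

/-- The wire of a target object. -/
abbrev objWire' (k a : ℕ) : WireTree Wire := leaf ⟨.obj' k, a⟩

/-! ### Naturality, linearity and the pentagon identities in the grades `0`, `1` -/

section

variable {S : Type u} [Category.{v} S] [MonoidalCategory S] [SymmetricCategory S]

/-- In each theorem of this kind the two formal terms evaluate definitionally to the two sides, and
the final `.rename` steps only match the names of inner wires. For naturality the only input is that
module maps commute with the action. -/
theorem assoc_natural_000 (E : Model S) :
    ((E.modHom 0).hom ⊗ₘ ((E.modHom 1).hom ⊗ₘ (E.modHom 2).hom)) ≫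
      (α_ (E.mod' 0).X (E.mod' 1).X (E.mod' 2).X).inv =
      (α_ (E.mod 0).X (E.mod 1).X (E.mod 2).X).inv ≫
        (((E.modHom 0).hom ⊗ₘ (E.modHom 1).hom) ⊗ₘ (E.modHom 2).hom) :=
  Term.eval_eq_of_steps E
    (.tensor (op (.modHom 0 0 3)) (.tensor (op (.modHom 1 1 4)) (op (.modHom 2 2 5))) ⊚
       .assocInv (modWire' 0 3) (modWire' 1 4) (modWire' 2 5))
    (.assocInv (modWire 0 0) (modWire 1 1) (modWire 2 2) ⊚
       .tensor (.tensor (op (.modHom 0 0 3)) (op (.modHom 1 1 4))) (op (.modHom 2 2 5)))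
    []
    (by decide +kernel)

theorem assoc_natural_001 (E : Model S) :
    ((E.modHom 0).hom ⊗ₘ ((E.modHom 1).hom ⊗ₘ E.objHom 2)) ≫
      (α_ (E.mod' 0).X (E.mod' 1).X (E.obj' 2)).inv =
      (α_ (E.mod 0).X (E.mod 1).X (E.obj 2)).inv ≫
        (((E.modHom 0).hom ⊗ₘ (E.modHom 1).hom) ⊗ₘ E.objHom 2) :=
  Term.eval_eq_of_steps E
    (.tensor (op (.modHom 0 0 3)) (.tensor (op (.modHom 1 1 4)) (op (.objHom 2 2 5))) ⊚
       .assocInv (modWire' 0 3) (modWire' 1 4) (objWire' 2 5))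
    (.assocInv (modWire 0 0) (modWire 1 1) (objWire 2 2) ⊚
       .tensor (.tensor (op (.modHom 0 0 3)) (op (.modHom 1 1 4))) (op (.objHom 2 2 5)))
    []
    (by decide +kernel)

theorem assoc_natural_010 (E : Model S) :
    ((E.modHom 0).hom ⊗ₘ (E.objHom 1 ⊗ₘ (E.modHom 2).hom)) ≫
      assoc010 E.cop (E.mod' 0) (E.obj' 1) (E.mod' 2) =
      assoc010 E.cop (E.mod 0) (E.obj 1) (E.mod 2) ≫
        (((E.modHom 0).hom ⊗ₘ E.objHom 1) ⊗ₘ (E.modHom 2).hom) :=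
  Term.eval_eq_of_steps E
    (.tensor (op (.modHom 0 0 3)) (.tensor (op (.objHom 1 1 4)) (op (.modHom 2 2 5))) ⊚
       .assoc010 (op (.act' 0 6 3 8)) (objWire' 1 4) (op (.act' 2 7 5 9)))
    (.assoc010 (op (.act 0 10 0 12)) (objWire 1 1) (op (.act 2 11 2 13)) ⊚
       .tensor (.tensor (op (.modHom 0 12 8)) (op (.objHom 1 1 4))) (op (.modHom 2 13 9)))
    [.rw (actModHom 0).symm [6, 0, 10, 8, 3], .rw (actModHom 2).symm [7, 2, 3, 9, 5],
     .rename 7 11, .rename 10 12, .rename 6 10, .rename 3 13]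
    (by decide +kernel)

theorem assoc_natural_011 (E : Model S) :
    ((E.modHom 0).hom ⊗ₘ E.H ◁ (E.objHom 1 ⊗ₘ E.objHom 2)) ≫
      assoc011 (E.mod' 0) (E.obj' 1) (E.obj' 2) =
      assoc011 (E.mod 0) (E.obj 1) (E.obj 2) ≫
        E.H ◁ (((E.modHom 0).hom ⊗ₘ E.objHom 1) ⊗ₘ E.objHom 2) :=
  Term.eval_eq_of_steps E
    (.tensor (op (.modHom 0 0 4))
       ((algWire 1) ◁ₜ (.tensor (op (.objHom 1 2 5)) (op (.objHom 2 3 6)))) ⊚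
       .assoc011 1 7 8 (op (.act' 0 9 4 10)) (objWire' 1 5) (objWire' 2 6))
    (.assoc011 1 11 8 (op (.act 0 12 0 13)) (objWire 1 2) (objWire 2 3) ⊚
       (algWire 8) ◁ₜ
         (.tensor (.tensor (op (.modHom 0 13 10)) (op (.objHom 1 2 5))) (op (.objHom 2 3 6))))
    [.rw (actModHom 0).symm [9, 0, 11, 10, 4], .rename 9 12, .rename 11 13, .rename 7 11]
    (by decide +kernel)

theorem assoc_natural_100 (E : Model S) :
    (E.objHom 0 ⊗ₘ ((E.modHom 1).hom ⊗ₘ (E.modHom 2).hom)) ≫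
      (α_ (E.obj' 0) (E.mod' 1).X (E.mod' 2).X).inv =
      (α_ (E.obj 0) (E.mod 1).X (E.mod 2).X).inv ≫
        ((E.objHom 0 ⊗ₘ (E.modHom 1).hom) ⊗ₘ (E.modHom 2).hom) :=
  Term.eval_eq_of_steps E
    (.tensor (op (.objHom 0 0 3)) (.tensor (op (.modHom 1 1 4)) (op (.modHom 2 2 5))) ⊚
       .assocInv (objWire' 0 3) (modWire' 1 4) (modWire' 2 5))
    (.assocInv (objWire 0 0) (modWire 1 1) (modWire 2 2) ⊚
       .tensor (.tensor (op (.objHom 0 0 3)) (op (.modHom 1 1 4))) (op (.modHom 2 2 5)))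
    []
    (by decide +kernel)

theorem assoc_natural_101 (E : Model S) :
    E.H ◁ (E.objHom 0 ⊗ₘ ((E.modHom 1).hom ⊗ₘ E.objHom 2)) ≫
      assoc101 E.cop E.g (E.obj' 0) (E.mod' 1) (E.obj' 2) =
      assoc101 E.cop E.g (E.obj 0) (E.mod 1) (E.obj 2) ≫
        E.H ◁ ((E.objHom 0 ⊗ₘ (E.modHom 1).hom) ⊗ₘ E.objHom 2) :=
  Term.eval_eq_of_steps E
    ((algWire 0) ◁ₜ
       (.tensor (op (.objHom 0 1 4)) (.tensor (op (.modHom 1 2 5)) (op (.objHom 2 3 6)))) ⊚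
       .assoc101 0 11 7 8 9 (objWire' 0 4) (op (.act' 1 10 5 12)) (objWire' 2 6))
    (.assoc101 0 11 13 14 15 (objWire 0 1) (op (.act 1 16 2 17)) (objWire 2 3) ⊚
       (algWire 11) ◁ₜ
         (.tensor (.tensor (op (.objHom 0 1 4)) (op (.modHom 1 17 12))) (op (.objHom 2 3 6))))
    [.rw (actModHom 1).symm [10, 2, 13, 12, 5], .rename 8 14, .rename 9 15, .rename 10 16,
     .rename 13 17, .rename 7 13]
    (by decide +kernel)

theorem assoc_natural_110 (E : Model S) :
    E.H ◁ (E.objHom 0 ⊗ₘ (E.objHom 1 ⊗ₘ (E.modHom 2).hom)) ≫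
      assoc110 (E.obj' 0) (E.obj' 1) (E.mod' 2) =
      assoc110 (E.obj 0) (E.obj 1) (E.mod 2) ≫
        (E.H ◁ (E.objHom 0 ⊗ₘ E.objHom 1) ⊗ₘ (E.modHom 2).hom) :=
  Term.eval_eq_of_steps E
    ((algWire 0) ◁ₜ
       (.tensor (op (.objHom 0 1 4)) (.tensor (op (.objHom 1 2 5)) (op (.modHom 2 3 6)))) ⊚
       .assoc110 0 7 (objWire' 0 4) (objWire' 1 5) (op (.act' 2 8 6 9)))
    (.assoc110 0 7 (objWire 0 1) (objWire 1 2) (op (.act 2 10 3 11)) ⊚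
       .tensor ((algWire 7) ◁ₜ (.tensor (op (.objHom 0 1 4)) (op (.objHom 1 2 5))))
         (op (.modHom 2 11 9)))
    [.rw (actModHom 2).symm [8, 3, 10, 9, 6], .rename 10 11, .rename 8 10]
    (by decide +kernel)

theorem assoc_natural_111 (E : Model S) :
    (E.objHom 0 ⊗ₘ E.H ◁ (E.objHom 1 ⊗ₘ E.objHom 2)) ≫
      assoc111 E.cop E.lam (E.obj' 0) (E.obj' 1) (E.obj' 2) =
      assoc111 E.cop E.lam (E.obj 0) (E.obj 1) (E.obj 2) ≫
        (E.H ◁ (E.objHom 0 ⊗ₘ E.objHom 1) ⊗ₘ E.objHom 2) :=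
  Term.eval_eq_of_steps E
    (.tensor (op (.objHom 0 0 4))
       ((algWire 1) ◁ₜ (.tensor (op (.objHom 1 2 5)) (op (.objHom 2 3 6)))) ⊚
       .assoc111 1 10 7 8 9 (objWire' 0 4) (objWire' 1 5) (objWire' 2 6))
    (.assoc111 1 10 11 12 13 (objWire 0 0) (objWire 1 2) (objWire 2 3) ⊚
       .tensor ((algWire 10) ◁ₜ (.tensor (op (.objHom 0 0 4)) (op (.objHom 1 2 5))))
         (op (.objHom 2 3 6)))
    [.rename 7 11, .rename 8 12, .rename 9 13]
    (by decide +kernel)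

theorem act_assoc_000 (E : Model S) :
    act (tensorModule (E.mod 0) (tensorModule (E.mod 1) (E.mod 2))) ≫
      (α_ (E.mod 0).X (E.mod 1).X (E.mod 2).X).inv =
      E.H ◁ (α_ (E.mod 0).X (E.mod 1).X (E.mod 2).X).inv ≫
        act (tensorModule (tensorModule (E.mod 0) (E.mod 1)) (E.mod 2)) :=
  Term.eval_eq_of_steps E
    (.tensorAct 0 (op (.act 0 4 1 6)) (.tensorAct 5 (op (.act 1 7 2 9)) (op (.act 2 8 3 10))) ⊚
       .assocInv (modWire 0 6) (modWire 1 9) (modWire 2 10))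
    ((algWire 0) ◁ₜ (.assocInv (modWire 0 1) (modWire 1 2) (modWire 2 3)) ⊚
       .tensorAct 0 (.tensorAct 11 (op (.act 0 13 1 6)) (op (.act 1 14 2 9)))
         (op (.act 2 12 3 10)))
    [.rw coassoc.symm [0, 4, 7, 8, 11, 5], .rename 8 12, .rename 4 13, .rename 7 14]
    (by decide +kernel)

/-- This is why S⁻¹ appears in the grade 011: the acting element contributes S⁻¹(x₂)x₁ = ε(x) on the
module. -/
theorem act_assoc_011 (E : Model S) :
    act (tensorModule (E.mod 0) (freeModule E.H (E.obj 1 ⊗ E.obj 2))) ≫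
      assoc011 (E.mod 0) (E.obj 1) (E.obj 2) =
      E.H ◁ assoc011 (E.mod 0) (E.obj 1) (E.obj 2) ≫
        act (freeModule E.H (((E.mod 0).X ⊗ E.obj 1) ⊗ E.obj 2)) :=
  Term.eval_eq_of_steps E
    (.tensorAct 0 (op (.act 0 5 1 7)) (.freeAct 6 2 8 (node (objWire 1 3) (objWire 2 4))) ⊚
       .assoc011 8 9 10 (op (.act 0 11 7 12)) (objWire 1 3) (objWire 2 4))
    ((algWire 0) ◁ₜ (.assoc011 2 13 14 (op (.act 0 15 1 12)) (objWire 1 3) (objWire 2 4)) ⊚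
       .freeAct 0 14 10 (node (node (modWire 0 12) (objWire 1 3)) (objWire 2 4)))
    [.rw mulComul [6, 2, 9, 10, 8, 13, 14, 15, 16], .rw mulAntiInv [13, 15, 11, 9, 0, 8, 0, 17],
     .rw (actMul 0) [17, 8, 11, 7, 12, 9], .rw (actMul 0).symm [8, 5, 11, 1, 9, 7],
     .rw coassoc.symm [0, 5, 13, 14, 7, 6], .rw antiInvLeft [7, 11, 5, 13, 8],
     .rw (actOne 0) [11, 1, 9], .unwire (.mod 0) 1 9, .rw counitLeft [0, 14, 7],
     .unwire .alg 0 14, .rename 15 13, .rename 16 14, .rename 17 15]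
    (by decide +kernel)

/-- Right multiplication by γ'' commutes with the left action on H. -/
theorem act_assoc_101 (E : Model S) :
    act (freeModule E.H (E.obj 0 ⊗ ((E.mod 1).X ⊗ E.obj 2))) ≫
      assoc101 E.cop E.g (E.obj 0) (E.mod 1) (E.obj 2) =
      E.H ◁ assoc101 E.cop E.g (E.obj 0) (E.mod 1) (E.obj 2) ≫
        act (freeModule E.H ((E.obj 0 ⊗ (E.mod 1).X) ⊗ E.obj 2)) :=
  Term.eval_eq_of_steps E
    (.freeAct 0 1 5 (node (objWire 0 2) (node (modWire 1 3) (objWire 2 4))) ⊚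
       .assoc101 5 10 6 7 8 (objWire 0 2) (op (.act 1 9 3 11)) (objWire 2 4))
    ((algWire 0) ◁ₜ (.assoc101 1 16 12 13 14 (objWire 0 2) (op (.act 1 15 3 11)) (objWire 2 4)) ⊚
       .freeAct 0 16 10 (node (node (objWire 0 2) (modWire 1 11)) (objWire 2 4)))
    [.rw mulAssoc [0, 1, 7, 10, 5, 12], .rename 7 13, .rename 8 14, .rename 9 15, .rename 12 16,
     .rename 6 12]
    (by decide +kernel)

theorem act_assoc_110 (E : Model S) :
    act (freeModule E.H (E.obj 0 ⊗ (E.obj 1 ⊗ (E.mod 2).X))) ≫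
      assoc110 (E.obj 0) (E.obj 1) (E.mod 2) =
      E.H ◁ assoc110 (E.obj 0) (E.obj 1) (E.mod 2) ≫
        act (tensorModule (freeModule E.H (E.obj 0 ⊗ E.obj 1)) (E.mod 2)) :=
  Term.eval_eq_of_steps E
    (.freeAct 0 1 5 (node (objWire 0 2) (node (objWire 1 3) (modWire 2 4))) ⊚
       .assoc110 5 6 (objWire 0 2) (objWire 1 3) (op (.act 2 7 4 8)))
    ((algWire 0) ◁ₜ (.assoc110 1 9 (objWire 0 2) (objWire 1 3) (op (.act 2 10 4 11))) ⊚
       .tensorAct 0 (.freeAct 12 9 6 (node (objWire 0 2) (objWire 1 3))) (op (.act 2 13 11 8)))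
    [.rw mulComul [0, 1, 6, 7, 5, 9, 10, 11, 12], .rw (actMul 2) [10, 12, 7, 4, 8, 5],
     .rename 10 13, .rename 12 10, .rename 9 12, .rename 11 9, .rename 5 11]
    (by decide +kernel)

theorem pentagon_0000 (E : Model S) :
    (𝟙 (E.mod 0).X ⊗ₘ (α_ (E.mod 1).X (E.mod 2).X (E.mod 3).X).inv) ≫
      (α_ (E.mod 0).X ((E.mod 1).X ⊗ (E.mod 2).X) (E.mod 3).X).inv ≫
      ((α_ (E.mod 0).X (E.mod 1).X (E.mod 2).X).inv ⊗ₘ 𝟙 (E.mod 3).X) =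
      (α_ (E.mod 0).X (E.mod 1).X ((E.mod 2).X ⊗ (E.mod 3).X)).inv ≫
        (α_ ((E.mod 0).X ⊗ (E.mod 1).X) (E.mod 2).X (E.mod 3).X).inv :=
  Term.eval_eq_of_steps E
    (.tensor (.id (modWire 0 0)) (.assocInv (modWire 1 1) (modWire 2 2) (modWire 3 3)) ⊚
       .assocInv (modWire 0 0) (node (modWire 1 1) (modWire 2 2)) (modWire 3 3) ⊚
       .tensor (.assocInv (modWire 0 0) (modWire 1 1) (modWire 2 2)) (.id (modWire 3 3)))
    (.assocInv (modWire 0 0) (modWire 1 1) (node (modWire 2 2) (modWire 3 3)) ⊚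
       .assocInv (node (modWire 0 0) (modWire 1 1)) (modWire 2 2) (modWire 3 3))
    []
    (by decide +kernel)

theorem pentagon_0001 (E : Model S) :
    (𝟙 (E.mod 0).X ⊗ₘ (α_ (E.mod 1).X (E.mod 2).X (E.obj 3)).inv) ≫
      (α_ (E.mod 0).X ((E.mod 1).X ⊗ (E.mod 2).X) (E.obj 3)).inv ≫
      ((α_ (E.mod 0).X (E.mod 1).X (E.mod 2).X).inv ⊗ₘ 𝟙 (E.obj 3)) =
      (α_ (E.mod 0).X (E.mod 1).X ((E.mod 2).X ⊗ E.obj 3)).inv ≫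
        (α_ ((E.mod 0).X ⊗ (E.mod 1).X) (E.mod 2).X (E.obj 3)).inv :=
  Term.eval_eq_of_steps E
    (.tensor (.id (modWire 0 0)) (.assocInv (modWire 1 1) (modWire 2 2) (objWire 3 3)) ⊚
       .assocInv (modWire 0 0) (node (modWire 1 1) (modWire 2 2)) (objWire 3 3) ⊚
       .tensor (.assocInv (modWire 0 0) (modWire 1 1) (modWire 2 2)) (.id (objWire 3 3)))
    (.assocInv (modWire 0 0) (modWire 1 1) (node (modWire 2 2) (objWire 3 3)) ⊚
       .assocInv (node (modWire 0 0) (modWire 1 1)) (modWire 2 2) (objWire 3 3))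
    []
    (by decide +kernel)

theorem pentagon_0010 (E : Model S) :
    (𝟙 (E.mod 0).X ⊗ₘ assoc010 E.cop (E.mod 1) (E.obj 2) (E.mod 3)) ≫
      assoc010 E.cop (E.mod 0) ((E.mod 1).X ⊗ E.obj 2) (E.mod 3) ≫
      ((α_ (E.mod 0).X (E.mod 1).X (E.obj 2)).inv ⊗ₘ 𝟙 (E.mod 3).X) =
      (α_ (E.mod 0).X (E.mod 1).X (E.obj 2 ⊗ (E.mod 3).X)).inv ≫
        assoc010 E.cop (tensorModule (E.mod 0) (E.mod 1)) (E.obj 2) (E.mod 3) :=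
  Term.eval_eq_of_steps E
    (.tensor (.id (modWire 0 0))
       (.assoc010 (op (.act 1 4 1 6)) (objWire 2 2) (op (.act 3 5 3 7))) ⊚
       .assoc010 (op (.act 0 8 0 10)) (node (modWire 1 6) (objWire 2 2)) (op (.act 3 9 7 11)) ⊚
       .tensor (.assocInv (modWire 0 10) (modWire 1 6) (objWire 2 2)) (.id (modWire 3 11)))
    (.assocInv (modWire 0 0) (modWire 1 1) (node (objWire 2 2) (modWire 3 3)) ⊚
       .assoc010 (.tensorAct 12 (op (.act 0 14 0 10)) (op (.act 1 15 1 6))) (objWire 2 2)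
         (op (.act 3 13 3 11)))
    [.rw (actMul 3).symm [9, 5, 12, 3, 11, 7], .rw copComulLeft.symm [8, 4, 12, 7, 9, 5],
     .rename 12 13, .rename 7 12, .rename 8 14, .rename 4 15]
    (by decide +kernel)

theorem pentagon_0011 (E : Model S) :
    (𝟙 (E.mod 0).X ⊗ₘ assoc011 (E.mod 1) (E.obj 2) (E.obj 3)) ≫
      assoc011 (E.mod 0) ((E.mod 1).X ⊗ E.obj 2) (E.obj 3) ≫
      E.H ◁ ((α_ (E.mod 0).X (E.mod 1).X (E.obj 2)).inv ⊗ₘ 𝟙 (E.obj 3)) =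
      (α_ (E.mod 0).X (E.mod 1).X (E.H ⊗ (E.obj 2 ⊗ E.obj 3))).inv ≫
        assoc011 (tensorModule (E.mod 0) (E.mod 1)) (E.obj 2) (E.obj 3) :=
  Term.eval_eq_of_steps E
    (.tensor (.id (modWire 0 0))
       (.assoc011 2 5 6 (op (.act 1 7 1 8)) (objWire 2 3) (objWire 3 4)) ⊚
       .assoc011 6 9 10 (op (.act 0 11 0 12)) (node (modWire 1 8) (objWire 2 3)) (objWire 3 4) ⊚
       (algWire 10) ◁ₜ
         (.tensor (.assocInv (modWire 0 12) (modWire 1 8) (objWire 2 3)) (.id (objWire 3 4))))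
    (.assocInv (modWire 0 0) (modWire 1 1)
       (node (algWire 2) (node (objWire 2 3) (objWire 3 4))) ⊚
       .assoc011 2 13 10 (.tensorAct 14 (op (.act 0 15 0 12)) (op (.act 1 16 1 8))) (objWire 2 3)
         (objWire 3 4))
    [.rw coassoc.symm [2, 5, 9, 10, 13, 6], .rw antiInvComul.symm [13, 11, 7, 6, 0, 9, 0, 5],
     .rename 6 14, .rename 11 15, .rename 7 16]
    (by decide +kernel)

theorem pentagon_0100 (E : Model S) :
    (𝟙 (E.mod 0).X ⊗ₘ (α_ (E.obj 1) (E.mod 2).X (E.mod 3).X).inv) ≫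
      assoc010 E.cop (E.mod 0) (E.obj 1 ⊗ (E.mod 2).X) (E.mod 3) ≫
      (assoc010 E.cop (E.mod 0) (E.obj 1) (E.mod 2) ⊗ₘ 𝟙 (E.mod 3).X) =
      assoc010 E.cop (E.mod 0) (E.obj 1) (tensorModule (E.mod 2) (E.mod 3)) ≫
        (α_ ((E.mod 0).X ⊗ E.obj 1) (E.mod 2).X (E.mod 3).X).inv :=
  Term.eval_eq_of_steps E
    (.tensor (.id (modWire 0 0)) (.assocInv (objWire 1 1) (modWire 2 2) (modWire 3 3)) ⊚
       .assoc010 (op (.act 0 4 0 6)) (node (objWire 1 1) (modWire 2 2)) (op (.act 3 5 3 7)) ⊚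
       .tensor (.assoc010 (op (.act 0 8 6 10)) (objWire 1 1) (op (.act 2 9 2 11)))
         (.id (modWire 3 7)))
    (.assoc010 (op (.act 0 12 0 10)) (objWire 1 1)
       (.tensorAct 13 (op (.act 2 14 2 11)) (op (.act 3 15 3 7))) ⊚
       .assocInv (node (modWire 0 10) (objWire 1 1)) (modWire 2 11) (modWire 3 7))
    [.rw (actMul 0).symm [8, 4, 12, 0, 10, 6], .rw copComulRight.symm [12, 9, 5, 6, 8, 4],
     .rename 6 13, .rename 9 14, .rename 5 15]
    (by decide +kernel)

/-- Splitting γ by (id ⊗ Δ)γ isolates c'S⁻¹(γ'') ⊗ c''gγ', which `copConj₃` reduces to 1 ⊗ g. -/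
theorem pentagon_0101 (E : Model S) :
    (𝟙 (E.mod 0).X ⊗ₘ assoc101 E.cop E.g (E.obj 1) (E.mod 2) (E.obj 3)) ≫
      assoc011 (E.mod 0) (E.obj 1 ⊗ (E.mod 2).X) (E.obj 3) ≫
      E.H ◁ (assoc010 E.cop (E.mod 0) (E.obj 1) (E.mod 2) ⊗ₘ 𝟙 (E.obj 3)) =
      assoc011 (E.mod 0) (E.obj 1) ((E.mod 2).X ⊗ E.obj 3) ≫
        assoc101 E.cop E.g ((E.mod 0).X ⊗ E.obj 1) (E.mod 2) (E.obj 3) :=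
  Term.eval_eq_of_steps E
    (.tensor (.id (modWire 0 0))
       (.assoc101 1 9 5 6 7 (objWire 1 2) (op (.act 2 8 3 10)) (objWire 3 4)) ⊚
       .assoc011 9 11 12 (op (.act 0 13 0 14)) (node (objWire 1 2) (modWire 2 10))
         (objWire 3 4) ⊚
       (algWire 12) ◁ₜ
         (.tensor (.assoc010 (op (.act 0 15 14 17)) (objWire 1 2) (op (.act 2 16 10 18)))
            (.id (objWire 3 4))))
    (.assoc011 1 19 20 (op (.act 0 21 0 17)) (objWire 1 2) (node (modWire 2 3) (objWire 3 4)) ⊚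
       .assoc101 20 12 22 23 24 (node (modWire 0 17) (objWire 1 2)) (op (.act 2 25 3 18))
         (objWire 3 4))
    [.rw mulComul [1, 6, 11, 12, 9, 19, 20, 21, 22], .rw mulAntiInv [19, 21, 13, 11, 0, 9, 0, 23],
     .rw copComulRight [5, 21, 22, 6, 11, 24], .rw mulAssoc.symm [7, 11, 24, 8, 6, 5],
     .rw (actMul 0).symm [15, 13, 5, 0, 17, 14], .rw (actMul 2).symm [16, 8, 14, 3, 18, 10],
     .rw mulAssoc.symm [15, 23, 9, 5, 10, 13], .rw mulAssoc.symm [16, 6, 24, 14, 13, 8],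
     .rw copConj₃ [10, 13, 15, 16, 11, 21, 23, 7, 6], .rw oneMul [9, 5, 10], .unwire .alg 9 5,
     .rename 9 21, .rename 22 23, .rename 24 22, .rename 13 24, .rename 14 25]
    (by decide +kernel)

theorem pentagon_0110 (E : Model S) :
    (𝟙 (E.mod 0).X ⊗ₘ assoc110 (E.obj 1) (E.obj 2) (E.mod 3)) ≫
      (α_ (E.mod 0).X (E.H ⊗ (E.obj 1 ⊗ E.obj 2)) (E.mod 3).X).inv ≫
      (assoc011 (E.mod 0) (E.obj 1) (E.obj 2) ⊗ₘ 𝟙 (E.mod 3).X) =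
      assoc011 (E.mod 0) (E.obj 1) (E.obj 2 ⊗ (E.mod 3).X) ≫
        assoc110 ((E.mod 0).X ⊗ E.obj 1) (E.obj 2) (E.mod 3) :=
  Term.eval_eq_of_steps E
    (.tensor (.id (modWire 0 0))
       (.assoc110 1 5 (objWire 1 2) (objWire 2 3) (op (.act 3 6 4 7))) ⊚
       .assocInv (modWire 0 0) (node (algWire 5) (node (objWire 1 2) (objWire 2 3)))
         (modWire 3 7) ⊚
       .tensor (.assoc011 5 8 9 (op (.act 0 10 0 11)) (objWire 1 2) (objWire 2 3))
         (.id (modWire 3 7)))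
    (.assoc011 1 12 13 (op (.act 0 14 0 11)) (objWire 1 2) (node (objWire 2 3) (modWire 3 4)) ⊚
       .assoc110 13 9 (node (modWire 0 11) (objWire 1 2)) (objWire 2 3) (op (.act 3 15 4 7)))
    [.rw coassoc [1, 8, 9, 6, 5, 12], .rename 12 13, .rename 8 12, .rename 6 15, .rename 10 14]
    (by decide +kernel)

theorem pentagon_0111 (E : Model S) :
    (𝟙 (E.mod 0).X ⊗ₘ assoc111 E.cop E.lam (E.obj 1) (E.obj 2) (E.obj 3)) ≫
      (α_ (E.mod 0).X (E.H ⊗ (E.obj 1 ⊗ E.obj 2)) (E.obj 3)).inv ≫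
      (assoc011 (E.mod 0) (E.obj 1) (E.obj 2) ⊗ₘ 𝟙 (E.obj 3)) =
      assoc010 E.cop (E.mod 0) (E.obj 1) (freeModule E.H (E.obj 2 ⊗ E.obj 3)) ≫
        assoc111 E.cop E.lam ((E.mod 0).X ⊗ E.obj 1) (E.obj 2) (E.obj 3) :=
  Term.eval_eq_of_steps E
    (.tensor (.id (modWire 0 0))
       (.assoc111 2 8 5 6 7 (objWire 1 1) (objWire 2 3) (objWire 3 4)) ⊚
       .assocInv (modWire 0 0) (node (algWire 8) (node (objWire 1 1) (objWire 2 3)))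
         (objWire 3 4) ⊚
       .tensor (.assoc011 8 9 10 (op (.act 0 11 0 12)) (objWire 1 1) (objWire 2 3))
         (.id (objWire 3 4)))
    (.assoc010 (op (.act 0 13 0 12)) (objWire 1 1)
       (.freeAct 14 2 15 (node (objWire 2 3) (objWire 3 4))) ⊚
       .assoc111 15 10 16 17 18 (node (modWire 0 12) (objWire 1 1)) (objWire 2 3) (objWire 3 4))
    [.rw fourierCopMul.symm [2, 10, 11, 13, 5, 6, 9, 8, 0, 0, 14, 15, 7], .rename 14 16,
     .rename 13 14, .rename 11 13, .rename 15 17, .rename 5 15, .rename 7 18]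
    (by decide +kernel)

theorem pentagon_1000 (E : Model S) :
    (𝟙 (E.obj 0) ⊗ₘ (α_ (E.mod 1).X (E.mod 2).X (E.mod 3).X).inv) ≫
      (α_ (E.obj 0) ((E.mod 1).X ⊗ (E.mod 2).X) (E.mod 3).X).inv ≫
      ((α_ (E.obj 0) (E.mod 1).X (E.mod 2).X).inv ⊗ₘ 𝟙 (E.mod 3).X) =
      (α_ (E.obj 0) (E.mod 1).X ((E.mod 2).X ⊗ (E.mod 3).X)).inv ≫
        (α_ (E.obj 0 ⊗ (E.mod 1).X) (E.mod 2).X (E.mod 3).X).inv :=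
  Term.eval_eq_of_steps E
    (.tensor (.id (objWire 0 0)) (.assocInv (modWire 1 1) (modWire 2 2) (modWire 3 3)) ⊚
       .assocInv (objWire 0 0) (node (modWire 1 1) (modWire 2 2)) (modWire 3 3) ⊚
       .tensor (.assocInv (objWire 0 0) (modWire 1 1) (modWire 2 2)) (.id (modWire 3 3)))
    (.assocInv (objWire 0 0) (modWire 1 1) (node (modWire 2 2) (modWire 3 3)) ⊚
       .assocInv (node (objWire 0 0) (modWire 1 1)) (modWire 2 2) (modWire 3 3))
    []
    (by decide +kernel)

/-- Combines the grouplike property of `g` with (Δ ⊗ id)γ. -/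
theorem pentagon_1001 (E : Model S) :
    E.H ◁ (𝟙 (E.obj 0) ⊗ₘ (α_ (E.mod 1).X (E.mod 2).X (E.obj 3)).inv) ≫
      assoc101 E.cop E.g (E.obj 0) (tensorModule (E.mod 1) (E.mod 2)) (E.obj 3) ≫
      E.H ◁ ((α_ (E.obj 0) (E.mod 1).X (E.mod 2).X).inv ⊗ₘ 𝟙 (E.obj 3)) =
      assoc101 E.cop E.g (E.obj 0) (E.mod 1) ((E.mod 2).X ⊗ E.obj 3) ≫
        assoc101 E.cop E.g (E.obj 0 ⊗ (E.mod 1).X) (E.mod 2) (E.obj 3) :=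
  Term.eval_eq_of_steps E
    ((algWire 0) ◁ₜ
       (.tensor (.id (objWire 0 1)) (.assocInv (modWire 1 2) (modWire 2 3) (objWire 3 4))) ⊚
       .assoc101 0 9 5 6 7 (objWire 0 1)
         (.tensorAct 8 (op (.act 1 10 2 12)) (op (.act 2 11 3 13))) (objWire 3 4) ⊚
       (algWire 9) ◁ₜ
         (.tensor (.assocInv (objWire 0 1) (modWire 1 12) (modWire 2 13)) (.id (objWire 3 4))))
    (.assoc101 0 18 14 15 16 (objWire 0 1) (op (.act 1 17 2 12))
       (node (modWire 2 3) (objWire 3 4)) ⊚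
       .assoc101 18 9 19 20 21 (node (objWire 0 1) (modWire 1 12)) (op (.act 2 22 3 13))
         (objWire 3 4))
    [.rw mulComul [7, 5, 10, 11, 8, 14, 15, 16, 17], .rw grpComul [14, 15, 7],
     .rw copComulLeft [16, 17, 6, 5, 7, 8], .rw mulAssoc.symm [0, 7, 8, 9, 5, 6], .rename 15 21,
     .rename 7 15, .rename 17 19, .rename 8 20, .rename 10 17, .rename 11 22, .rename 5 18,
     .rename 14 24, .rename 16 14, .rename 24 16]
    (by decide +kernel)

theorem pentagon_1010 (E : Model S) :
    E.H ◁ (𝟙 (E.obj 0) ⊗ₘ assoc010 E.cop (E.mod 1) (E.obj 2) (E.mod 3)) ≫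
      assoc110 (E.obj 0) ((E.mod 1).X ⊗ E.obj 2) (E.mod 3) ≫
      (assoc101 E.cop E.g (E.obj 0) (E.mod 1) (E.obj 2) ⊗ₘ 𝟙 (E.mod 3).X) =
      assoc101 E.cop E.g (E.obj 0) (E.mod 1) (E.obj 2 ⊗ (E.mod 3).X) ≫
        assoc110 (E.obj 0 ⊗ (E.mod 1).X) (E.obj 2) (E.mod 3) :=
  Term.eval_eq_of_steps E
    ((algWire 0) ◁ₜ
       (.tensor (.id (objWire 0 1))
          (.assoc010 (op (.act 1 5 2 7)) (objWire 2 3) (op (.act 3 6 4 8)))) ⊚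
       .assoc110 0 9 (objWire 0 1) (node (modWire 1 7) (objWire 2 3)) (op (.act 3 10 8 11)) ⊚
       .tensor (.assoc101 9 16 12 13 14 (objWire 0 1) (op (.act 1 15 7 17)) (objWire 2 3))
         (.id (modWire 3 11)))
    (.assoc101 0 22 18 19 20 (objWire 0 1) (op (.act 1 21 2 17))
       (node (objWire 2 3) (modWire 3 4)) ⊚
       .assoc110 22 16 (node (objWire 0 1) (modWire 1 17)) (objWire 2 3) (op (.act 3 23 4 11)))
    [.rw (actMul 1).symm [15, 5, 18, 2, 17, 7], .rw (actMul 3).symm [10, 6, 7, 4, 11, 8],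
     .rw mulAssoc [14, 12, 5, 18, 15, 8], .rw copComulRight.symm [8, 13, 6, 15, 12, 5],
     .rw mulComul.symm [0, 15, 16, 7, 5, 9, 10, 13, 6], .rename 14 20, .rename 15 19,
     .rename 18 21, .rename 8 18, .rename 5 22, .rename 7 23]
    (by decide +kernel)

/-- `lamMulComul₂` trades S⁻¹(h₁)λ(γ''h₂) for g⁻¹γ''₁λ(γ''₂h). After splitting γ, the copies not
attached to λ cancel by `copConj`. -/
theorem pentagon_1011 (E : Model S) :
    (𝟙 (E.obj 0) ⊗ₘ assoc011 (E.mod 1) (E.obj 2) (E.obj 3)) ≫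
      assoc111 E.cop E.lam (E.obj 0) ((E.mod 1).X ⊗ E.obj 2) (E.obj 3) ≫
      (assoc101 E.cop E.g (E.obj 0) (E.mod 1) (E.obj 2) ⊗ₘ 𝟙 (E.obj 3)) =
      (α_ (E.obj 0) (E.mod 1).X (E.H ⊗ (E.obj 2 ⊗ E.obj 3))).inv ≫
        assoc111 E.cop E.lam (E.obj 0 ⊗ (E.mod 1).X) (E.obj 2) (E.obj 3) := by
  -- The left diagram acts on the module and so renames its wire. An explicit identity gives the
  -- right diagram the same output names; it is removed at the end.
  have h : (𝟙 (E.obj 0) ⊗ₘ assoc011 (E.mod 1) (E.obj 2) (E.obj 3)) ≫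
          assoc111 E.cop E.lam (E.obj 0) ((E.mod 1).X ⊗ E.obj 2) (E.obj 3) ≫
          (assoc101 E.cop E.g (E.obj 0) (E.mod 1) (E.obj 2) ⊗ₘ 𝟙 (E.obj 3)) =
        (α_ (E.obj 0) (E.mod 1).X (E.H ⊗ (E.obj 2 ⊗ E.obj 3))).inv ≫
          assoc111 E.cop E.lam (E.obj 0 ⊗ (E.mod 1).X) (E.obj 2) (E.obj 3) ≫
          ((E.H ◁ (((E.obj 0) ◁ 𝟙 (E.mod 1).X) ▷ (E.obj 2))) ▷ (E.obj 3)) :=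
    Term.eval_eq_of_steps E
      (.tensor (.id (objWire 0 0))
         (.assoc011 2 5 6 (op (.act 1 7 1 8)) (objWire 2 3) (objWire 3 4)) ⊚
         .assoc111 6 12 9 10 11 (objWire 0 0) (node (modWire 1 8) (objWire 2 3)) (objWire 3 4) ⊚
         .tensor (.assoc101 12 17 13 14 15 (objWire 0 0) (op (.act 1 16 8 18)) (objWire 2 3))
           (.id (objWire 3 4)))
      (.assocInv (objWire 0 0) (modWire 1 1)
         (node (algWire 2) (node (objWire 2 3) (objWire 3 4))) ⊚
         .assoc111 2 17 19 20 21 (node (objWire 0 0) (modWire 1 1)) (objWire 2 3) (objWire 3 4) ⊚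
         ((algWire 17) ◁ₜ (((objWire 0 0) ◁ₜ (op (.wire (.mod 1) 1 18))) ▷ₜ (objWire 2 3))) ▷ₜ
           (objWire 3 4))
      [.rw (actMul 1).symm [16, 7, 19, 1, 18, 8],
       .rw lamMulComul₂.symm [10, 2, 7, 0, 11, 0, 8, 20, 21, 22, 6, 5],
       .rw copComulRight [9, 8, 20, 10, 5, 6], .rw mulAnti [5, 6, 12, 9, 10, 11],
       .rw mulAssoc [11, 10, 14, 17, 12, 9], .rw mulAssoc.symm [16, 22, 8, 19, 12, 7],
       .rw copConj [9, 19, 5, 8, 10, 13, 14, 15, 16, 22, 12], .rw mulOne [11, 17, 9],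
       .unwire .alg 11 17, .rw (actOne 1) [19, 1, 18], .rename 6 19]
      (by decide +kernel)
  simpa only [whiskerLeft_id, id_whiskerRight, Category.comp_id] using h

theorem pentagon_1100 (E : Model S) :
    E.H ◁ (𝟙 (E.obj 0) ⊗ₘ (α_ (E.obj 1) (E.mod 2).X (E.mod 3).X).inv) ≫
      assoc110 (E.obj 0) (E.obj 1 ⊗ (E.mod 2).X) (E.mod 3) ≫
      (assoc110 (E.obj 0) (E.obj 1) (E.mod 2) ⊗ₘ 𝟙 (E.mod 3).X) =
      assoc110 (E.obj 0) (E.obj 1) (tensorModule (E.mod 2) (E.mod 3)) ≫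
        (α_ (E.H ⊗ (E.obj 0 ⊗ E.obj 1)) (E.mod 2).X (E.mod 3).X).inv :=
  Term.eval_eq_of_steps E
    ((algWire 0) ◁ₜ
       (.tensor (.id (objWire 0 1)) (.assocInv (objWire 1 2) (modWire 2 3) (modWire 3 4))) ⊚
       .assoc110 0 5 (objWire 0 1) (node (objWire 1 2) (modWire 2 3)) (op (.act 3 6 4 7)) ⊚
       .tensor (.assoc110 5 8 (objWire 0 1) (objWire 1 2) (op (.act 2 9 3 10)))
         (.id (modWire 3 7)))
    (.assoc110 0 8 (objWire 0 1) (objWire 1 2)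
       (.tensorAct 11 (op (.act 2 12 3 10)) (op (.act 3 13 4 7))) ⊚
       .assocInv (node (algWire 8) (node (objWire 0 1) (objWire 1 2))) (modWire 2 10)
         (modWire 3 7))
    [.rw coassoc [0, 8, 9, 6, 5, 11], .rename 9 12, .rename 6 13]
    (by decide +kernel)

/-- The coproduct of S(γ') doubles γ; `lamCopCop` cancels one of the copies together with the γ of
the associator 101. -/
theorem pentagon_1101 (E : Model S) :
    (𝟙 (E.obj 0) ⊗ₘ assoc101 E.cop E.g (E.obj 1) (E.mod 2) (E.obj 3)) ≫
      assoc111 E.cop E.lam (E.obj 0) (E.obj 1 ⊗ (E.mod 2).X) (E.obj 3) ≫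
      (assoc110 (E.obj 0) (E.obj 1) (E.mod 2) ⊗ₘ 𝟙 (E.obj 3)) =
      assoc111 E.cop E.lam (E.obj 0) (E.obj 1) ((E.mod 2).X ⊗ E.obj 3) ≫
        (α_ (E.H ⊗ (E.obj 0 ⊗ E.obj 1)) (E.mod 2).X (E.obj 3)).inv := by
  have h : (𝟙 (E.obj 0) ⊗ₘ assoc101 E.cop E.g (E.obj 1) (E.mod 2) (E.obj 3)) ≫
          assoc111 E.cop E.lam (E.obj 0) (E.obj 1 ⊗ (E.mod 2).X) (E.obj 3) ≫
          (assoc110 (E.obj 0) (E.obj 1) (E.mod 2) ⊗ₘ 𝟙 (E.obj 3)) =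
        assoc111 E.cop E.lam (E.obj 0) (E.obj 1) ((E.mod 2).X ⊗ E.obj 3) ≫
          (α_ (E.H ⊗ (E.obj 0 ⊗ E.obj 1)) (E.mod 2).X (E.obj 3)).inv ≫
          (((E.H ⊗ ((E.obj 0) ⊗ (E.obj 1))) ◁ 𝟙 (E.mod 2).X) ▷ (E.obj 3)) :=
    Term.eval_eq_of_steps E
      (.tensor (.id (objWire 0 0))
         (.assoc101 1 9 5 6 7 (objWire 1 2) (op (.act 2 8 3 10)) (objWire 3 4)) ⊚
         .assoc111 9 14 11 12 13 (objWire 0 0) (node (objWire 1 2) (modWire 2 10)) (objWire 3 4) ⊚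
         .tensor (.assoc110 14 15 (objWire 0 0) (objWire 1 2) (op (.act 2 16 10 17)))
           (.id (objWire 3 4)))
      (.assoc111 1 15 18 19 20 (objWire 0 0) (objWire 1 2) (node (modWire 2 3) (objWire 3 4)) ⊚
         .assocInv (node (algWire 15) (node (objWire 0 0) (objWire 1 2))) (modWire 2 3)
           (objWire 3 4) ⊚
         ((node (algWire 15) (node (objWire 0 0) (objWire 1 2))) ◁ₜ (op (.wire (.mod 2) 3 17))) ▷ₜ
           (objWire 3 4))
      [.rw antiComul [11, 15, 16, 14, 18, 19], .rw copComulLeft [18, 19, 12, 11, 14, 20],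
       .rw mulAssoc [14, 20, 9, 13, 12, 11], .rw mulAssoc.symm [20, 1, 6, 11, 12, 9],
       .rw mulAssoc.symm [14, 12, 6, 13, 9, 11], .rw (actMul 2).symm [16, 8, 11, 3, 17, 10],
       .rw lamCopCop [12, 11, 18, 14, 5, 6, 9, 13, 16, 7, 8], .rw (actOne 2) [11, 3, 17],
       .rename 19 18, .rename 20 19, .rename 12 20]
      (by decide +kernel)
  simpa only [whiskerLeft_id, id_whiskerRight, Category.comp_id] using h

theorem pentagon_1110 (E : Model S) :
    (𝟙 (E.obj 0) ⊗ₘ assoc110 (E.obj 1) (E.obj 2) (E.mod 3)) ≫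
      (α_ (E.obj 0) (E.H ⊗ (E.obj 1 ⊗ E.obj 2)) (E.mod 3).X).inv ≫
      (assoc111 E.cop E.lam (E.obj 0) (E.obj 1) (E.obj 2) ⊗ₘ 𝟙 (E.mod 3).X) =
      assoc111 E.cop E.lam (E.obj 0) (E.obj 1) (E.obj 2 ⊗ (E.mod 3).X) ≫
        assoc010 E.cop (freeModule E.H (E.obj 0 ⊗ E.obj 1)) (E.obj 2) (E.mod 3) :=
  Term.eval_eq_of_steps E
    (.tensor (.id (objWire 0 0))
       (.assoc110 1 5 (objWire 1 2) (objWire 2 3) (op (.act 3 6 4 7))) ⊚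
       .assocInv (objWire 0 0) (node (algWire 5) (node (objWire 1 2) (objWire 2 3)))
         (modWire 3 7) ⊚
       .tensor (.assoc111 5 11 8 9 10 (objWire 0 0) (objWire 1 2) (objWire 2 3))
         (.id (modWire 3 7)))
    (.assoc111 1 15 12 13 14 (objWire 0 0) (objWire 1 2) (node (objWire 2 3) (modWire 3 4)) ⊚
       .assoc010 (.freeAct 16 15 11 (node (objWire 0 0) (objWire 1 2))) (objWire 2 3)
         (op (.act 3 17 4 7)))
    [.rw fourierComul [1, 11, 6, 5, 8, 9, 10, 12, 13, 0, 14], .rename 9 15, .rename 14 16,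
     .rename 12 14, .rename 5 12, .rename 6 17]
    (by decide +kernel)

/-- Replacing γ'F(k) ⊗ γ'' by F(k₁) ⊗ k₂ exposes F(gF(k₁)) = S⁻¹(k₁). The result S⁻¹(k₁) ⊗ hk₂ is
the other side by `mulComulMul`. -/
theorem pentagon_1111 (E : Model S) :
    E.H ◁ (𝟙 (E.obj 0) ⊗ₘ assoc111 E.cop E.lam (E.obj 1) (E.obj 2) (E.obj 3)) ≫
      assoc101 E.cop E.g (E.obj 0) (freeModule E.H (E.obj 1 ⊗ E.obj 2)) (E.obj 3) ≫
      E.H ◁ (assoc111 E.cop E.lam (E.obj 0) (E.obj 1) (E.obj 2) ⊗ₘ 𝟙 (E.obj 3)) =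
      assoc110 (E.obj 0) (E.obj 1) (freeModule E.H (E.obj 2 ⊗ E.obj 3)) ≫
        assoc011 (freeModule E.H (E.obj 0 ⊗ E.obj 1)) (E.obj 2) (E.obj 3) :=
  Term.eval_eq_of_steps E
    ((algWire 0) ◁ₜ
       (.tensor (.id (objWire 0 1))
          (.assoc111 3 9 6 7 8 (objWire 1 2) (objWire 2 4) (objWire 3 5))) ⊚
       .assoc101 0 14 10 11 12 (objWire 0 1)
         (.freeAct 13 9 15 (node (objWire 1 2) (objWire 2 4))) (objWire 3 5) ⊚
       (algWire 14) ◁ₜ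
         (.tensor (.assoc111 15 19 16 17 18 (objWire 0 1) (objWire 1 2) (objWire 2 4))
            (.id (objWire 3 5))))
    (.assoc110 0 20 (objWire 0 1) (objWire 1 2)
       (.freeAct 21 3 22 (node (objWire 2 4) (objWire 3 5))) ⊚
       .assoc011 22 23 14 (.freeAct 24 20 19 (node (objWire 0 1) (objWire 1 2))) (objWire 2 4)
         (objWire 3 5))
    [.rw mulAssoc [12, 10, 9, 15, 13, 20],
     .rw fourierComul.symm [3, 20, 11, 6, 13, 9, 21, 8, 7, 0, 10],
     .rw fourierGrpFourier [6, 19, 13, 9, 21, 20, 12, 15, 16, 17, 18],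
     .rw mulComulMul.symm [0, 3, 19, 14, 7, 8, 9, 10, 12, 0, 0, 6, 11], .rename 7 20,
     .rename 8 21, .rename 9 22, .rename 10 23, .rename 12 24]
    (by decide +kernel)

end

/-! ### Invertibility of the associativity morphisms, and the triangle identity in grades `101` -/

/-- The one-sided inverses may be given by different expressions. The composites `e`, `e'` arise
from diagrams as tensor products of identities and are simplified separately. -/
lemma isIso_of_comp {C : Type u} [Category.{v} C] {X Y : C} {f : X ⟶ Y} {g g' : Y ⟶ X}
    {e : X ⟶ X} {e' : Y ⟶ Y} (h : f ≫ g = e) (h' : g' ≫ f = e') (he : e = 𝟙 X) (he' : e' = 𝟙 Y) :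
    IsIso f := by
  have : IsSplitMono f := .mk' ⟨g, h.trans he⟩
  have : IsSplitEpi f := .mk' ⟨g', h'.trans he'⟩
  exact isIso_of_mono_of_isSplitEpi f

lemma tensorHom_eq_id {C : Type u} [Category.{v} C] [MonoidalCategory C] {X Y : C} {f : X ⟶ X}
    {g : Y ⟶ Y} (hf : f = 𝟙 X) (hg : g = 𝟙 Y) : f ⊗ₘ g = 𝟙 (X ⊗ Y) := by
  rw [hf, hg, id_tensorHom_id]

section

variable {S : Type u} [Category.{v} S] [MonoidalCategory S] [SymmetricCategory S]

/-- The inverse acts by S(γ') ⊗ γ'', the inverse of γ in H ⊗ H. -/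
theorem isIso_assoc010 (E : Model S) :
    IsIso (assoc010 E.cop (E.mod 0) (E.obj 1) (E.mod 2)) :=
  isIso_of_comp
    (Term.eval_eq_of_steps E
      ((.assoc010 (op (.act 0 3 0 5)) (objWire 1 1) (op (.act 2 4 2 6))) ⊚
         (.insertAct (op (.cop 7 8) ⊚ (op (.anti 7 9)) ▷ₜ (algWire 8))
            (.assocInv (algWire 9) (modWire 0 5) (objWire 1 1) ⊚
               (op (.act 0 9 5 10)) ▷ₜ (objWire 1 1))
            (op (.act 2 8 6 11)) ⊚
            .assoc (modWire 0 10) (objWire 1 1) (modWire 2 11)))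
      (.tensor (op (.wire (.mod 0) 0 10))
         (.tensor (.id (objWire 1 1)) (op (.wire (.mod 2) 2 11))))
      [.rw (actMul 0).symm [9, 3, 12, 0, 10, 5], .rw (actMul 2).symm [8, 4, 5, 2, 11, 6],
       .rw copInvLeft₂ [12, 5, 7, 8, 3, 4, 9], .rw (actOne 0) [12, 0, 10],
       .rw (actOne 2) [5, 2, 11]]
      (by decide +kernel))
    (Term.eval_eq_of_steps E
      ((.insertAct (op (.cop 3 4) ⊚ (op (.anti 3 5)) ▷ₜ (algWire 4))
          (.assocInv (algWire 5) (modWire 0 0) (objWire 1 1) ⊚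
             (op (.act 0 5 0 6)) ▷ₜ (objWire 1 1))
          (op (.act 2 4 2 7)) ⊚
          .assoc (modWire 0 6) (objWire 1 1) (modWire 2 7)) ⊚
         (.assoc010 (op (.act 0 8 6 10)) (objWire 1 1) (op (.act 2 9 7 11))))
      (.tensor (.tensor (op (.wire (.mod 0) 0 10)) (.id (objWire 1 1)))
         (op (.wire (.mod 2) 2 11)))
      [.rw (actMul 0).symm [8, 5, 12, 0, 10, 6], .rw (actMul 2).symm [9, 4, 6, 2, 11, 7],
       .rw copInvRight₂ [12, 6, 8, 9, 3, 4, 5], .rw (actOne 0) [12, 0, 10],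
       .rw (actOne 2) [6, 2, 11]]
      (by decide +kernel))
    (tensorHom_eq_id rfl (tensorHom_eq_id rfl rfl))
    (tensorHom_eq_id (tensorHom_eq_id rfl rfl) rfl)

/-- The inverse is h ⊗ a ↦ h₁.a ⊗ h₂. -/
theorem isIso_moveH (E : Model S) :
    IsIso (moveH (E.mod 0)) :=
  isIso_of_comp
    (Term.eval_eq_of_steps E
      ((.moveH 1 2 3 (op (.act 0 4 0 5))) ⊚
         ((op (.comul 3 6 7) ⊚ .braid (algWire 6) (algWire 7)) ▷ₜ (modWire 0 5) ⊚
            .assoc (algWire 7) (algWire 6) (modWire 0 5) ⊚ (algWire 7) ◁ₜ (op (.act 0 6 5 8)) ⊚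
            .braid (algWire 7) (modWire 0 8)))
      (.tensor (op (.wire (.mod 0) 0 8)) (op (.wire .alg 1 7)))
      [.rw (actMul 0).symm [6, 4, 9, 0, 8, 5], .rw coassoc.symm [1, 2, 6, 7, 5, 3],
       .rw antiInvRight [5, 9, 2, 6, 4], .rw (actOne 0) [9, 0, 8], .rw counitLeft [1, 7, 5]]
      (by decide +kernel))
    (Term.eval_eq_of_steps E
      (((op (.comul 0 2 3) ⊚ .braid (algWire 2) (algWire 3)) ▷ₜ (modWire 0 1) ⊚
          .assoc (algWire 3) (algWire 2) (modWire 0 1) ⊚ (algWire 3) ◁ₜ (op (.act 0 2 1 4)) ⊚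
          .braid (algWire 3) (modWire 0 4)) ⊚
         (.moveH 3 5 6 (op (.act 0 7 4 8))))
      (.tensor (op (.wire .alg 0 6)) (op (.wire (.mod 0) 1 8)))
      [.rw (actMul 0).symm [7, 2, 9, 1, 8, 4], .rw coassoc.symm [0, 2, 5, 6, 4, 3],
       .rw antiInvLeft [4, 9, 2, 5, 7], .rw (actOne 0) [9, 1, 8], .rw counitLeft [0, 6, 4]]
      (by decide +kernel))
    (tensorHom_eq_id rfl rfl)
    (tensorHom_eq_id rfl rfl)

/-- The inverse multiplies by γ'' on the right and acts by S⁻¹(γ')g⁻¹. Here S⁻¹ replaces S because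
the second leg multiplies from the right, in the opposite order. -/
theorem isIso_assoc101 (E : Model S) :
    IsIso (assoc101 E.cop E.g (E.obj 0) (E.mod 1) (E.obj 2)) :=
  isIso_of_comp
    (Term.eval_eq_of_steps E
      ((.assoc101 0 8 4 5 6 (objWire 0 1) (op (.act 1 7 2 9)) (objWire 2 3)) ⊚
         (.insertAct
            (op (.cop 10 11) ⊚ .braid (algWire 10) (algWire 11) ⊚
               (algWire 11) ◁ₜ
                 (op (.antiInv 10 12) ⊚ .rightUnitorInv (algWire 12) ⊚
                    (algWire 12) ◁ₜ (op (.grpInv 13)) ⊚ op (.mul 12 13 14)))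
            (.braid (algWire 11) (algWire 8) ⊚ op (.mul 8 11 15))
            (.assocInv (algWire 14) (node (objWire 0 1) (modWire 1 9)) (objWire 2 3) ⊚
               (.assocInv (algWire 14) (objWire 0 1) (modWire 1 9) ⊚
                  (.braid (algWire 14) (objWire 0 1)) ▷ₜ (modWire 1 9) ⊚
                  .assoc (objWire 0 1) (algWire 14) (modWire 1 9) ⊚
                  (objWire 0 1) ◁ₜ (op (.act 1 14 9 16)))
                 ▷ₜ (objWire 2 3)) ⊚
            (algWire 15) ◁ₜ (.assoc (objWire 0 1) (modWire 1 16) (objWire 2 3))))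
      (.tensor (op (.wire .alg 0 15))
         (.tensor (.id (objWire 0 1)) (.tensor (op (.wire (.mod 1) 2 16)) (.id (objWire 2 3)))))
      [.rw (actMul 1).symm [14, 7, 17, 2, 16, 9], .rw mulAssoc [0, 5, 11, 15, 8, 9],
       .rw mulAssoc [12, 13, 7, 17, 14, 8], .rw mulAssoc.symm [13, 6, 4, 8, 14, 7],
       .rw grpInvMul [14, 13, 6], .rw oneMul [4, 8, 14], .unwire .alg 4 8,
       .rw copInvLeft₃ [17, 9, 4, 5, 10, 11, 12], .rw mulOne [0, 15, 9],
       .rw (actOne 1) [17, 2, 16]]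
      (by decide +kernel))
    (Term.eval_eq_of_steps E
      ((.insertAct
          (op (.cop 4 5) ⊚ .braid (algWire 4) (algWire 5) ⊚
             (algWire 5) ◁ₜ
               (op (.antiInv 4 6) ⊚ .rightUnitorInv (algWire 6) ⊚
                  (algWire 6) ◁ₜ (op (.grpInv 7)) ⊚ op (.mul 6 7 8)))
          (.braid (algWire 5) (algWire 0) ⊚ op (.mul 0 5 9))
          (.assocInv (algWire 8) (node (objWire 0 1) (modWire 1 2)) (objWire 2 3) ⊚
             (.assocInv (algWire 8) (objWire 0 1) (modWire 1 2) ⊚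
                (.braid (algWire 8) (objWire 0 1)) ▷ₜ (modWire 1 2) ⊚
                .assoc (objWire 0 1) (algWire 8) (modWire 1 2) ⊚
                (objWire 0 1) ◁ₜ (op (.act 1 8 2 10)))
               ▷ₜ (objWire 2 3)) ⊚
          (algWire 9) ◁ₜ (.assoc (objWire 0 1) (modWire 1 10) (objWire 2 3))) ⊚
         (.assoc101 9 15 11 12 13 (objWire 0 1) (op (.act 1 14 10 16)) (objWire 2 3)))
      (.tensor (op (.wire .alg 0 15))
         (.tensor (.tensor (.id (objWire 0 1)) (op (.wire (.mod 1) 2 16))) (.id (objWire 2 3))))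
      [.rw (actMul 1).symm [14, 8, 17, 2, 16, 10], .rw mulAssoc [0, 5, 12, 15, 9, 10],
       .rw mulAssoc [13, 11, 8, 17, 14, 9], .rw mulAssoc.symm [11, 6, 7, 9, 14, 8],
       .rw copInvRight₃ [14, 10, 4, 5, 11, 12, 6], .rw mulOne [0, 15, 10], .rw oneMul [7, 9, 14],
       .unwire .alg 7 9, .rw grpMulInv [17, 13, 7], .rw (actOne 1) [17, 2, 16]]
      (by decide +kernel))
    (tensorHom_eq_id rfl (tensorHom_eq_id rfl (tensorHom_eq_id rfl rfl)))
    (tensorHom_eq_id rfl (tensorHom_eq_id (tensorHom_eq_id rfl rfl) rfl))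

/-- The inverse is h ⊗ x ⊗ y ⊗ c ↦ h₁ ⊗ x ⊗ y ⊗ S(h₂).c. -/
theorem isIso_assoc110 (E : Model S) :
    IsIso (assoc110 (E.obj 0) (E.obj 1) (E.mod 2)) :=
  isIso_of_comp
    (Term.eval_eq_of_steps E
      ((.assoc110 0 4 (objWire 0 1) (objWire 1 2) (op (.act 2 5 3 6))) ⊚
         (((op (.comul 4 7 8)) ▷ₜ (node (objWire 0 1) (objWire 1 2)) ⊚
             .assoc (algWire 7) (algWire 8) (node (objWire 0 1) (objWire 1 2)) ⊚
             (algWire 7) ◁ₜ (.braid (algWire 8) (node (objWire 0 1) (objWire 1 2))) ⊚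
             .assocInv (algWire 7) (node (objWire 0 1) (objWire 1 2)) (algWire 8))
            ▷ₜ (modWire 2 6) ⊚
            .assoc (node (algWire 7) (node (objWire 0 1) (objWire 1 2))) (algWire 8)
              (modWire 2 6) ⊚
            (node (algWire 7) (node (objWire 0 1) (objWire 1 2))) ◁ₜ
              ((op (.anti 8 9)) ▷ₜ (modWire 2 6) ⊚ op (.act 2 9 6 10)) ⊚
            .assoc (algWire 7) (node (objWire 0 1) (objWire 1 2)) (modWire 2 10) ⊚
            (algWire 7) ◁ₜ (.assoc (objWire 0 1) (objWire 1 2) (modWire 2 10))))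
      (.tensor (op (.wire .alg 0 7))
         (.tensor (.id (objWire 0 1)) (.tensor (.id (objWire 1 2)) (op (.wire (.mod 2) 3 10)))))
      [.rw (actMul 2).symm [9, 5, 11, 3, 10, 6], .rw coassoc [0, 7, 8, 5, 4, 6],
       .rw antiLeft [6, 11, 8, 5, 9], .rw (actOne 2) [11, 3, 10], .rw counitRight [0, 7, 6]]
      (by decide +kernel))
    (Term.eval_eq_of_steps E
      ((((op (.comul 0 4 5)) ▷ₜ (node (objWire 0 1) (objWire 1 2)) ⊚
           .assoc (algWire 4) (algWire 5) (node (objWire 0 1) (objWire 1 2)) ⊚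
           (algWire 4) ◁ₜ (.braid (algWire 5) (node (objWire 0 1) (objWire 1 2))) ⊚
           .assocInv (algWire 4) (node (objWire 0 1) (objWire 1 2)) (algWire 5))
          ▷ₜ (modWire 2 3) ⊚
          .assoc (node (algWire 4) (node (objWire 0 1) (objWire 1 2))) (algWire 5)
            (modWire 2 3) ⊚
          (node (algWire 4) (node (objWire 0 1) (objWire 1 2))) ◁ₜ
            ((op (.anti 5 6)) ▷ₜ (modWire 2 3) ⊚ op (.act 2 6 3 7)) ⊚
          .assoc (algWire 4) (node (objWire 0 1) (objWire 1 2)) (modWire 2 7) ⊚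
          (algWire 4) ◁ₜ (.assoc (objWire 0 1) (objWire 1 2) (modWire 2 7))) ⊚
         (.assoc110 4 8 (objWire 0 1) (objWire 1 2) (op (.act 2 9 7 10))))
      (.tensor (.tensor (op (.wire .alg 0 8)) (.id (node (objWire 0 1) (objWire 1 2))))
         (op (.wire (.mod 2) 3 10)))
      [.rw (actMul 2).symm [9, 6, 11, 3, 10, 7], .rw coassoc [0, 8, 9, 5, 4, 7],
       .rw antiRight [7, 11, 9, 5, 6], .rw (actOne 2) [11, 3, 10], .rw counitRight [0, 8, 7]]
      (by decide +kernel))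
    (tensorHom_eq_id rfl (tensorHom_eq_id rfl (tensorHom_eq_id rfl rfl)))
    (tensorHom_eq_id (tensorHom_eq_id rfl rfl) rfl)

theorem fourier_leftMul_fourier (E : Model S) :
    fourier E.cop E.lam ≫ leftMul E.g ≫ fourier E.cop E.lam =
      inv (HopfObj.antipode (X := E.H)) :=
  Term.eval_eq_of_steps E
    (.fourier 0 4 1 2 3 ⊚
       (.leftUnitorInv (algWire 4) ⊚ (op (.grp 5)) ▷ₜ (algWire 4) ⊚ op (.mul 5 4 6)) ⊚
       .fourier 6 10 7 8 9)
    (op (.antiInv 0 10))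
    [.rw fourierGrpFourier [0, 10, 1, 2, 3, 4, 5, 6, 7, 8, 9]]
    (by decide +kernel)

/-- On the trivial module gγ' acts by ε(g)ε(γ') = ε(γ'), and ε(γ')γ'' = 1. -/
theorem triangle_101 (E : Model S) :
    assoc101 E.cop E.g (E.obj 0) (trivialModule E.H) (E.obj 2) ≫
      E.H ◁ ((ρ_ (E.obj 0)).hom ⊗ₘ 𝟙 (E.obj 2)) =
      E.H ◁ (𝟙 (E.obj 0) ⊗ₘ (λ_ (E.obj 2)).hom) := by
  have h : assoc101 E.cop E.g (E.obj 0) (trivialModule E.H) (E.obj 2) ≫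
          E.H ◁ ((ρ_ (E.obj 0)).hom ⊗ₘ 𝟙 (E.obj 2)) =
        E.H ◁ (𝟙 (E.obj 0) ⊗ₘ (λ_ (E.obj 2)).hom) ≫ (𝟙 (E.H) ▷ ((E.obj 0) ⊗ (E.obj 2))) :=
    Term.eval_eq_of_steps E
      (.assoc101 0 7 3 4 5 (objWire 0 1) (.trivialAct 6) (objWire 2 2) ⊚
         (algWire 7) ◁ₜ (.tensor (.rightUnitor (objWire 0 1)) (.id (objWire 2 2))))
      ((algWire 0) ◁ₜ (.tensor (.id (objWire 0 1)) (.leftUnitor (objWire 2 2))) ⊚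
         (op (.wire .alg 0 7)) ▷ₜ (node (objWire 0 1) (objWire 2 2)))
      [.rw mulCounit [5, 3, 6], .rw grpCounit [5], .rw copCounitLeft [4, 3], .rw mulOne [0, 7, 4]]
      (by decide +kernel)
  simpa only [whiskerLeft_id, id_whiskerRight, Category.comp_id] using h

/-- F ∘ L ∘ F = S⁻¹, with L left multiplication by `g`, is invertible, so F has inverses on both
sides. -/
theorem isIso_fourier (E : Model S) : IsIso (fourier E.cop E.lam) := by
  have h := fourier_leftMul_fourier E
  refine isIso_of_comp (g := leftMul E.g ≫ fourier E.cop E.lam ≫ HopfObj.antipode)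
    (g' := HopfObj.antipode ≫ fourier E.cop E.lam ≫ leftMul E.g) rfl rfl ?_ ?_
  · simp only [← Category.assoc] at h ⊢
    rw [h, IsIso.inv_hom_id]
  · simp only [Category.assoc]
    rw [h, IsIso.hom_inv_id]

end

/-! ### The monoidal structure -/

section

variable {S : Type u} [Category.{v} S] [MonoidalCategory S] [SymmetricCategory S]

namespace Model

/-- The same Hopf algebra with other morphisms of modules and other morphisms. -/
@[reducible] def withHoms (E : Model S) {m m' : ℕ → Mod S E.H} {o o' : ℕ → S}
    (f : ∀ k, m k ⟶ m' k) (h : ∀ k, o k ⟶ o' k) : Model S :=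
  { E with
    mod := m
    mod' := m'
    modHom := f
    obj := o
    obj' := o'
    objHom := h }

/-- The same Hopf algebra with other modules and other objects. -/
@[reducible] def withObjects (E : Model S) (m : ℕ → Mod S E.H) (o : ℕ → S) : Model S :=
  E.withHoms (fun k => 𝟙 (m k)) (fun k => 𝟙 (o k))

end Model

theorem isIso_assoc011 (E : Model S) : IsIso (assoc011 (E.mod 0) (E.obj 1) (E.obj 2)) := by
  have := isIso_moveH E
  unfold assoc011
  infer_instance

theorem isIso_assoc111 (E : Model S) :
    IsIso (assoc111 E.cop E.lam (E.obj 0) (E.obj 1) (E.obj 2)) := by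
  have := isIso_fourier E
  unfold assoc111
  infer_instance

/-- The grade-wise theorems read position k from the k-th module or the k-th object. At positions of
the other grade the families below take arbitrary filler values. -/
theorem isIso_assocMor (E : Model S) : ∀ X Y Z : Ext E.H, IsIso (assocMor E.cop E.lam E.g X Y Z)
  | .inl X, .inl Y, .inl Z => inferInstanceAs (IsIso (α_ X.X Y.X Z.X).inv)
  | .inl X, .inl Y, .inr Z => inferInstanceAs (IsIso (α_ X.X Y.X Z).inv)
  | .inl X, .inr Y, .inl Z => isIso_assoc010 (E.withObjects (fun | 0 => X | 1 => X | _ + 2 => Z) (fun | 0 => Y | _ + 1 => Y))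
  | .inl X, .inr Y, .inr Z => isIso_assoc011 (E.withObjects (fun _ => X) (fun | 0 => Y | 1 => Y | _ + 2 => Z))
  | .inr X, .inl Y, .inl Z => inferInstanceAs (IsIso (α_ X Y.X Z.X).inv)
  | .inr X, .inl Y, .inr Z => isIso_assoc101 (E.withObjects (fun | 0 => Y | _ + 1 => Y) (fun | 0 => X | 1 => X | _ + 2 => Z))
  | .inr X, .inr Y, .inl Z => isIso_assoc110 (E.withObjects (fun | 0 => Z | 1 => Z | _ + 2 => Z) (fun | 0 => X | _ + 1 => Y))
  | .inr X, .inr Y, .inr Z => isIso_assoc111 (E.withObjects (fun _ => trivialModule E.H) (fun | 0 => X | 1 => Y | _ + 2 => Z))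

namespace Model

/-- The isomorphism underlying the associativity isomorphism. -/
noncomputable def forgetAssocIso (E : Model S) (X Y Z : Ext E.H) :
    (forgetGrade E.H).obj (starObj X (starObj Y Z)) ≅
      (forgetGrade E.H).obj (starObj (starObj X Y) Z) :=
  @asIso _ _ _ _ (assocMor E.cop E.lam E.g X Y Z) (isIso_assocMor E X Y Z)

/-- The associativity isomorphism. -/
noncomputable def assocIso (E : Model S) : ∀ X Y Z : Ext E.H,
    starObj X (starObj Y Z) ≅ starObj (starObj X Y) Z
  | .inl X, .inl Y, .inl Z => (Sum.inl_ _ _).mapIso (mkModIso (E.forgetAssocIso (.inl X) (.inl Y) (.inl Z))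
    (act_assoc_000 (E.withObjects (fun | 0 => X | 1 => Y | _ + 2 => Z) (fun _ => 𝟙_ S))))
  | .inl X, .inl Y, .inr Z => (Sum.inr_ _ _).mapIso (E.forgetAssocIso (.inl X) (.inl Y) (.inr Z))
  | .inl X, .inr Y, .inl Z => (Sum.inr_ _ _).mapIso (E.forgetAssocIso (.inl X) (.inr Y) (.inl Z))
  | .inl X, .inr Y, .inr Z => (Sum.inl_ _ _).mapIso (mkModIso (E.forgetAssocIso (.inl X) (.inr Y) (.inr Z))
    (act_assoc_011 (E.withObjects (fun _ => X) (fun | 0 => Y | 1 => Y | _ + 2 => Z))))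
  | .inr X, .inl Y, .inl Z => (Sum.inr_ _ _).mapIso (E.forgetAssocIso (.inr X) (.inl Y) (.inl Z))
  | .inr X, .inl Y, .inr Z => (Sum.inl_ _ _).mapIso (mkModIso (E.forgetAssocIso (.inr X) (.inl Y) (.inr Z))
    (act_assoc_101 (E.withObjects (fun | 0 => Y | _ + 1 => Y) (fun | 0 => X | 1 => X | _ + 2 => Z))))
  | .inr X, .inr Y, .inl Z => (Sum.inl_ _ _).mapIso (mkModIso (E.forgetAssocIso (.inr X) (.inr Y) (.inl Z))
    (act_assoc_110 (E.withObjects (fun | 0 => Z | 1 => Z | _ + 2 => Z) (fun | 0 => X | _ + 1 => Y))))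
  | .inr X, .inr Y, .inr Z => (Sum.inr_ _ _).mapIso (E.forgetAssocIso (.inr X) (.inr Y) (.inr Z))

lemma forgetGrade_map_assocIso_hom (E : Model S) : ∀ X Y Z : Ext E.H,
    (forgetGrade E.H).map (E.assocIso X Y Z).hom = assocMor E.cop E.lam E.g X Y Z
  | .inl _, .inl _, .inl _ => rfl
  | .inl _, .inl _, .inr _ => rfl
  | .inl _, .inr _, .inl _ => rfl
  | .inl _, .inr _, .inr _ => rfl
  | .inr _, .inl _, .inl _ => rfl
  | .inr _, .inl _, .inr _ => rfl
  | .inr _, .inr _, .inl _ => rfl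
  | .inr _, .inr _, .inr _ => rfl

end Model

/-- There are no morphisms between the two grades, and a module map is determined by its underlying
morphism. Coherence in `C` is thereby reduced to `S`. -/
instance (H : S) [HopfObj H] : (forgetGrade H).Faithful where
  map_injective {X Y} f g h := by
    match X, Y, f, g, h with
    | .inl _, .inl _, f, g, h => exact ULift.ext _ _ (Mod.hom_ext _ _ h)
    | .inr _, .inr _, f, g, h => exact ULift.ext _ _ h

lemma tensor_triangle {C : Type u} [Category.{v} C] [MonoidalCategory C] (X Y : C) :
    (α_ X (𝟙_ C) Y).inv ≫ ((ρ_ X).hom ⊗ₘ 𝟙 Y) = 𝟙 X ⊗ₘ (λ_ Y).hom := by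
  simp

theorem assocIso_natural (E : Model S) : ∀ {X X' Y Y' Z Z' : Ext E.H} (f : X ⟶ X') (g : Y ⟶ Y')
    (h : Z ⟶ Z'), starHom f (starHom g h) ≫ (E.assocIso X' Y' Z').hom =
      (E.assocIso X Y Z).hom ≫ starHom (starHom f g) h
  | .inl X, .inl X', .inl Y, .inl Y', .inl Z, .inl Z', f, g, h =>
    (forgetGrade E.H).map_injective (assoc_natural_000 (E.withHoms
      (m := fun | 0 => X | 1 => Y | _ + 2 => Z) (m' := fun | 0 => X' | 1 => Y' | _ + 2 => Z')
      (o := fun _ => 𝟙_ S) (o' := fun _ => 𝟙_ S)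
      (fun | 0 => f.down | 1 => g.down | _ + 2 => h.down) (fun _ => 𝟙 _)))
  | .inl X, .inl X', .inl Y, .inl Y', .inr Z, .inr Z', f, g, h =>
    (forgetGrade E.H).map_injective (assoc_natural_001 (E.withHoms
      (m := fun | 0 => X | _ + 1 => Y) (m' := fun | 0 => X' | _ + 1 => Y')
      (o := fun | 0 => Z | 1 => Z | _ + 2 => Z) (o' := fun | 0 => Z' | 1 => Z' | _ + 2 => Z')
      (fun | 0 => f.down | _ + 1 => g.down) (fun | 0 => h.down | 1 => h.down | _ + 2 => h.down)))
  | .inl X, .inl X', .inr Y, .inr Y', .inl Z, .inl Z', f, g, h =>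
    (forgetGrade E.H).map_injective (assoc_natural_010 (E.withHoms
      (m := fun | 0 => X | 1 => X | _ + 2 => Z) (m' := fun | 0 => X' | 1 => X' | _ + 2 => Z')
      (o := fun | 0 => Y | _ + 1 => Y) (o' := fun | 0 => Y' | _ + 1 => Y')
      (fun | 0 => f.down | 1 => f.down | _ + 2 => h.down) (fun | 0 => g.down | _ + 1 => g.down)))
  | .inl X, .inl X', .inr Y, .inr Y', .inr Z, .inr Z', f, g, h =>
    (forgetGrade E.H).map_injective (assoc_natural_011 (E.withHoms
      (m := fun _ => X) (m' := fun _ => X')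
      (o := fun | 0 => Y | 1 => Y | _ + 2 => Z) (o' := fun | 0 => Y' | 1 => Y' | _ + 2 => Z')
      (fun _ => f.down) (fun | 0 => g.down | 1 => g.down | _ + 2 => h.down)))
  | .inr X, .inr X', .inl Y, .inl Y', .inl Z, .inl Z', f, g, h =>
    (forgetGrade E.H).map_injective (assoc_natural_100 (E.withHoms
      (m := fun | 0 => Y | 1 => Y | _ + 2 => Z) (m' := fun | 0 => Y' | 1 => Y' | _ + 2 => Z')
      (o := fun _ => X) (o' := fun _ => X')
      (fun | 0 => g.down | 1 => g.down | _ + 2 => h.down) (fun _ => f.down)))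
  | .inr X, .inr X', .inl Y, .inl Y', .inr Z, .inr Z', f, g, h =>
    (forgetGrade E.H).map_injective (assoc_natural_101 (E.withHoms
      (m := fun | 0 => Y | _ + 1 => Y) (m' := fun | 0 => Y' | _ + 1 => Y')
      (o := fun | 0 => X | 1 => X | _ + 2 => Z) (o' := fun | 0 => X' | 1 => X' | _ + 2 => Z')
      (fun | 0 => g.down | _ + 1 => g.down) (fun | 0 => f.down | 1 => f.down | _ + 2 => h.down)))
  | .inr X, .inr X', .inr Y, .inr Y', .inl Z, .inl Z', f, g, h =>
    (forgetGrade E.H).map_injective (assoc_natural_110 (E.withHoms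
      (m := fun | 0 => Z | 1 => Z | _ + 2 => Z) (m' := fun | 0 => Z' | 1 => Z' | _ + 2 => Z')
      (o := fun | 0 => X | _ + 1 => Y) (o' := fun | 0 => X' | _ + 1 => Y')
      (fun | 0 => h.down | 1 => h.down | _ + 2 => h.down) (fun | 0 => f.down | _ + 1 => g.down)))
  | .inr X, .inr X', .inr Y, .inr Y', .inr Z, .inr Z', f, g, h =>
    (forgetGrade E.H).map_injective (assoc_natural_111 (E.withHoms
      (m := fun _ => trivialModule E.H) (m' := fun _ => trivialModule E.H)
      (o := fun | 0 => X | 1 => Y | _ + 2 => Z) (o' := fun | 0 => X' | 1 => Y' | _ + 2 => Z')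
      (fun _ => 𝟙 _) (fun | 0 => f.down | 1 => g.down | _ + 2 => h.down)))

/-- After forgetting the action, each grade is definitionally the pentagon in `S` for a suitable
choice of families. -/
theorem assocIso_pentagon (E : Model S) : ∀ W X Y Z : Ext E.H,
    starHom (𝟙 W) (E.assocIso X Y Z).hom ≫ (E.assocIso W (starObj X Y) Z).hom ≫
        starHom (E.assocIso W X Y).hom (𝟙 Z) =
      (E.assocIso W X (starObj Y Z)).hom ≫ (E.assocIso (starObj W X) Y Z).hom
  | .inl W, .inl X, .inl Y, .inl Z => (forgetGrade E.H).map_injective (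
    pentagon_0000 (E.withObjects (fun | 0 => W | 1 => X | 2 => Y | _ + 3 => Z) (fun _ => 𝟙_ S)))
  | .inl W, .inl X, .inl Y, .inr Z => (forgetGrade E.H).map_injective (
    pentagon_0001 (E.withObjects (fun | 0 => W | 1 => X | _ + 2 => Y) (fun | 0 => Z | 1 => Z | 2 => Z | _ + 3 => Z)))
  | .inl W, .inl X, .inr Y, .inl Z => (forgetGrade E.H).map_injective (
    pentagon_0010 (E.withObjects (fun | 0 => W | 1 => X | 2 => W | _ + 3 => Z) (fun | 0 => Y | 1 => Y | _ + 2 => Y)))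
  | .inl W, .inl X, .inr Y, .inr Z => (forgetGrade E.H).map_injective (
    pentagon_0011 (E.withObjects (fun | 0 => W | _ + 1 => X) (fun | 0 => Y | 1 => Y | 2 => Y | _ + 3 => Z)))
  | .inl W, .inr X, .inl Y, .inl Z => (forgetGrade E.H).map_injective (
    pentagon_0100 (E.withObjects (fun | 0 => W | 1 => W | 2 => Y | _ + 3 => Z) (fun | 0 => X | _ + 1 => X)))
  | .inl W, .inr X, .inl Y, .inr Z => (forgetGrade E.H).map_injective (
    pentagon_0101 (E.withObjects (fun | 0 => W | 1 => W | _ + 2 => Y) (fun | 0 => X | 1 => X | 2 => X | _ + 3 => Z)))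
  | .inl W, .inr X, .inr Y, .inl Z => (forgetGrade E.H).map_injective (
    pentagon_0110 (E.withObjects (fun | 0 => W | 1 => W | 2 => W | _ + 3 => Z) (fun | 0 => X | 1 => X | _ + 2 => Y)))
  | .inl W, .inr X, .inr Y, .inr Z => (forgetGrade E.H).map_injective (
    pentagon_0111 (E.withObjects (fun _ => W) (fun | 0 => X | 1 => X | 2 => Y | _ + 3 => Z)))
  | .inr W, .inl X, .inl Y, .inl Z => (forgetGrade E.H).map_injective (
    pentagon_1000 (E.withObjects (fun | 0 => X | 1 => X | 2 => Y | _ + 3 => Z) (fun _ => W)))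
  | .inr W, .inl X, .inl Y, .inr Z => (forgetGrade E.H).map_injective (
    pentagon_1001 (E.withObjects (fun | 0 => X | 1 => X | _ + 2 => Y) (fun | 0 => W | 1 => W | 2 => W | _ + 3 => Z)))
  | .inr W, .inl X, .inr Y, .inl Z => (forgetGrade E.H).map_injective (
    pentagon_1010 (E.withObjects (fun | 0 => X | 1 => X | 2 => X | _ + 3 => Z) (fun | 0 => W | 1 => W | _ + 2 => Y)))
  | .inr W, .inl X, .inr Y, .inr Z => (forgetGrade E.H).map_injective (
    pentagon_1011 (E.withObjects (fun | 0 => X | _ + 1 => X) (fun | 0 => W | 1 => W | 2 => Y | _ + 3 => Z)))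
  | .inr W, .inr X, .inl Y, .inl Z => (forgetGrade E.H).map_injective (
    pentagon_1100 (E.withObjects (fun | 0 => Y | 1 => Y | 2 => Y | _ + 3 => Z) (fun | 0 => W | _ + 1 => X)))
  | .inr W, .inr X, .inl Y, .inr Z => (forgetGrade E.H).map_injective (
    pentagon_1101 (E.withObjects (fun | 0 => Y | 1 => Y | _ + 2 => Y) (fun | 0 => W | 1 => X | 2 => W | _ + 3 => Z)))
  | .inr W, .inr X, .inr Y, .inl Z => (forgetGrade E.H).map_injective (
    pentagon_1110 (E.withObjects (fun | 0 => Z | 1 => Z | 2 => Z | _ + 3 => Z) (fun | 0 => W | 1 => X | _ + 2 => Y)))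
  | .inr W, .inr X, .inr Y, .inr Z => (forgetGrade E.H).map_injective (
    pentagon_1111 (E.withObjects (fun _ => trivialModule E.H) (fun | 0 => W | 1 => X | 2 => Y | _ + 3 => Z)))

theorem assocIso_triangle (E : Model S) : ∀ X Y : Ext E.H,
    (E.assocIso X (starUnit E.H) Y).hom ≫ starHom (starRightUnitor X).hom (𝟙 Y) =
      starHom (𝟙 X) (starLeftUnitor Y).hom
  | .inl X, .inl Y => (forgetGrade E.H).map_injective (
    tensor_triangle X.X Y.X)
  | .inl X, .inr Y => (forgetGrade E.H).map_injective (
    tensor_triangle X.X Y)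
  | .inr X, .inl Y => (forgetGrade E.H).map_injective (
    tensor_triangle X Y.X)
  | .inr X, .inr Y => (forgetGrade E.H).map_injective (
    triangle_101 (E.withObjects (fun _ => trivialModule E.H)
      (fun | 0 => X | _ + 1 => Y)))

end

/-! ### Functoriality of the graded tensor product and assembly -/

section

variable {S : Type u} [Category.{v} S] [MonoidalCategory S] [SymmetricCategory S]

lemma starHom_id {H : S} [HopfObj H] (X Y : Ext H) : starHom (𝟙 X) (𝟙 Y) = 𝟙 (starObj X Y) := by
  apply (forgetGrade H).map_injective
  match X, Y with
  | .inl A, .inl B => exact id_tensorHom_id A.X B.X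
  | .inl A, .inr Y => exact id_tensorHom_id A.X Y
  | .inr X, .inl B => exact id_tensorHom_id X B.X
  | .inr X, .inr Y => exact (congrArg (H ◁ ·) (id_tensorHom_id X Y)).trans (whiskerLeft_id _ _)

lemma starHom_comp {H : S} [HopfObj H] {X X' X'' Y Y' Y'' : Ext H} (f : X ⟶ X') (g : Y ⟶ Y')
    (f' : X' ⟶ X'') (g' : Y' ⟶ Y'') :
    starHom f g ≫ starHom f' g' = starHom (f ≫ f') (g ≫ g') := by
  apply (forgetGrade H).map_injective
  match X, X', X'', Y, Y', Y'', f, g, f', g' with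
  | .inl _, .inl _, .inl _, .inl _, .inl _, .inl _, f, g, f', g' =>
    exact tensorHom_comp_tensorHom f.down.hom g.down.hom f'.down.hom g'.down.hom
  | .inl _, .inl _, .inl _, .inr _, .inr _, .inr _, f, g, f', g' =>
    exact tensorHom_comp_tensorHom f.down.hom g.down f'.down.hom g'.down
  | .inr _, .inr _, .inr _, .inl _, .inl _, .inl _, f, g, f', g' =>
    exact tensorHom_comp_tensorHom f.down g.down.hom f'.down g'.down.hom
  | .inr _, .inr _, .inr _, .inr _, .inr _, .inr _, f, g, f', g' =>
    exact (whiskerLeft_comp H _ _).symm.trans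
      (congrArg (H ◁ ·) (tensorHom_comp_tensorHom f.down g.down f'.down g'.down))

lemma starLeftUnitor_natural {H : S} [HopfObj H] {X Y : Ext H} (f : X ⟶ Y) :
    starHom (𝟙 (starUnit H)) f ≫ (starLeftUnitor Y).hom = (starLeftUnitor X).hom ≫ f := by
  apply (forgetGrade H).map_injective
  match X, Y, f with
  | .inl A, .inl B, f =>
    have h : (𝟙 (𝟙_ S) ⊗ₘ f.down.hom) ≫ (λ_ B.X).hom = (λ_ A.X).hom ≫ f.down.hom := by simp
    exact h
  | .inr A, .inr B, f =>
    have h : (𝟙 (𝟙_ S) ⊗ₘ f.down) ≫ (λ_ B).hom = (λ_ A).hom ≫ f.down := by simp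
    exact h

lemma starRightUnitor_natural {H : S} [HopfObj H] {X Y : Ext H} (f : X ⟶ Y) :
    starHom f (𝟙 (starUnit H)) ≫ (starRightUnitor Y).hom = (starRightUnitor X).hom ≫ f := by
  apply (forgetGrade H).map_injective
  match X, Y, f with
  | .inl A, .inl B, f =>
    have h : (f.down.hom ⊗ₘ 𝟙 (𝟙_ S)) ≫ (ρ_ B.X).hom = (ρ_ A.X).hom ≫ f.down.hom := by simp
    exact h
  | .inr A, .inr B, f =>
    have h : (f.down ⊗ₘ 𝟙 (𝟙_ S)) ≫ (ρ_ B).hom = (ρ_ A).hom ≫ f.down := by simp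
    exact h

/-- The monoidal structure. -/
@[reducible] noncomputable def Model.monoidalCategory (E : Model S) : MonoidalCategory (Ext E.H) :=
  letI : MonoidalCategoryStruct (Ext E.H) := starStruct fun X Y Z => (E.assocIso X Y Z).symm
  MonoidalCategory.ofTensorHom
    (id_tensorHom_id := starHom_id)
    (id_tensorHom := fun _ _ _ _ => rfl)
    (tensorHom_id := fun _ _ => rfl)
    (tensorHom_comp_tensorHom := starHom_comp)
    (associator_naturality := fun {X₁ X₂ X₃ Y₁ Y₂ Y₃} f g h => by
      have e : starHom (starHom f g) h ≫ (E.assocIso Y₁ Y₂ Y₃).inv =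
          (E.assocIso X₁ X₂ X₃).inv ≫ starHom f (starHom g h) := by
        rw [Iso.comp_inv_eq, Category.assoc, assocIso_natural, Iso.inv_hom_id_assoc]
      exact e)
    (leftUnitor_naturality := starLeftUnitor_natural)
    (rightUnitor_naturality := starRightUnitor_natural)
    (pentagon := fun W X Y Z => by
      have e₁ : starHom (E.assocIso W X Y).inv (𝟙 Z) ≫ starHom (E.assocIso W X Y).hom (𝟙 Z) =
          𝟙 _ := by
        rw [starHom_comp, Iso.inv_hom_id, Category.comp_id, starHom_id]
      have e₂ : starHom (𝟙 W) (E.assocIso X Y Z).inv ≫ starHom (𝟙 W) (E.assocIso X Y Z).hom =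
          𝟙 _ := by
        rw [starHom_comp, Iso.inv_hom_id, Category.comp_id, starHom_id]
      have e : starHom (E.assocIso W X Y).inv (𝟙 Z) ≫ (E.assocIso W (starObj X Y) Z).inv ≫
            starHom (𝟙 W) (E.assocIso X Y Z).inv =
          (E.assocIso (starObj W X) Y Z).inv ≫ (E.assocIso W X (starObj Y Z)).inv := by
        -- The pentagon is known for the isomorphisms in the direction of the theorem. Cancelling
        -- the two inverses on the right side turns it into the pentagon for the inverses.
        rw [← cancel_mono (E.assocIso W X (starObj Y Z)).hom,
          ← cancel_mono (E.assocIso (starObj W X) Y Z).hom, Category.assoc _ _ (Iso.hom _),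
          Category.assoc _ _ (Iso.hom _), ← assocIso_pentagon]
        simp only [Category.assoc, Iso.inv_hom_id_assoc, reassoc_of% e₂]
        rw [assocIso_pentagon, Iso.inv_hom_id_assoc, Iso.inv_hom_id, e₁]
      exact e)
    (triangle := fun X Y => by
      have e : (E.assocIso X (starUnit E.H) Y).inv ≫ starHom (𝟙 X) (starLeftUnitor Y).hom =
          starHom (starRightUnitor X).hom (𝟙 Y) := by
        rw [← assocIso_triangle, Iso.inv_hom_id_assoc]
      exact e)

end

end HopfExtension

theorem theorem1 {S : Type u} [Category.{v} S] [MonoidalCategory S] [SymmetricCategory S]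
    [RigidCategory S] [PivotalSymmetricCategory S]
    (H : S) [HopfObj H] [IsIso (HopfObj.antipode (X := H))]
    (cop : 𝟙_ S ⟶ H ⊗ H) (lam : H ⟶ 𝟙_ S) (g ginv : 𝟙_ S ⟶ H)
    (hcop : HopfExtension.IsHopfCopairing cop)
    (hnondeg : HopfExtension.IsNondegenerate cop)
    (hlam : HopfExtension.IsRightCointegral lam)
    (hg : Δ[H] ≫ H ◁ lam ≫ (ρ_ H).hom = lam ≫ g)
    (hginv : HopfExtension.IsInversePoints g ginv)
    (hnorm : cop ≫ H ◁ HopfObj.antipode ≫ (lam ⊗ₘ lam) ≫ (λ_ (𝟙_ S)).hom = 𝟙 (𝟙_ S))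
    (hsymm : cop ≫ (β_ H H).hom =
      cop ≫ H ◁ ((HopfExtension.leftMul ginv ≫ HopfExtension.rightMul g) ≫
        HopfObj.antipode ≫ HopfObj.antipode)) :
    ∃ a : ∀ X Y Z : HopfExtension.Ext H,
        HopfExtension.starObj X (HopfExtension.starObj Y Z) ≅
          HopfExtension.starObj (HopfExtension.starObj X Y) Z,
      (∀ X Y Z : HopfExtension.Ext H, (HopfExtension.forgetGrade H).map (a X Y Z).hom =
        HopfExtension.assocMor cop lam g X Y Z) ∧
      ∃ M : MonoidalCategory (HopfExtension.Ext H),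
        M.toMonoidalCategoryStruct = HopfExtension.starStruct (fun X Y Z => (a X Y Z).symm) := by
  obtain ⟨p, rfl⟩ := hnondeg
  -- Non-degeneracy supplies `ev`. The families of modules and objects are placeholders, replaced
  -- whenever a coherence equation is used.
  let E : HopfExtension.Model S :=
    { H := H
      cop := p.coevaluation'
      ev := p.evaluation'
      lam := lam
      g := g
      ginv := ginv
      cop_hopf := hcop
      cop_ev := p.coevaluation_evaluation'
      ev_cop := p.evaluation_coevaluation'
      lam_right := hlam
      lam_left := hg
      g_ginv := hginv
      lam_lam := hnorm
      cop_symm := hsymm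
      mod := fun _ => HopfExtension.trivialModule H
      mod' := fun _ => HopfExtension.trivialModule H
      modHom := fun _ => 𝟙 _
      obj := fun _ => 𝟙_ S
      obj' := fun _ => 𝟙_ S
      objHom := fun _ => 𝟙 _ }
  exact ⟨E.assocIso, E.forgetGrade_map_assocIso_hom, E.monoidalCategory, rfl⟩
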